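/- Let $k$ be a commutative ring. All DGAs are $\mathbb Z$-graded augmented differential graded $k$-algebras with differential of degree $+1$, and all DGCs are coaugmented; tensor products carry the Koszul signs. For a DGA $A$ with augmentation $\varepsilon$ and augmentation ideal $\bar A$, let $BA$ be the bar construction: the tensor coalgebra on $s^{-1}\bar A$ (so $|[a]|=|a|-1$) with differential the coderivation determined by $[a]\mapsto -[da]$ and $[a|b]\mapsto(-1)^{|[a]|}[ab]$, and let $t_A\colon BA\to A$, $[a]\mapsto a$ (and $0$ on words of length $\neq1$), be its tautological twisting cochain. For a DGC $C$ with coaugmentation coideal $\bar C$, let $\Omega C$ be the cobar construction: the tensor algebra on $s\bar C$ (so $|\langle c\rangle|=|c|+1$) with $d\langle c\rangle=-\langle dc\rangle+\sum(-1)^{|c_{(1)}|}\langle c_{(1)}\rangle\langle c_{(2)}\rangle$. A twisting cochain $t\colon C\to A$ (degree $1$, $\varepsilon t=0=t\eta$, $dt+td=t\cup t$, where $(t\cup t)(c)=\sum(-1)^{|c_{(1)}|}t(c_{(1)})t(c_{(2)})$) induces the DGA map $\Omega C\to A$, $\langle c\rangle\mapsto t(c)$; let $\alpha_A\colon\Omega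 BA\to A$ be the map induced by $t_A$. Let $A_1,A_2$ be DGAs. * $\gamma\colon\Omega(BA_1\otimes BA_2)\to\Omega BA_1\otimes\Omega BA_2$ is the DGA map with $\langle x\otimes y\rangle\mapsto\varepsilon(y)\,\langle x\rangle\otimes1+\varepsilon(x)\,1\otimes\langle y\rangle$. * $\nabla\colon BA_1\otimes BA_2\to B(A_1\otimes A_2)$ is the shuffle map: it sends $[a_1|\cdots|a_p]\otimes[b_1|\cdots|b_q]$ to the sum of all $(p,q)$-shuffles, with Koszul signs, of $[a_1\otimes1|\cdots|a_p\otimes1|1\otimes b_1|\cdots|1\otimes b_q]$. It is a DGC map. * $\psi\colon\Omega B(A_1\otimes A_2)\to\Omega BA_1\otimes\Omega BA_2$ is Munkholm's natural map, defined as follows. The map $\alpha_A$ has the chain section $\beta_A(a)=\varepsilon(a)+\langle[a-\varepsilon(a)]\rangle$ and the homotopy $h_A$, $dh_A+h_Ad=1-\beta_A\alpha_A$, $\alpha_Ah_A=0$, given by $h_A(1)=h_A\langle c\rangle=0$ and $$h_A(\langle c_1\rangle\cdots\langle c_n\rangle)=\sum_{i=1}^{n-1}\sigma\big(t_A(c_1)\cdots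 t_A(c_i),\,c_{i+1}\big)\langle c_{i+2}\rangle\cdots\langle c_n\rangle,$$ where $\sigma(a,\,c)=-(-1)^{|a|}\,\langle[a-\varepsilon(a)\,|\,c-\varepsilon(c)]\rangle$, the bracket denoting the word $c-\varepsilon(c)$ with the letter $[a-\varepsilon(a)]$ put in front. Write $\alpha_i,\beta_i,h_i$ for these maps for $A_i$. Put $\beta=\beta_1\otimes\beta_2$, and let $h$ be either of the two tensor product homotopies $h_1\otimes1+\beta_1\alpha_1\otimes h_2$ and $h_1\otimes\beta_2\alpha_2+1\otimes h_2$ on $\Omega BA_1\otimes\Omega BA_2$. Then there is a unique linear map $\tau\colon B(A_1\otimes A_2)\to\Omega BA_1\otimes\Omega BA_2$ with $$\tau=\beta\,t_{A_1\otimes A_2}+h(\tau\cup\tau),\qquad \tau(1)=0;$$ it is a twisting cochain, and $\psi$ is the DGA map it induces, $\psi\langle c\rangle=\tau(c)$. It satisfies $(\alpha_1\otimes\alpha_2)\psi=\alpha_{A_1\otimes A_2}$. Then, for either choice of $h$, $$\gamma=\psi\circ\Omega\nabla\colon\ \Omega(BA_1\otimes BA_2)\to\Omega BA_1\otimes\Omega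 BA_2 .$$ -/

import Mathlib

open scoped TensorProduct DirectSum

universe u v w x y

noncomputable section

/-! ### Shortcut instances, which only save elaboration time -/
section shortcuts
variable {R : Type*} [Semiring R] {M : Type*} {N : Type*} [AddCommMonoid M] [AddCommMonoid N]
  [Module R M] [Module R N]
instance shortcutAdd : AddHomClass (M →ₗ[R] N) M N := inferInstance
instance shortcutAddMonoid : AddMonoidHomClass (M →ₗ[R] N) M N := inferInstance
instance shortcutZero : ZeroHomClass (M →ₗ[R] N) M N := inferInstance
instance shortcutSmul : MulActionHomClass (M →ₗ[R] N) R M N := inferInstance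
instance shortcutAdd' : AddHomClass (M ≃ₗ[R] N) M N := inferInstance
instance shortcutAddMonoid' : AddMonoidHomClass (M ≃ₗ[R] N) M N := inferInstance
instance shortcutZero' : ZeroHomClass (M ≃ₗ[R] N) M N := inferInstance
instance shortcutSmul' : MulActionHomClass (M ≃ₗ[R] N) R M N := inferInstance
instance shortcutTensorAlgebra {k : Type*} [CommSemiring k] {V : Type*} [AddCommMonoid V]
    [Module k V] : Module k (TensorAlgebra k V) := Algebra.toModule
attribute [instance] AddCommGroup.toAddCommMonoid
end shortcuts

/-- A `ℤ`-grading of a `k`-module (cohomological, unbounded). -/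
class GrMod (k : Type u) [CommRing k] (V : Type v) [AddCommGroup V] [Module k V] where
  gr : ℤ → Submodule k V
  [dec : DirectSum.Decomposition gr]

attribute [reducible, instance] GrMod.dec


namespace GrMod

section basics
variable (k : Type u) [CommRing k] (V : Type v) [AddCommGroup V] [Module k V] [GrMod k V]

/-- The homogeneous component of degree `n`. -/
abbrev deg : ℤ → Submodule k V := GrMod.gr

/-- The projection onto the sum of the components of odd degree. -/
def odd : V →ₗ[k] V :=
  DirectSum.toModule k ℤ V (fun n => if Even n then 0 else (deg k V n).subtype) ∘ₗ
    (DirectSum.decomposeLinearEquiv (deg k V)).toLinearMap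

/-- The sign involution `x ↦ (-1)^|x| x`. -/
def sgn : V →ₗ[k] V := LinearMap.id - (2 : k) • odd k V

/-- `x ↦ ∑ x_i T^i`, the components of `x` recorded by their degrees. -/
def coact : V →ₗ[k] (ℤ →₀ V) :=
  DirectSum.toModule k ℤ _ (fun n => Finsupp.lsingle n ∘ₗ (deg k V n).subtype) ∘ₗ
    (DirectSum.decomposeLinearEquiv (deg k V)).toLinearMap

variable {k V}

theorem odd_of_mem {n : ℤ} {x : V} (hx : x ∈ deg k V n) :
    odd k V x = if Even n then 0 else x := by
  simp only [odd, LinearMap.comp_apply, LinearEquiv.coe_coe]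
  rw [DirectSum.decomposeLinearEquiv_apply, DirectSum.decompose_of_mem _ hx,
    ← DirectSum.lof_eq_of k, DirectSum.toModule_lof]
  split_ifs <;> simp

theorem coact_of_mem {n : ℤ} {x : V} (hx : x ∈ deg k V n) :
    coact k V x = Finsupp.single n x := by
  simp only [coact, LinearMap.comp_apply, LinearEquiv.coe_coe]
  rw [DirectSum.decomposeLinearEquiv_apply, DirectSum.decompose_of_mem _ hx,
    ← DirectSum.lof_eq_of k, DirectSum.toModule_lof]
  simp

theorem sgn_of_mem {n : ℤ} {x : V} (hx : x ∈ deg k V n) :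
    sgn k V x = n.negOnePow • x := by
  simp only [sgn, LinearMap.sub_apply, LinearMap.smul_apply, LinearMap.id_apply, odd_of_mem hx]
  split_ifs with h
  · simp [Int.negOnePow_even _ h]
  · rw [Int.negOnePow_odd _ (Int.not_even_iff_odd.mp h)]
    rw [Units.neg_smul, one_smul, two_smul]; abel

variable (k) in
@[elab_as_elim]
theorem hom_induction {P : V → Prop} (x : V) (hom : ∀ n, ∀ y ∈ deg k V n, P y)
    (add : ∀ y z, P y → P z → P (y + z)) : P x := by
  refine DirectSum.Decomposition.inductionOn (deg k V) (hom 0 0 (zero_mem _)) ?_ add x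
  intro i m; exact hom i m m.2

theorem hom_ext' {W : Type*} [AddCommGroup W] [Module k W] {f g : V →ₗ[k] W}
    (h : ∀ n, ∀ y ∈ deg k V n, f y = g y) : f = g := by
  ext x
  refine hom_induction k x h ?_
  intro y z hy hz; rw [map_add, map_add, hy, hz]

theorem odd_odd (x : V) : odd k V (odd k V x) = odd k V x := by
  refine hom_induction k x (fun n y hy => ?_) (fun y z hy hz => by simp only [map_add, hy, hz])
  rw [odd_of_mem hy]; split_ifs with h
  · simp
  · rw [odd_of_mem hy, if_neg h]

theorem sgn_sgn (x : V) : sgn k V (sgn k V x) = x := by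
  simp only [sgn, LinearMap.sub_apply, LinearMap.smul_apply, LinearMap.id_apply, map_sub, map_smul,
    odd_odd]
  module

variable (k V) in
theorem iSup_deg : ⨆ i, deg k V i = ⊤ :=
  (DirectSum.Decomposition.isInternal (deg k V)).submodule_iSup_eq_top
end basics

/-- A family of submodules that spans and is separated by a "coaction" is a grading. -/
@[reducible] def ofCoact {k : Type u} [CommRing k] {V : Type v} [AddCommGroup V] [Module k V]
    (𝒱 : ℤ → Submodule k V) (c : V →ₗ[k] (ℤ →₀ V))
    (hs : ⨆ i, 𝒱 i = ⊤) (hc : ∀ i, ∀ x ∈ 𝒱 i, c x = Finsupp.single i x) :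
    GrMod k V where
  gr := 𝒱
  dec := DirectSum.IsInternal.chooseDecomposition 𝒱 (by
    classical
    rw [DirectSum.isInternal_submodule_iff_iSupIndep_and_iSup_eq_top]
    refine ⟨?_, hs⟩
    intro i
    rw [Submodule.disjoint_def]
    intro x hx hx'
    have h1 : c x i = x := by rw [hc i x hx]; simp
    rw [← h1]
    rw [iSup_subtype'] at hx'
    refine Submodule.iSup_induction _ (motive := fun x => c x i = 0) hx' ?_ (by simp) ?_
    · rintro ⟨j, hj⟩ y hy
      rw [hc j y hy]; simp [hj]
    · intro y z hy hz; rw [map_add, Finsupp.add_apply, hy, hz, add_zero])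

/-- `f` is homogeneous of degree `n`. -/
def HasDeg {k : Type u} [CommRing k] {V : Type v} {W : Type w} [AddCommGroup V] [Module k V]
    [AddCommGroup W] [Module k W] [GrMod k V] [GrMod k W] (f : V →ₗ[k] W) (n : ℤ) : Prop :=
  ∀ m, ∀ x ∈ deg k V m, f x ∈ deg k W (m + n)

section hasdeg
variable {k : Type u} [CommRing k] {V W X: Type*} [AddCommGroup V] [Module k V]
    [AddCommGroup W] [Module k W] [GrMod k V] [GrMod k W] [AddCommGroup X] [Module k X] [GrMod k X]

theorem odd_even {f : V →ₗ[k] W} {n : ℤ} (hf : HasDeg f n) (hn : Even n) (x : V) :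
    odd k W (f x) = f (odd k V x) := by
  refine hom_induction k x (fun m y hy => ?_) (fun y z hy hz => by simp only [map_add, hy, hz])
  rw [odd_of_mem hy, odd_of_mem (hf m y hy)]
  by_cases h : Even m
  · simp [h, hn, Int.even_add]
  · simp [h, hn, Int.even_add]

theorem odd_odd' {f : V →ₗ[k] W} {n : ℤ} (hf : HasDeg f n) (hn : Odd n) (x : V) :
    odd k W (f x) = f x - f (odd k V x) := by
  refine hom_induction k x (fun m y hy => ?_)
    (fun y z hy hz => by simp only [map_add, hy, hz]; abel)
  rw [odd_of_mem hy, odd_of_mem (hf m y hy)]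
  have hn' := Int.not_even_iff_odd.mpr hn
  by_cases h : Even m
  · simp [h, hn', Int.even_add]
  · simp [h, hn', Int.even_add]

theorem sgn_even {f : V →ₗ[k] W} {n : ℤ} (hf : HasDeg f n) (hn : Even n) (x : V) :
    sgn k W (f x) = f (sgn k V x) := by
  simp [sgn, odd_even hf hn]

theorem sgn_odd {f : V →ₗ[k] W} {n : ℤ} (hf : HasDeg f n) (hn : Odd n) (x : V) :
    sgn k W (f x) = - f (sgn k V x) := by
  simp only [sgn, odd_odd' hf hn, LinearMap.sub_apply, LinearMap.smul_apply, LinearMap.id_apply,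
    map_sub, map_smul]; module

theorem HasDeg.comp {f : V →ₗ[k] W} {g : W →ₗ[k] X} {m n p : ℤ} (hg : HasDeg g n) (hf : HasDeg f m)
    (h : m + n = p) : HasDeg (g ∘ₗ f) p := by
  intro i x hx
  have := hg _ _ (hf i x hx)
  rwa [add_assoc, h] at this

theorem HasDeg.add {f g : V →ₗ[k] W} {n : ℤ} (hf : HasDeg f n) (hg : HasDeg g n) :
    HasDeg (f + g) n := fun i x hx => add_mem (hf i x hx) (hg i x hx)

theorem HasDeg.neg {f : V →ₗ[k] W} {n : ℤ} (hf : HasDeg f n) :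
    HasDeg (-f) n := fun i x hx => neg_mem (hf i x hx)

theorem HasDeg.sub {f g : V →ₗ[k] W} {n : ℤ} (hf : HasDeg f n) (hg : HasDeg g n) :
    HasDeg (f - g) n := fun i x hx => sub_mem (hf i x hx) (hg i x hx)

theorem HasDeg.zero (n : ℤ) : HasDeg (0 : V →ₗ[k] W) n := fun _ _ _ => zero_mem _

theorem HasDeg.id : HasDeg (LinearMap.id : V →ₗ[k] V) 0 := fun i x hx => by simpa using hx

theorem HasDeg.odd : HasDeg (odd k V) 0 := fun i x hx => by
  rw [odd_of_mem hx]; split_ifs <;> simp [hx]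

theorem HasDeg.smul {f : V →ₗ[k] W} {n : ℤ} (hf : HasDeg f n) (c : k) :
    HasDeg (c • f) n := fun i x hx => Submodule.smul_mem _ _ (hf i x hx)

theorem HasDeg.sgn : HasDeg (sgn k V) 0 := HasDeg.id.sub (HasDeg.odd.smul 2)

end hasdeg

/-! ### The ground ring, shifts, tensor products, tensor algebras, sub- and quotient modules -/

/-- The ground ring, in degree zero. -/
instance instGround (k : Type u) [CommRing k] : GrMod k k :=
  ofCoact (fun n => if n = 0 then ⊤ else ⊥) (Finsupp.lsingle 0)
    (by rw [eq_top_iff]; refine le_trans ?_ (le_iSup _ 0); simp)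
    (by
      intro i x hx
      by_cases h : i = 0
      · subst h; rfl
      · have : x = 0 := by simpa [h] using hx
        subst this; simp)

theorem mem_ground {k : Type u} [CommRing k] (x : k) : x ∈ deg k k 0 := by
  change x ∈ (if (0:ℤ) = 0 then (⊤ : Submodule k k) else ⊥); simp

theorem eq_zero_of_mem_ground {k : Type u} [CommRing k] {x : k} {n : ℤ} (hn : n ≠ 0)
    (h : x ∈ deg k k n) : x = 0 := by
  change x ∈ (if n = 0 then (⊤ : Submodule k k) else ⊥) at h
  simpa [hn] using h

section tensor
variable (k : Type u) [CommRing k] (V : Type v) [AddCommGroup V] [Module k V] [GrMod k V]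
  (W : Type w) [AddCommGroup W] [Module k W] [GrMod k W]

/-- The total degree on a tensor product. -/
def tensorDeg (n : ℤ) : Submodule k (V ⊗[k] W) :=
  Submodule.span k {t | ∃ i j, i + j = n ∧ ∃ x ∈ deg k V i, ∃ y ∈ deg k W j, t = x ⊗ₜ y}

instance instTensor : GrMod k (V ⊗[k] W) :=
  ofCoact (tensorDeg k V W)
    (Finsupp.lmapDomain (V ⊗[k] W) k (fun p : ℤ × ℤ => p.1 + p.2) ∘ₗ
      (finsuppTensorFinsupp k k V W ℤ ℤ).toLinearMap ∘ₗ
      TensorProduct.map (coact k V) (coact k W))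
    (by
      rw [eq_top_iff, ← TensorProduct.span_tmul_eq_top, Submodule.span_le]
      rintro _ ⟨x, y, rfl⟩
      change x ⊗ₜ[k] y ∈ ⨆ i, tensorDeg k V W i
      refine hom_induction k x (fun i x hx => ?_)
        (fun x x' hx hx' => by rw [TensorProduct.add_tmul]; exact add_mem hx hx')
      refine hom_induction k y (fun j y hy => ?_)
        (fun x x' hx hx' => by rw [TensorProduct.tmul_add]; exact add_mem hx hx')
      exact Submodule.mem_iSup_of_mem (i + j)
        (Submodule.subset_span ⟨i, j, rfl, x, hx, y, hy, rfl⟩))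
    (by
      intro n t ht
      refine Submodule.span_induction ?_ (by simp) (fun x y _ _ hx hy => by
        rw [map_add, hx, hy, Finsupp.single_add]) (fun c x _ hx => by
        rw [map_smul, hx, Finsupp.smul_single]) ht
      rintro _ ⟨i, j, rfl, x, hx, y, hy, rfl⟩
      simp [coact_of_mem hx, coact_of_mem hy, Finsupp.mapDomain_single])

variable {k V W}
theorem tmul_mem {i j n : ℤ} (h : i + j = n) {x : V} {y : W} (hx : x ∈ deg k V i)
    (hy : y ∈ deg k W j) : x ⊗ₜ[k] y ∈ deg k (V ⊗[k] W) n :=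
  Submodule.subset_span ⟨i, j, h, x, hx, y, hy, rfl⟩

theorem hasDeg_tensor {X : Type*} [AddCommGroup X] [Module k X] [GrMod k X]
    {f : V ⊗[k] W →ₗ[k] X} {n : ℤ}
    (h : ∀ i j, ∀ x ∈ deg k V i, ∀ y ∈ deg k W j, f (x ⊗ₜ y) ∈ deg k X (i + j + n)) :
    HasDeg f n := by
  intro m t ht
  refine Submodule.span_induction ?_ (by simp) (fun x y _ _ hx hy => by
        rw [map_add]; exact add_mem hx hy) (fun c x _ hx => by
        rw [map_smul]; exact Submodule.smul_mem _ _ hx) ht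
  rintro _ ⟨i, j, rfl, x, hx, y, hy, rfl⟩
  exact h i j x hx y hy

theorem HasDeg.map {X Y : Type*} [AddCommGroup X] [Module k X] [GrMod k X]
    [AddCommGroup Y] [Module k Y] [GrMod k Y] {f : V →ₗ[k] X} {g : W →ₗ[k] Y} {m n p : ℤ}
    (hf : HasDeg f m) (hg : HasDeg g n) (h : m + n = p) : HasDeg (TensorProduct.map f g) p := by
  refine hasDeg_tensor ?_
  intro i j x hx y hy
  exact tmul_mem (by omega) (hf i x hx) (hg j y hy)

theorem odd_tmul (x : V) (y : W) : odd k (V ⊗[k] W) (x ⊗ₜ y) =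
    odd k V x ⊗ₜ y + x ⊗ₜ odd k W y - (2 : k) • odd k V x ⊗ₜ odd k W y := by
  refine hom_induction k x (fun i x hx => ?_)
    (fun x x' hx hx' => by simp only [map_add, TensorProduct.add_tmul, hx, hx']; module)
  refine hom_induction k y (fun j y hy => ?_)
    (fun x x' hx hx' => by simp only [map_add, TensorProduct.tmul_add, hx, hx']; module)
  rw [odd_of_mem hx, odd_of_mem hy, odd_of_mem (tmul_mem rfl hx hy)]
  by_cases hi : Even i <;> by_cases hj : Even j <;> simp [hi, hj, Int.even_add]
  module

theorem sgn_tmul (x : V) (y : W) : sgn k (V ⊗[k] W) (x ⊗ₜ y) = sgn k V x ⊗ₜ sgn k W y := by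
  simp only [sgn, LinearMap.sub_apply, LinearMap.smul_apply, LinearMap.id_apply, odd_tmul,
    TensorProduct.sub_tmul, TensorProduct.tmul_sub, ← TensorProduct.smul_tmul', TensorProduct.tmul_smul]
  module

end tensor
end GrMod
open GrMod

/-- `Shift n V` is `V` regraded by `(Shift n V)_m = V_{m+n}`. -/
@[nolint unusedArguments]
def Shift (_n : ℤ) (V : Type v) : Type v := V

namespace Shift
variable {k : Type u} [CommRing k] {V : Type v} [AddCommGroup V] [Module k V]
instance (n : ℤ) : AddCommGroup (Shift n V) := inferInstanceAs (AddCommGroup V)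
instance (n : ℤ) : Module k (Shift n V) := inferInstanceAs (Module k V)

/-- The identity, as a map to the shifted module. -/
def mk (k : Type u) [CommRing k] {V : Type v} [AddCommGroup V] [Module k V] (n : ℤ) :
    V ≃ₗ[k] Shift n V := LinearEquiv.refl k V

instance instGr [GrMod k V] (n : ℤ) : GrMod k (Shift n V) :=
  ofCoact (fun m => (deg k V (m + n)).map (mk k n).toLinearMap)
    (Finsupp.lmapDomain (Shift n V) k (fun m => m - n) ∘ₗ
      Finsupp.mapRange.linearMap (mk k n).toLinearMap ∘ₗ coact k V ∘ₗ (mk k n).symm.toLinearMap)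
    (by
      rw [eq_top_iff]
      intro x _
      refine hom_induction k (V := V) (P := fun x : V => (mk k n x) ∈ _) ((mk k n).symm x) ?_ ?_
      · intro i y hy
        refine Submodule.mem_iSup_of_mem (i - n) ?_
        exact ⟨y, by simpa using hy, rfl⟩
      · intro y z hy hz; rw [map_add]; exact add_mem hy hz)
    (by
      rintro i _ ⟨y, hy, rfl⟩
      simp [coact_of_mem hy, Finsupp.mapDomain_single])

theorem hasDeg_mk [GrMod k V] (n : ℤ) : HasDeg (mk k n : V ≃ₗ[k] Shift n V).toLinearMap (-n) := by
  intro m x hx; exact ⟨x, by simpa using hx, rfl⟩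
theorem hasDeg_mk_symm [GrMod k V] (n : ℤ) :
    HasDeg (mk k n : V ≃ₗ[k] Shift n V).symm.toLinearMap n := by
  rintro m x ⟨y, hy, rfl⟩; simpa using hy
end Shift

namespace GrMod
section subquot
variable {k : Type u} [CommRing k] {V : Type v} [AddCommGroup V] [Module k V]

/-- The projection of `V` to `ker e` along a vector `z` with `e z = 1`. -/
def toKer (e : V →ₗ[k] k) (z : V) (h1 : e z = 1) : V →ₗ[k] LinearMap.ker e :=
  (LinearMap.id - e.smulRight z).codRestrict _ (fun x => by simp [h1])

theorem coe_toKer (e : V →ₗ[k] k) (z : V) (h1 : e z = 1) (x : V) :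
    (toKer e z h1 x : V) = x - e x • z := rfl

variable [GrMod k V]

theorem smul_mem_deg {e : V →ₗ[k] k} (he : HasDeg e 0) {z : V} (hz : z ∈ deg k V 0) {n : ℤ} {x : V}
    (hx : x ∈ deg k V n) : e x • z ∈ deg k V n := by
  by_cases hn : n = 0
  · subst hn; exact Submodule.smul_mem _ _ hz
  · have := he n x hx
    rw [add_zero] at this
    rw [eq_zero_of_mem_ground hn this, zero_smul]; exact zero_mem _

/-- The kernel of a functional of degree zero, as a graded submodule. -/
@[reducible] def kerGr (e : V →ₗ[k] k) (he : HasDeg e 0) (z : V) (hz : z ∈ deg k V 0)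
    (h1 : e z = 1) : GrMod k (LinearMap.ker e) :=
  ofCoact (fun n => (deg k V n).comap (LinearMap.ker e).subtype)
    (Finsupp.mapRange.linearMap (toKer e z h1) ∘ₗ coact k V ∘ₗ (LinearMap.ker e).subtype)
    (by
      rw [eq_top_iff]
      intro x _
      have hx : toKer e z h1 x = x := by
        ext; rw [coe_toKer, LinearMap.mem_ker.mp x.2]; simp
      rw [← hx]
      generalize (x : V) = y
      refine hom_induction k y (fun n y hy => ?_) (fun y y' h h' => by
        rw [map_add]; exact add_mem h h')
      refine Submodule.mem_iSup_of_mem n ?_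
      exact sub_mem hy (smul_mem_deg he hz hy))
    (by
      intro n x hx
      have hx' : toKer e z h1 x = x := by
        ext; rw [coe_toKer, LinearMap.mem_ker.mp x.2]; simp
      have : (LinearMap.ker e).subtype x ∈ deg k V n := hx
      simp only [LinearMap.comp_apply, coact_of_mem this]
      simp [hx'])

/-- The quotient by the line through a vector of degree zero. -/
@[reducible] def quotGr (f : k →ₗ[k] V) (hf : f 1 ∈ deg k V 0) :
    GrMod k (V ⧸ LinearMap.range f) :=
  ofCoact (fun n => (deg k V n).map (LinearMap.range f).mkQ)
    ((LinearMap.range f).liftQ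
      (Finsupp.mapRange.linearMap (LinearMap.range f).mkQ ∘ₗ coact k V)
      (by
        rintro _ ⟨c, rfl⟩
        have : f c = c • f 1 := by rw [← map_smul]; simp
        rw [LinearMap.mem_ker, this, map_smul]
        simp only [LinearMap.comp_apply, coact_of_mem hf]
        have : (LinearMap.range f).mkQ (f 1) = 0 := by simp
        simp only [Finsupp.mapRange.linearMap_apply, Finsupp.mapRange_single, this,
          Finsupp.single_zero, smul_zero]))
    (by
      rw [eq_top_iff]
      intro x _
      obtain ⟨y, rfl⟩ := Submodule.mkQ_surjective _ x
      refine hom_induction k y (fun n y hy => ?_) (fun y y' h h' => by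
        rw [map_add]; exact add_mem h h')
      exact Submodule.mem_iSup_of_mem n ⟨y, hy, rfl⟩)
    (by
      rintro n _ ⟨y, hy, rfl⟩
      simp [coact_of_mem hy])
end subquot
end GrMod

namespace GrMod
section alg
variable {k : Type u} [CommRing k] {A : Type v} [Ring A] [Algebra k A] [GrMod k A]
  [SetLike.GradedMonoid (deg k A)]

instance instGradedAlgebra : GradedAlgebra (deg k A) where
  toDecomposition := GrMod.dec

theorem one_mem_deg : (1 : A) ∈ deg k A 0 := SetLike.GradedOne.one_mem
theorem mul_mem_deg {i j n : ℤ} (h : i + j = n) {x y : A} (hx : x ∈ deg k A i)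
    (hy : y ∈ deg k A j) : x * y ∈ deg k A n := h ▸ SetLike.GradedMul.mul_mem hx hy

theorem odd_one : odd k A 1 = 0 := by rw [odd_of_mem one_mem_deg]; simp
theorem sgn_one : sgn k A 1 = 1 := by rw [sgn_of_mem one_mem_deg]; simp

theorem odd_mul (x y : A) : odd k A (x * y) =
    odd k A x * y + x * odd k A y - (2 : k) • (odd k A x * odd k A y) := by
  refine hom_induction k x (fun i x hx => ?_)
    (fun x x' hx hx' => by simp only [map_add, add_mul, hx, hx']; module)
  refine hom_induction k y (fun j y hy => ?_)
    (fun x x' hx hx' => by simp only [map_add, mul_add, hx, hx']; module)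
  rw [odd_of_mem hx, odd_of_mem hy, odd_of_mem (mul_mem_deg rfl hx hy)]
  by_cases hi : Even i <;> by_cases hj : Even j <;> simp [hi, hj, Int.even_add]
  module

theorem sgn_mul (x y : A) : sgn k A (x * y) = sgn k A x * sgn k A y := by
  simp only [sgn, LinearMap.sub_apply, LinearMap.smul_apply, LinearMap.id_apply, odd_mul,
    sub_mul, mul_sub, smul_mul_assoc, mul_smul_comm]
  module
end alg

section gtp
variable {k : Type u} [CommRing k] {A : Type v} [Ring A] [Algebra k A] [GrMod k A]
  [SetLike.GradedMonoid (deg k A)] {B : Type w} [Ring B] [Algebra k B] [GrMod k B]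
  [SetLike.GradedMonoid (deg k B)]

variable (k A B) in
/-- The tensor product of graded algebras, `(a ⊗ b)(a' ⊗ b') = (-1)^{|b||a'|} aa' ⊗ bb'`. -/
abbrev GTP := GradedTensorProduct k (deg k A) (deg k B)

/-- The total grading. -/
instance : GrMod k (GTP k A B) := inferInstanceAs (GrMod k (A ⊗[k] B))

variable (k A B) in
/-- The bilinear map `(a, b) ↦ a ⊗ b`. -/
def gt : A →ₗ[k] B →ₗ[k] GTP k A B :=
  (TensorProduct.mk k A B).compr₂ (GradedTensorProduct.of k (deg k A) (deg k B)).toLinearMap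

theorem gt_def (a : A) (b : B) : gt k A B a b = GradedTensorProduct.tmul k a b := rfl

theorem gt_mul (a a' : A) (b b' : B) :
    gt k A B a b * gt k A B a' b' = gt k A B (a * a') (b * b') -
       (2 : k) • gt k A B (a * odd k A a') (odd k B b * b') := by
  refine hom_induction k a' (fun i x hx => ?_)
    (fun x x' hx hx' => by
      simp only [map_add, mul_add, hx, hx', LinearMap.add_apply, smul_add]; abel)
  refine hom_induction k b (fun j y hy => ?_)
    (fun x x' hx hx' => by
      simp only [map_add, add_mul, hx, hx', smul_add]; abel)
  have := GradedTensorProduct.tmul_coe_mul_coe_tmul (R := k) (deg k A) (deg k B) a ⟨y, hy⟩ ⟨x, hx⟩ b'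
  simp only [← gt_def] at this
  rw [this, odd_of_mem hx, odd_of_mem hy]
  change (j * i).negOnePow • _ = _
  by_cases hi : Even i
  · rw [Int.negOnePow_even _ (hi.mul_left j)]; simp [hi]
  by_cases hj : Even j
  · rw [Int.negOnePow_even _ (hj.mul_right i)]; simp [hj]
  rw [if_neg hi, if_neg hj, Int.negOnePow_odd _
    ((Int.not_even_iff_odd.mp hj).mul (Int.not_even_iff_odd.mp hi))]
  rw [Units.neg_smul, one_smul, two_smul]; abel

theorem gt_mem {i j n : ℤ} (h : i + j = n) {x : A} {y : B} (hx : x ∈ deg k A i)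
    (hy : y ∈ deg k B j) : gt k A B x y ∈ deg k (GTP k A B) n :=
  tmul_mem h hx hy

theorem gt_one : gt k A B 1 1 = 1 := rfl

@[elab_as_elim]
theorem gt_induction {P : GTP k A B → Prop} (t : GTP k A B) (gt : ∀ a b, P (gt k A B a b))
    (add : ∀ s t, P s → P t → P (s + t)) : P t := by
  refine TensorProduct.induction_on (motive := P) t ?_ gt add
  have := gt 0 0
  rw [map_zero] at this
  exact this

@[elab_as_elim]
theorem gt_deg_induction {n : ℤ} {P : GTP k A B → Prop} {t : GTP k A B} (ht : t ∈ deg k (GTP k A B) n)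
    (gt : ∀ i j, i + j = n → ∀ a ∈ deg k A i, ∀ b ∈ deg k B j, P (gt k A B a b))
    (add : ∀ s t, P s → P t → P (s + t)) (smul : ∀ (c : k) t, P t → P (c • t)) : P t := by
  refine Submodule.span_induction (p := fun t _ => P t) ?_ ?_ (fun x y _ _ hx hy => add x y hx hy)
    (fun c x _ hx => smul c x hx) ht
  · rintro _ ⟨i, j, h, x, hx, y, hy, rfl⟩
    exact gt i j h x hx y hy
  · simpa using gt n 0 (by simp) 0 (zero_mem _) 0 (zero_mem _)

instance : SetLike.GradedMonoid (deg k (GTP k A B)) where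
  one_mem := gt_mem (add_zero 0) one_mem_deg one_mem_deg
  mul_mem := by
    intro m n s t hs ht
    refine gt_deg_induction hs ?_ (fun x y hx hy => by rw [add_mul]; exact add_mem hx hy)
      (fun c x hx => by rw [smul_mul_assoc]; exact Submodule.smul_mem _ _ hx)
    rintro i j rfl x hx y hy
    refine gt_deg_induction ht ?_ (fun x y hx hy => by rw [mul_add]; exact add_mem hx hy)
      (fun c x hx => by rw [mul_smul_comm]; exact Submodule.smul_mem _ _ hx)
    rintro i' j' rfl x' hx' y' hy'
    rw [gt_mul]
    refine sub_mem ?_ (Submodule.smul_mem _ _ ?_)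
    · exact gt_mem (by omega) (mul_mem_deg (k := k) rfl hx hx') (mul_mem_deg (k := k) rfl hy hy')
    · have h1 := HasDeg.odd (k := k) i' x' hx'
      have h2 := HasDeg.odd (k := k) j y hy
      exact gt_mem (by omega) (mul_mem_deg (k := k) rfl hx h1) (mul_mem_deg (k := k) rfl h2 hy')

theorem sgn_gt (x : A) (y : B) :
    sgn k (GTP k A B) (gt k A B x y) = gt k A B (sgn k A x) (sgn k B y) := sgn_tmul x y
end gtp

/-! ### The tensor algebra -/
section tensorAlgebra
variable (k : Type u) [CommRing k] (V : Type v) [AddCommGroup V] [Module k V] [GrMod k V]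

/-- The total degree on the tensor algebra. -/
def wordDeg (n : ℤ) : Submodule k (TensorAlgebra k V) :=
  Submodule.span k {t | ∃ l : List (ℤ × V), (∀ p ∈ l, p.2 ∈ deg k V p.1) ∧
    (l.map Prod.fst).sum = n ∧ t = (l.map fun p => TensorAlgebra.ι k p.2).prod}

/-- `v₁⋯vₙ ↦ v₁⋯vₙ T^{|v₁|+⋯+|vₙ|}`. -/
def wordCoact : TensorAlgebra k V →ₐ[k] AddMonoidAlgebra (TensorAlgebra k V) ℤ :=
  TensorAlgebra.lift k ((AddMonoidAlgebra.coeffLinearEquiv k).symm.toLinearMap ∘ₗ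
    Finsupp.mapRange.linearMap (TensorAlgebra.ι k) ∘ₗ coact k V)

variable {k V}
theorem wordDeg_mul {m n : ℤ} {s t : TensorAlgebra k V} (hs : s ∈ wordDeg k V m)
    (ht : t ∈ wordDeg k V n) : s * t ∈ wordDeg k V (m + n) := by
  refine Submodule.span_induction ?_ (by simp) (fun x y _ _ hx hy => by
        rw [add_mul]; exact add_mem hx hy) (fun c x _ hx => by
        rw [smul_mul_assoc]; exact Submodule.smul_mem _ _ hx) hs
  rintro _ ⟨l, hl, rfl, rfl⟩
  refine Submodule.span_induction ?_ (by simp) (fun x y _ _ hx hy => by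
        rw [mul_add]; exact add_mem hx hy) (fun c x _ hx => by
        rw [mul_smul_comm]; exact Submodule.smul_mem _ _ hx) ht
  rintro _ ⟨l', hl', rfl, rfl⟩
  refine Submodule.subset_span ⟨l ++ l', ?_, by simp, by simp⟩
  intro p hp
  rcases List.mem_append.mp hp with h | h
  · exact hl p h
  · exact hl' p h

theorem wordDeg_one : (1 : TensorAlgebra k V) ∈ wordDeg k V 0 :=
  Submodule.subset_span ⟨[], by simp, by simp, by simp⟩

theorem wordDeg_ι {n : ℤ} {v : V} (hv : v ∈ deg k V n) : TensorAlgebra.ι k v ∈ wordDeg k V n :=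
  Submodule.subset_span ⟨[(n, v)], by simpa using hv, by simp, by simp⟩

/-- Induction on words. -/
@[elab_as_elim]
theorem word_induction {V : Type v} [AddCommGroup V] [Module k V]
    {P : TensorAlgebra k V → Prop} (x : TensorAlgebra k V)
    (one : P 1) (smul : ∀ (c : k) x, P x → P (c • x)) (add : ∀ x y, P x → P y → P (x + y))
    (cons : ∀ v x, P x → P (TensorAlgebra.ι k v * x)) : P x := by
  have : ∀ y, P y → P (x * y) := by
    induction x using TensorAlgebra.induction with
    | algebraMap r => intro y hy; rw [← Algebra.smul_def]; exact smul r y hy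
    | ι v => intro y hy; exact cons v y hy
    | mul a b ha hb => intro y hy; rw [mul_assoc]; exact ha _ (hb _ hy)
    | add a b ha hb => intro y hy; rw [add_mul]; exact add _ _ (ha _ hy) (hb _ hy)
  simpa using this 1 one

theorem word_ext {V : Type v} [AddCommGroup V] [Module k V] {N : Type*} [AddCommGroup N] [Module k N]
    {f g : TensorAlgebra k V →ₗ[k] N} (one : f 1 = g 1)
    (cons : ∀ v x, f x = g x → f (TensorAlgebra.ι k v * x) = g (TensorAlgebra.ι k v * x)) :
    f = g := by
  ext x
  refine word_induction x one (fun c x h => ?_) (fun x y hx hy => ?_) cons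
  · rw [map_smul, map_smul, h]
  · rw [map_add, map_add, hx, hy]

instance instTensorAlgebra : GrMod k (TensorAlgebra k V) :=
  ofCoact (wordDeg k V)
    ((AddMonoidAlgebra.coeffLinearEquiv k).toLinearMap ∘ₗ (wordCoact k V).toLinearMap)
    (by
      rw [eq_top_iff]
      intro x _
      refine word_induction x ?_ (fun c x h => Submodule.smul_mem _ _ h)
        (fun x y hx hy => add_mem hx hy) ?_
      · exact Submodule.mem_iSup_of_mem 0 wordDeg_one
      · intro v x hx
        refine hom_induction k v (fun n v hv => ?_) (fun v v' h h' => by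
          rw [map_add, add_mul]; exact add_mem h h')
        refine Submodule.iSup_induction (wordDeg k V)
          (motive := fun x => TensorAlgebra.ι k v * x ∈ ⨆ i, wordDeg k V i) hx ?_ (by simp) ?_
        · intro i y hy
          exact Submodule.mem_iSup_of_mem (n + i) (wordDeg_mul (wordDeg_ι hv) hy)
        · intro y z hy hz; rw [mul_add]; exact add_mem hy hz)
    (by
      intro n t ht
      refine Submodule.span_induction ?_ (by simp) (fun x y _ _ hx hy => by
        rw [map_add, hx, hy, Finsupp.single_add]) (fun c x _ hx => by
        rw [map_smul, hx, Finsupp.smul_single]) ht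
      rintro _ ⟨l, hl, rfl, rfl⟩
      have : wordCoact k V (l.map fun p => TensorAlgebra.ι k p.2).prod =
          AddMonoidAlgebra.single (l.map Prod.fst).sum (l.map fun p => TensorAlgebra.ι k p.2).prod := by
        clear ht
        induction l with
        | nil => simp
        | cons p l ih =>
          have h1 := hl p (by simp)
          have h2 := ih (fun q hq => hl q (by simp [hq]))
          simp only [List.map_cons, List.prod_cons, List.sum_cons, map_mul]
          rw [h2]
          simp only [wordCoact, TensorAlgebra.lift_ι_apply, LinearMap.comp_apply, coact_of_mem h1]
          rw [← AddMonoidAlgebra.single_mul_single]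
          simp
      simp only [LinearMap.comp_apply, AlgHom.toLinearMap_apply, this]
      rfl)

instance : SetLike.GradedMonoid (deg k (TensorAlgebra k V)) where
  one_mem := wordDeg_one
  mul_mem := fun _ _ _ _ => wordDeg_mul

theorem hasDeg_ι : HasDeg (TensorAlgebra.ι k : V →ₗ[k] _) 0 := fun n v hv => by
  rw [add_zero]; exact wordDeg_ι hv

theorem hasDeg_lift {A : Type*} [Ring A] [Algebra k A] [GrMod k A]
    [SetLike.GradedMonoid (deg k A)] {f : V →ₗ[k] A} (hf : HasDeg f 0) :
    HasDeg (TensorAlgebra.lift k f).toLinearMap 0 := by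
  intro n t ht
  refine Submodule.span_induction ?_ (by simp) (fun x y _ _ hx hy => by
        rw [map_add]; exact add_mem hx hy) (fun c x _ hx => by
        rw [map_smul]; exact Submodule.smul_mem _ _ hx) ht
  rintro _ ⟨l, hl, rfl, rfl⟩
  rw [add_zero]
  clear ht
  induction l with
  | nil => simpa using one_mem_deg (k := k)
  | cons p l ih =>
    have h1 := hf _ _ (hl p (by simp))
    have h2 := ih (fun q hq => hl q (by simp [hq]))
    simp only [List.map_cons, List.prod_cons, List.sum_cons]
    rw [AlgHom.toLinearMap_apply, map_mul, TensorAlgebra.lift_ι_apply]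
    exact mul_mem_deg rfl (by simpa using h1) h2

/-- A linear map on words defined by recursion is homogeneous if each step is. -/
theorem word_hasDeg {N : Type*} [AddCommGroup N] [Module k N] [GrMod k N]
    {f : TensorAlgebra k V →ₗ[k] N} {p : ℤ} (one : f 1 ∈ deg k N p)
    (cons : ∀ i j, ∀ v ∈ deg k V i, ∀ x ∈ deg k (TensorAlgebra k V) j, f x ∈ deg k N (j + p) →
      f (TensorAlgebra.ι k v * x) ∈ deg k N (i + j + p)) : HasDeg f p := by
  intro n t ht
  refine Submodule.span_induction ?_ (by simp) (fun x y _ _ hx hy => by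
        rw [map_add]; exact add_mem hx hy) (fun c x _ hx => by
        rw [map_smul]; exact Submodule.smul_mem _ _ hx) ht
  rintro _ ⟨l, hl, rfl, rfl⟩
  clear ht
  induction l with
  | nil => simpa using one
  | cons q l ih =>
    simp only [List.map_cons, List.prod_cons, List.sum_cons]
    exact cons _ _ _ (hl q (by simp)) _
      (Submodule.subset_span ⟨l, fun q hq => hl q (by simp [hq]), rfl, rfl⟩)
      (ih (fun q hq => hl q (by simp [hq])))

theorem sgn_ι (v : V) : sgn k (TensorAlgebra k V) (TensorAlgebra.ι k v) =
    TensorAlgebra.ι k (sgn k V v) := sgn_even hasDeg_ι (by simp) v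

section wordRec
variable {V : Type v} [AddCommGroup V] [Module k V] {N : Type w} [AddCommGroup N] [Module k N]

/-- Recursion on the first letter of a word: the linear map `F` with `F(1) = n₀` and
`F(v x) = g v x + h v (F x)`. -/
def wordRec (n₀ : N) (g : V →ₗ[k] TensorAlgebra k V →ₗ[k] N) (h : V →ₗ[k] N →ₗ[k] N) :
    TensorAlgebra k V →ₗ[k] N :=
  LinearMap.snd k (TensorAlgebra k V) N ∘ₗ
    (LinearMap.applyₗ (1, n₀)) ∘ₗ
    (TensorAlgebra.lift k (A := Module.End k (TensorAlgebra k V × N))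
      { toFun := fun v => LinearMap.prod
          (LinearMap.mulLeft k (TensorAlgebra.ι k v) ∘ₗ LinearMap.fst k _ _)
          (LinearMap.coprod (g v) (h v))
        map_add' := fun v v' => by ext <;> simp [add_mul]
        map_smul' := fun c v => by ext <;> simp }).toLinearMap

variable (n₀ : N) (g : V →ₗ[k] TensorAlgebra k V →ₗ[k] N) (h : V →ₗ[k] N →ₗ[k] N)
@[simp] theorem wordRec_one : wordRec n₀ g h 1 = n₀ := by simp [wordRec]

@[simp] theorem wordRec_cons (v : V) (x : TensorAlgebra k V) :
    wordRec n₀ g h (TensorAlgebra.ι k v * x) = g v x + h v (wordRec n₀ g h x) := by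
  have key : ∀ x : TensorAlgebra k V, (TensorAlgebra.lift k (A := Module.End k (TensorAlgebra k V × N))
      { toFun := fun v => LinearMap.prod
          (LinearMap.mulLeft k (TensorAlgebra.ι k v) ∘ₗ LinearMap.fst k _ _)
          (LinearMap.coprod (g v) (h v))
        map_add' := fun v v' => by ext <;> simp [add_mul]
        map_smul' := fun c v => by ext <;> simp } x (1, n₀)).1 = x := by
    intro x
    refine word_induction x (by simp) (fun c x h => by simp [h]) (fun x y hx hy => by simp [hx, hy]) ?_
    intro v x hx
    rw [map_mul, Module.End.mul_apply, TensorAlgebra.lift_ι_apply]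
    simp [hx]
  simp only [wordRec, LinearMap.comp_apply, AlgHom.toLinearMap_apply, map_mul,
    LinearMap.applyₗ_apply_apply, Module.End.mul_apply, TensorAlgebra.lift_ι_apply]
  simp [key]
end wordRec
end tensorAlgebra
end GrMod

/-- An augmented differential graded `k`-algebra (`ℤ`-graded, with differential of degree `1`). -/
structure DGA (k : Type u) [CommRing k] where
  carrier : Type v
  [ring : Ring carrier]
  [algebra : Algebra k carrier]
  [grMod : GrMod k carrier]
  [gradedMonoid : SetLike.GradedMonoid (deg k carrier)]
  d : carrier →ₗ[k] carrier
  d_deg : HasDeg d 1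
  d_d : ∀ x, d (d x) = 0
  d_mul : ∀ x y, d (x * y) = d x * y + sgn k carrier x * d y
  ε : carrier →ₐ[k] k
  ε_deg : HasDeg ε.toLinearMap 0
  ε_d : ∀ x, ε (d x) = 0

attribute [instance] DGA.ring DGA.algebra DGA.grMod DGA.gradedMonoid

/-- A map of augmented DGAs: a `k`-algebra map of degree `0` that commutes with the differentials
and with the augmentations. -/
@[ext]
structure DGAHom {k : Type u} [CommRing k] (A : DGA.{u, v} k) (B : DGA.{u, w} k) where
  toAlgHom : A.carrier →ₐ[k] B.carrier
  map_deg : HasDeg toAlgHom.toLinearMap 0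
  map_d : ∀ x, toAlgHom (A.d x) = B.d (toAlgHom x)
  map_ε : ∀ x, B.ε (toAlgHom x) = A.ε x

/-- Composition of DGA maps. -/
def DGAHom.comp {k : Type u} [CommRing k] {A : DGA.{u, v} k} {B : DGA.{u, w} k} {C : DGA k}
    (g : DGAHom B C) (f : DGAHom A B) : DGAHom A C where
  toAlgHom := g.toAlgHom.comp f.toAlgHom
  map_deg := g.map_deg.comp f.map_deg (add_zero 0)
  map_d x := by simp [f.map_d, g.map_d]
  map_ε x := by simp [f.map_ε, g.map_ε]

/-- A coaugmented differential graded `k`-coalgebra. -/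
structure DGC (k : Type u) [CommRing k] where
  carrier : Type v
  [addCommGroup : AddCommGroup carrier]
  [module : Module k carrier]
  [grMod : GrMod k carrier]
  d : carrier →ₗ[k] carrier
  d_deg : HasDeg d 1
  d_d : ∀ x, d (d x) = 0
  Δ : carrier →ₗ[k] carrier ⊗[k] carrier
  Δ_deg : HasDeg Δ 0
  ε : carrier →ₗ[k] k
  ε_deg : HasDeg ε 0
  η : k →ₗ[k] carrier
  η_deg : HasDeg η 0
  coassoc : ∀ x, TensorProduct.assoc k _ _ _ (TensorProduct.map Δ LinearMap.id (Δ x)) =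
    TensorProduct.map LinearMap.id Δ (Δ x)
  counit_left : ∀ x, TensorProduct.lid k _ (TensorProduct.map ε LinearMap.id (Δ x)) = x
  counit_right : ∀ x, TensorProduct.rid k _ (TensorProduct.map LinearMap.id ε (Δ x)) = x
  Δ_d : ∀ x, Δ (d x) = TensorProduct.map d LinearMap.id (Δ x) +
    TensorProduct.map (sgn k carrier) d (Δ x)
  ε_d : ∀ x, ε (d x) = 0
  ε_η : ∀ c, ε (η c) = c
  Δ_η : Δ (η 1) = η 1 ⊗ₜ η 1
  d_η : ∀ c, d (η c) = 0

attribute [instance] DGC.addCommGroup DGC.module DGC.grMod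

/-- A map of coaugmented DGCs. -/
@[ext]
structure DGCHom {k : Type u} [CommRing k] (C : DGC.{u, v} k) (D : DGC.{u, w} k) where
  toLin : C.carrier →ₗ[k] D.carrier
  map_deg : HasDeg toLin 0
  map_d : ∀ x, toLin (C.d x) = D.d (toLin x)
  map_Δ : ∀ x, D.Δ (toLin x) = TensorProduct.map toLin toLin (C.Δ x)
  map_ε : ∀ x, D.ε (toLin x) = C.ε x
  map_η : ∀ c, toLin (C.η c) = D.η c

namespace GrMod
section
variable {k : Type u} [CommRing k] {V : Type v} [AddCommGroup V] [Module k V] [GrMod k V]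
theorem odd_ground (c : k) : odd k k c = 0 := by rw [odd_of_mem (mem_ground c)]; simp
theorem fun_odd {f : V →ₗ[k] k} (hf : HasDeg f 0) (x : V) : f (odd k V x) = 0 := by
  rw [← odd_even hf (by simp), odd_ground]
theorem fun_sgn {f : V →ₗ[k] k} (hf : HasDeg f 0) (x : V) : f (sgn k V x) = f x := by
  simp [sgn, fun_odd hf]
theorem fun_zero {f : V →ₗ[k] k} (hf : HasDeg f 0) {n : ℤ} (hn : n ≠ 0) {x : V}
    (hx : x ∈ deg k V n) : f x = 0 :=
  eq_zero_of_mem_ground hn (by simpa using hf n x hx)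
theorem odd_fix {z : V} (hz : z ∈ deg k V 0) : odd k V z = 0 := by rw [odd_of_mem hz]; simp
theorem sgn_fix {z : V} (hz : z ∈ deg k V 0) : sgn k V z = z := by rw [sgn_of_mem hz]; simp
theorem hasDeg_smul {z : V} (hz : z ∈ deg k V 0) : HasDeg (LinearMap.toSpanSingleton k V z) 0 := by
  intro n c hc
  by_cases hn : n = 0
  · subst hn; simpa using Submodule.smul_mem _ _ hz
  · rw [eq_zero_of_mem_ground hn hc]; simp
end
end GrMod

namespace DGA
variable {k : Type u} [CommRing k] (A : DGA.{u, v} k) (B : DGA.{u, w} k)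

theorem ε_odd (x : A.carrier) : A.ε (odd k _ x) = 0 := fun_odd A.ε_deg x
theorem ε_sgn (x : A.carrier) : A.ε (sgn k _ x) = A.ε x := fun_sgn A.ε_deg x
theorem d_sgn (x : A.carrier) : A.d (sgn k _ x) = - sgn k _ (A.d x) := by
  rw [sgn_odd A.d_deg (by decide), neg_neg]
theorem sgn_d (x : A.carrier) : sgn k _ (A.d x) = - A.d (sgn k _ x) := sgn_odd A.d_deg (by decide) x
theorem d_one : A.d 1 = 0 := by
  have := A.d_mul 1 1
  simpa [sgn_one] using this
theorem d_odd (x : A.carrier) : A.d (odd k _ x) = A.d x - odd k _ (A.d x) := by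
  rw [odd_odd' A.d_deg (by decide)]; abel

/-- The differential `d ⊗ 1 + 1 ⊗ d`, with Koszul signs. -/
def tensorD : GTP k A.carrier B.carrier →ₗ[k] GTP k A.carrier B.carrier :=
  (GradedTensorProduct.of k _ _).toLinearMap ∘ₗ
    (TensorProduct.map A.d LinearMap.id + TensorProduct.map (sgn k _) B.d) ∘ₗ
    (GradedTensorProduct.of k _ _).symm.toLinearMap

theorem tensorD_gt (a : A.carrier) (b : B.carrier) :
    tensorD A B (gt k _ _ a b) = gt k _ _ (A.d a) b + gt k _ _ (sgn k _ a) (B.d b) := rfl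

/-- The functional `a ⊗ b ↦ ε(a) ε(b)`. -/
def tensorε : GTP k A.carrier B.carrier →ₗ[k] k :=
  LinearMap.mul' k k ∘ₗ TensorProduct.map A.ε.toLinearMap B.ε.toLinearMap ∘ₗ
    (GradedTensorProduct.of k _ _).symm.toLinearMap

theorem tensorε_gt (a : A.carrier) (b : B.carrier) :
    tensorε A B (gt k _ _ a b) = A.ε a * B.ε b := rfl

/-- The tensor product of augmented DGAs. -/
def tensor : DGA k where
  carrier := GTP k A.carrier B.carrier
  d := tensorD A B
  d_deg := by
    intro n t ht
    refine gt_deg_induction ht ?_ (fun x y hx hy => by rw [map_add]; exact add_mem hx hy)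
      (fun c x hx => by rw [map_smul]; exact Submodule.smul_mem _ _ hx)
    rintro i j rfl a ha b hb
    rw [tensorD_gt]
    exact add_mem (gt_mem (by omega) (A.d_deg _ _ ha) hb)
      (gt_mem (by omega) (HasDeg.sgn _ _ ha) (B.d_deg _ _ hb))
  d_d x := by
    refine gt_induction x (fun a b => ?_) (fun s t hs ht => by rw [map_add, map_add, hs, ht, add_zero])
    simp [tensorD_gt, A.d_d, B.d_d, A.sgn_d]
  d_mul x y := by
    refine gt_induction x (fun a b => ?_) (fun s t hs ht => by
      simp only [add_mul, map_add, hs, ht]; abel)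
    refine gt_induction y (fun a' b' => ?_) (fun s t hs ht => by
      simp only [mul_add, map_add, hs, ht]; abel)
    simp only [gt_mul, tensorD_gt, sgn_gt, map_sub, map_smul, A.d_mul, B.d_mul, add_mul, mul_add,
      map_add, LinearMap.add_apply]
    simp only [map_add, LinearMap.add_apply, A.d_odd, B.d_odd, sgn, odd_odd, map_sub, LinearMap.sub_apply,
      LinearMap.smul_apply, LinearMap.id_apply, mul_sub, sub_mul, map_smul, smul_mul_assoc, mul_smul_comm,
      odd_mul]
    module
  ε := AlgHom.ofLinearMap (tensorε A B) (by rw [← gt_one, tensorε_gt]; simp) (by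
    intro x y
    refine gt_induction x (fun a b => ?_) (fun s t hs ht => by
      simp only [add_mul, map_add, hs, ht])
    refine gt_induction y (fun a' b' => ?_) (fun s t hs ht => by
      simp only [mul_add, map_add, hs, ht])
    simp [gt_mul, tensorε_gt, A.ε_odd]; ring)
  ε_deg := by
    intro n t ht
    refine gt_deg_induction ht ?_ (fun x y hx hy => by rw [map_add]; exact add_mem hx hy)
      (fun c x hx => by rw [map_smul]; exact Submodule.smul_mem _ _ hx)
    rintro i j rfl a ha b hb
    change tensorε A B _ ∈ _
    rw [tensorε_gt]
    have h1 := A.ε_deg _ _ ha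
    have h2 := B.ε_deg _ _ hb
    by_cases hi : i = 0
    · by_cases hj : j = 0
      · subst hi hj; exact mem_ground _
      · have := fun_zero B.ε_deg hj hb
        simp only [AlgHom.toLinearMap_apply] at this
        rw [this]; simp
    · have := fun_zero A.ε_deg hi ha
      simp only [AlgHom.toLinearMap_apply] at this
      rw [this]; simp
  ε_d x := by
    refine gt_induction x (fun a b => ?_) (fun s t hs ht => by
      rw [map_add, map_add, hs, ht, add_zero])
    rw [AlgHom.ofLinearMap_apply]
    simp [tensorD_gt, tensorε_gt, A.ε_d, B.ε_d]
end DGA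

/-! ### The tensor coalgebra -/
namespace TC
variable {k : Type u} [CommRing k] {V : Type v} [AddCommGroup V] [Module k V]
local notation "T" => TensorAlgebra k V
local notation "ι" => TensorAlgebra.ι k

/-- Left multiplication on the first factor, `x ⊗ y ↦ v x ⊗ y`. -/
def lmul : V →ₗ[k] (T ⊗[k] T) →ₗ[k] (T ⊗[k] T) where
  toFun v := TensorProduct.map (LinearMap.mulLeft k (ι v)) LinearMap.id
  map_add' v w := by ext; simp [add_mul, TensorProduct.add_tmul]
  map_smul' c v := by ext; simp [TensorProduct.smul_tmul']

@[simp] theorem lmul_tmul (v : V) (x y : T) : lmul v (x ⊗ₜ y) = (ι v * x) ⊗ₜ y := rfl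

variable (k V) in
/-- Deconcatenation: `Δ(v₁⋯vₙ) = ∑ v₁⋯vᵢ ⊗ vᵢ₊₁⋯vₙ`. -/
def decon : T →ₗ[k] T ⊗[k] T :=
  wordRec (1 ⊗ₜ 1)
    (LinearMap.compr₂ (LinearMap.mul k T ∘ₗ ι) (TensorProduct.mk k T T 1)) lmul

@[simp] theorem decon_one : decon k V 1 = 1 ⊗ₜ 1 := by simp [decon]
@[simp] theorem decon_cons (v : V) (x : T) :
    decon k V (ι v * x) = 1 ⊗ₜ (ι v * x) + lmul v (decon k V x) := by
  simp [decon]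

variable (k V) in
/-- The counit: projection on words of length `0`. -/
def counit : T →ₗ[k] k := (TensorAlgebra.algebraMapInv (R := k) (M := V)).toLinearMap

@[simp] theorem counit_one : counit k V 1 = 1 := by simp [counit]
@[simp] theorem counit_cons (v : V) (x : T) : counit k V (ι v * x) = 0 := by
  simp [counit, TensorAlgebra.algebraMapInv]

theorem coassoc (x : T) : TensorProduct.assoc k _ _ _
      (TensorProduct.map (decon k V) LinearMap.id (decon k V x)) =
    TensorProduct.map LinearMap.id (decon k V) (decon k V x) := by
  refine word_induction x ?_ (fun c x h => ?_) (fun x y hx hy => ?_) ?_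
  · simp
  · simp only [map_smul, h]
  · simp only [map_add, hx, hy]
  · intro v x h
    have h1 : ∀ t : T ⊗[k] T, TensorProduct.assoc k _ _ _
        (TensorProduct.map (decon k V) LinearMap.id (lmul v t)) =
        1 ⊗ₜ lmul v t + TensorProduct.map (LinearMap.mulLeft k (ι v)) LinearMap.id
          (TensorProduct.assoc k _ _ _ (TensorProduct.map (decon k V) LinearMap.id t)) := by
      intro t
      induction t with
      | zero => simp
      | add s t hs ht => simp only [map_add, hs, ht, TensorProduct.tmul_add]; abel
      | tmul a b =>
        simp only [lmul_tmul, TensorProduct.map_tmul, decon_cons, TensorProduct.add_tmul, map_add,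
          LinearMap.id_apply, TensorProduct.assoc_tmul]
        congr 1
        generalize decon k V a = s
        induction s with
        | zero => simp
        | add s t hs ht => simp only [map_add, hs, ht, TensorProduct.add_tmul]
        | tmul p q => simp
    have h2 : ∀ t : T ⊗[k] T, TensorProduct.map LinearMap.id (decon k V) (lmul v t) =
        TensorProduct.map (LinearMap.mulLeft k (ι v)) LinearMap.id
          (TensorProduct.map LinearMap.id (decon k V) t) := by
      intro t
      induction t with
      | zero => simp
      | add s t hs ht => simp only [map_add, hs, ht]
      | tmul a b => simp
    simp only [decon_cons, map_add, h1, h2, h, TensorProduct.map_tmul, LinearMap.id_apply,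
      decon_one, TensorProduct.assoc_tmul, TensorProduct.tmul_add]
    abel

theorem counit_left (x : T) :
    TensorProduct.lid k _ (TensorProduct.map (counit k V) LinearMap.id (decon k V x)) = x := by
  refine word_induction x ?_ (fun c x h => ?_) (fun x y hx hy => ?_) ?_
  · simp
  · simp only [map_smul, h]
  · simp only [map_add, hx, hy]
  · intro v x h
    have h1 : ∀ t : T ⊗[k] T, TensorProduct.map (counit k V) LinearMap.id (lmul v t) = 0 := by
      intro t
      induction t with
      | zero => simp
      | add s t hs ht => simp only [map_add, hs, ht, add_zero]
      | tmul a b => simp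
    simp [h1]

theorem counit_right (x : T) :
    TensorProduct.rid k _ (TensorProduct.map LinearMap.id (counit k V) (decon k V x)) = x := by
  refine word_induction x ?_ (fun c x h => ?_) (fun x y hx hy => ?_) ?_
  · simp
  · simp only [map_smul, h]
  · simp only [map_add, hx, hy]
  · intro v x h
    have h1 : ∀ t : T ⊗[k] T, TensorProduct.rid k _
        (TensorProduct.map LinearMap.id (counit k V) (lmul v t)) =
        ι v * TensorProduct.rid k _ (TensorProduct.map LinearMap.id (counit k V) t) := by
      intro t
      induction t with
      | zero => simp
      | add s t hs ht => simp only [map_add, hs, ht, mul_add]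
      | tmul a b => simp
    simp [h1, h]

/-- Merging of a letter with the first letter of a word: `(v, w y) ↦ m(v, w) y`, `(v, 1) ↦ 0`. -/
def merge (m : V →ₗ[k] V →ₗ[k] V) : T →ₗ[k] V →ₗ[k] T :=
  wordRec 0
    (LinearMap.mk₂ k (fun w y => (LinearMap.mulRight k y) ∘ₗ ι ∘ₗ m.flip w)
      (by intros; ext; simp [add_mul]) (by intros; ext; simp)
      (by intros; ext; simp [mul_add]) (by intros; ext; simp)) 0

@[simp] theorem merge_one (m : V →ₗ[k] V →ₗ[k] V) (v : V) : merge m 1 v = 0 := by simp [merge]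
@[simp] theorem merge_cons (m : V →ₗ[k] V →ₗ[k] V) (v w : V) (y : T) :
    merge m (ι w * y) v = ι (m v w) * y := by simp [merge]

variable [GrMod k V]

/-- The coderivation of the tensor coalgebra with unary component `d₁` and binary component `m`:
`D(v x) = d₁(v) x + m(v, x₁) x₂⋯ + (-1)^{|v|} v D(x)`. -/
def coder (d₁ : V →ₗ[k] V) (m : V →ₗ[k] V →ₗ[k] V) : T →ₗ[k] T :=
  wordRec 0 (LinearMap.mul k T ∘ₗ ι ∘ₗ d₁ + (merge m).flip) (LinearMap.mul k T ∘ₗ ι ∘ₗ sgn k V)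

variable (d₁ : V →ₗ[k] V) (m : V →ₗ[k] V →ₗ[k] V)
@[simp] theorem coder_one : coder d₁ m 1 = 0 := by simp [coder]
@[simp] theorem coder_cons (v : V) (x : T) :
    coder d₁ m (ι v * x) = ι (d₁ v) * x + merge m x v + ι (sgn k V v) * coder d₁ m x := by
  simp [coder]

theorem sgn_cons (v : V) (x : T) : sgn k T (ι v * x) = ι (sgn k V v) * sgn k T x := by
  rw [sgn_mul, sgn_ι]

theorem decon_deg : HasDeg (decon k V) 0 := by
  have hl : ∀ {i j : ℤ} {v : V} (_ : v ∈ deg k V i) {t : T ⊗[k] T} (_ : t ∈ deg k (T ⊗[k] T) j),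
      lmul v t ∈ deg k (T ⊗[k] T) (i + j) := by
    intro i j v hv t ht
    refine Submodule.span_induction ?_ (by simp) (fun x y _ _ hx hy => by
        rw [map_add]; exact add_mem hx hy) (fun c x _ hx => by
        rw [map_smul]; exact Submodule.smul_mem _ _ hx) ht
    rintro _ ⟨p, q, rfl, x, hx, y, hy, rfl⟩
    exact tmul_mem (add_assoc _ _ _) (mul_mem_deg rfl (wordDeg_ι hv) hx) hy
  refine word_hasDeg ?_ ?_
  · rw [decon_one]; exact tmul_mem (add_zero _) one_mem_deg one_mem_deg
  · intro i j v hv x hx h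
    rw [decon_cons, add_zero]
    rw [add_zero] at h
    exact add_mem (tmul_mem (zero_add _) one_mem_deg (mul_mem_deg rfl (wordDeg_ι hv) hx)) (hl hv h)

theorem counit_deg : HasDeg (counit k V) 0 := by
  refine word_hasDeg (by simpa using mem_ground (1 : k)) ?_
  intro i j v hv x hx h; simp

/-- The hypotheses on `d₁` and `m` under which `coder d₁ m` is a differential. -/
structure IsBar : Prop where
  d_deg : HasDeg d₁ 1
  m_deg : ∀ i j, ∀ v ∈ deg k V i, ∀ w ∈ deg k V j, m v w ∈ deg k V (i + j + 1)
  d_d : ∀ v, d₁ (d₁ v) = 0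
  d_m : ∀ v w, d₁ (m v w) + m (d₁ v) w + m (sgn k V v) (d₁ w) = 0
  m_m : ∀ v w u, m (m v w) u + m (sgn k V v) (m w u) = 0

variable {d₁ m}

theorem sgn_m (hm : ∀ i j, ∀ v ∈ deg k V i, ∀ w ∈ deg k V j, m v w ∈ deg k V (i + j + 1)) (v w : V) :
    sgn k V (m v w) = - m (sgn k V v) (sgn k V w) := by
  refine hom_induction k v (fun i v hv => ?_) (fun x x' hx hx' => by
    simp only [map_add, LinearMap.add_apply, hx, hx']; abel)
  refine hom_induction k w (fun j w hw => ?_) (fun x x' hx hx' => by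
    simp only [map_add, hx, hx']; abel)
  rw [sgn_of_mem hv, sgn_of_mem hw, sgn_of_mem (hm i j v hv w hw)]
  rw [Int.negOnePow_add, Int.negOnePow_add, Int.negOnePow_one]
  rcases Int.units_eq_one_or i.negOnePow with h | h <;>
  rcases Int.units_eq_one_or j.negOnePow with h' | h' <;> rw [h, h'] <;> simp [Units.neg_smul]

theorem merge_deg (H : IsBar d₁ m) {i j : ℤ} {v : V} (hv : v ∈ deg k V i) {x : T} (hx : x ∈ deg k T j) :
    merge m x v ∈ deg k T (i + j + 1) := by
  refine Submodule.span_induction ?_ (by simp) (fun x y _ _ hx hy => by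
      rw [map_add]; exact add_mem hx hy) (fun c x _ hx => by
      rw [map_smul]; exact Submodule.smul_mem _ _ hx) hx
  rintro _ ⟨l, hl, rfl, rfl⟩
  cases l with
  | nil => simp
  | cons p l =>
    simp only [List.map_cons, List.prod_cons, merge_cons, List.sum_cons]
    refine mul_mem_deg (i := i + p.1 + 1) (j := (l.map Prod.fst).sum) (by omega)
      (wordDeg_ι (H.m_deg _ _ _ hv _ (hl p (by simp)))) ?_
    exact Submodule.subset_span ⟨l, fun q hq => hl q (by simp [hq]), rfl, rfl⟩

theorem coder_deg (H : IsBar d₁ m) : HasDeg (coder d₁ m) 1 := by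
  refine word_hasDeg (by simp) ?_
  intro i j v hv x hx h
  rw [coder_cons]
  refine add_mem (add_mem ?_ (merge_deg H hv hx)) ?_
  · exact mul_mem_deg (by omega) (wordDeg_ι (H.d_deg _ _ hv)) hx
  · have := HasDeg.sgn _ _ hv
    rw [add_zero] at this
    exact mul_mem_deg (by omega) (wordDeg_ι this) h

theorem coder_merge (H : IsBar d₁ m) (v : V) (x : T) : coder d₁ m (merge m x v) =
    - merge m x (d₁ v) - merge m (coder d₁ m x) (sgn k V v) := by
  refine word_induction x ?_ (fun c x h => ?_) (fun x y hx hy => ?_) ?_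
  · simp
  · simp only [map_smul, h, LinearMap.smul_apply]; module
  · simp only [map_add, hx, hy, LinearMap.add_apply]; abel
  · intro w y _
    have h2 : ∀ y : T, merge m y (m v w) = - merge m (merge m y w) (sgn k V v) := by
      intro y
      refine word_induction y ?_ (fun c x h => ?_) (fun x y hx hy => ?_) ?_
      · simp
      · simp only [map_smul, h, LinearMap.smul_apply]; module
      · simp only [map_add, hx, hy, LinearMap.add_apply]; abel
      · intro u z _
        have := eq_neg_of_add_eq_zero_left (H.m_m v w u)
        simp [this]
    have h1 := H.d_m v w
    have h1' : d₁ (m v w) = - m (d₁ v) w - m (sgn k V v) (d₁ w) := by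
      rw [eq_sub_iff_add_eq, eq_neg_iff_add_eq_zero, ← h1]; abel
    simp only [merge_cons, coder_cons, h1', h2, sgn_m H.m_deg, map_add, map_sub, map_neg,
      LinearMap.add_apply, sub_mul, neg_mul]
    abel

theorem coder_coder (H : IsBar d₁ m) (x : T) : coder d₁ m (coder d₁ m x) = 0 := by
  refine word_induction x ?_ (fun c x h => ?_) (fun x y hx hy => ?_) ?_
  · simp
  · simp only [map_smul, h, smul_zero]
  · simp only [map_add, hx, hy, add_zero]
  · intro v x h
    simp only [coder_cons, map_add, coder_merge H, H.d_d, h, map_zero, zero_mul, mul_zero,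
      sgn_odd H.d_deg (show Odd (1 : ℤ) by decide), map_neg, neg_mul]
    abel

theorem decon_coder (x : T) : decon k V (coder d₁ m x) =
    TensorProduct.map (coder d₁ m) LinearMap.id (decon k V x) +
    TensorProduct.map (sgn k T) (coder d₁ m) (decon k V x) := by
  refine word_induction x ?_ (fun c x h => ?_) (fun x y hx hy => ?_) ?_
  · simp
  · simp only [map_smul, h, smul_add]
  · simp only [map_add, hx, hy]; abel
  · intro v x h
    have h1 : ∀ x : T, decon k V (merge m x v) = 1 ⊗ₜ merge m x v +
        TensorProduct.map ((merge m).flip v) LinearMap.id (decon k V x) := by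
      intro x
      refine word_induction x ?_ (fun c x h => ?_) (fun x y hx hy => ?_) ?_
      · simp
      · simp only [map_smul, h, LinearMap.smul_apply, TensorProduct.tmul_smul, smul_add]
      · simp only [map_add, hx, hy, LinearMap.add_apply, TensorProduct.tmul_add]; abel
      · intro w y _
        simp only [merge_cons, decon_cons, map_add, TensorProduct.map_tmul, LinearMap.flip_apply,
          merge_one, TensorProduct.zero_tmul, zero_add]
        congr 1
        generalize decon k V y = t
        induction t with
        | zero => simp
        | add s t hs ht => simp only [map_add, hs, ht]
        | tmul a b => simp
    have h2 : ∀ t : T ⊗[k] T, TensorProduct.map (coder d₁ m) LinearMap.id (lmul v t) =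
        lmul (d₁ v) t + TensorProduct.map ((merge m).flip v) LinearMap.id t +
        lmul (sgn k V v) (TensorProduct.map (coder d₁ m) LinearMap.id t) := by
      intro t
      induction t with
      | zero => simp
      | add s t hs ht => simp only [map_add, hs, ht]; abel
      | tmul a b => simp [TensorProduct.add_tmul]
    have h3 : ∀ t : T ⊗[k] T, TensorProduct.map (sgn k T) (coder d₁ m) (lmul v t) =
        lmul (sgn k V v) (TensorProduct.map (sgn k T) (coder d₁ m) t) := by
      intro t
      induction t with
      | zero => simp
      | add s t hs ht => simp only [map_add, hs, ht]
      | tmul a b => simp [sgn_mul, sgn_ι]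
    simp only [coder_cons, decon_cons, map_add, h, h1, h2, h3, TensorProduct.map_tmul, coder_one,
      TensorProduct.zero_tmul, sgn_one, TensorProduct.tmul_add, zero_add]
    abel

theorem counit_coder (x : T) : counit k V (coder d₁ m x) = 0 := by
  refine word_induction x ?_ (fun c x h => ?_) (fun x y hx hy => ?_) ?_
  · simp
  · simp only [map_smul, h, smul_zero]
  · simp only [map_add, hx, hy, add_zero]
  · intro v x h
    have h1 : ∀ x : T, counit k V (merge m x v) = 0 := by
      intro x
      refine word_induction x ?_ (fun c x h => ?_) (fun x y hx hy => ?_) ?_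
      · simp
      · simp only [map_smul, h, LinearMap.smul_apply, smul_zero]
      · simp only [map_add, hx, hy, LinearMap.add_apply, add_zero]
      · simp
    simp [h1]

/-- The tensor coalgebra with a quadratic codifferential. -/
def dgc (H : IsBar d₁ m) : DGC k where
  carrier := T
  d := coder d₁ m
  d_deg := coder_deg H
  d_d := coder_coder H
  Δ := decon k V
  Δ_deg := decon_deg
  ε := counit k V
  ε_deg := counit_deg
  η := LinearMap.toSpanSingleton k T 1
  η_deg := hasDeg_smul one_mem_deg
  coassoc := coassoc
  counit_left := counit_left
  counit_right := counit_right
  Δ_d := decon_coder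
  ε_d := counit_coder
  ε_η c := by simp
  Δ_η := by simp
  d_η c := by simp
end TC

/-! ### Tensor products of coalgebras -/
namespace GrMod
section mid
variable (k : Type u) [CommRing k] (C C' D D' : Type*)
  [AddCommGroup C] [Module k C] [AddCommGroup C'] [Module k C'] [GrMod k C']
  [AddCommGroup D] [Module k D] [GrMod k D] [AddCommGroup D'] [Module k D']

/-- Interchange of the middle factors with its Koszul sign,
`(c ⊗ c') ⊗ (e ⊗ e') ↦ (-1)^{|c'||e|} (c ⊗ e) ⊗ (c' ⊗ e')`. -/
def mid : (C ⊗[k] C') ⊗[k] (D ⊗[k] D') →ₗ[k] (C ⊗[k] D) ⊗[k] (C' ⊗[k] D') :=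
  (TensorProduct.tensorTensorTensorComm k C C' D D').toLinearMap ∘ₗ
    (LinearMap.id - (2 : k) • TensorProduct.map (TensorProduct.map LinearMap.id (odd k C'))
      (TensorProduct.map (odd k D) LinearMap.id))

variable {k C C' D D'}
theorem mid_tmul (c : C) (c' : C') (e : D) (e' : D') :
    mid k C C' D D' ((c ⊗ₜ c') ⊗ₜ (e ⊗ₜ e')) =
      (c ⊗ₜ e) ⊗ₜ (c' ⊗ₜ e') - (2 : k) • ((c ⊗ₜ odd k D e) ⊗ₜ (odd k C' c' ⊗ₜ e')) := by
  simp [mid]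

theorem mid_of_mem {i j : ℤ} (c : C) {c' : C'} {e : D} (e' : D') (hc : c' ∈ deg k C' i)
    (he : e ∈ deg k D j) : mid k C C' D D' ((c ⊗ₜ c') ⊗ₜ (e ⊗ₜ e')) =
      (i * j).negOnePow • (c ⊗ₜ e) ⊗ₜ (c' ⊗ₜ e') := by
  rw [mid_tmul, odd_of_mem hc, odd_of_mem he]
  by_cases hi : Even i
  · rw [Int.negOnePow_even _ (hi.mul_right j)]; simp [hi]
  by_cases hj : Even j
  · rw [Int.negOnePow_even _ (hj.mul_left i)]; simp [hj]
  rw [if_neg hi, if_neg hj, Int.negOnePow_odd _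
    ((Int.not_even_iff_odd.mp hi).mul (Int.not_even_iff_odd.mp hj))]
  rw [Units.neg_smul, one_smul, two_smul]; abel

theorem mid_deg [GrMod k C] [GrMod k D'] : HasDeg (mid k C C' D D') 0 := by
  have key : ∀ i j, ∀ s ∈ deg k (C ⊗[k] C') i, ∀ t ∈ deg k (D ⊗[k] D') j,
      mid k C C' D D' (s ⊗ₜ t) ∈ deg k _ (i + j) := by
    intro i j s hs t ht
    refine Submodule.span_induction ?_ (by simp) (fun x y _ _ hx hy => by
      rw [TensorProduct.add_tmul, map_add]; exact add_mem hx hy) (fun c x _ hx => by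
      rw [← TensorProduct.smul_tmul', map_smul]; exact Submodule.smul_mem _ _ hx) hs
    rintro _ ⟨p, q, rfl, x, hx, y, hy, rfl⟩
    refine Submodule.span_induction ?_ (by simp) (fun x y _ _ hx hy => by
      rw [TensorProduct.tmul_add, map_add]; exact add_mem hx hy) (fun c x _ hx => by
      rw [TensorProduct.tmul_smul, map_smul]; exact Submodule.smul_mem _ _ hx) ht
    rintro _ ⟨p', q', rfl, x', hx', y', hy', rfl⟩
    rw [mid_tmul]
    have h1 := HasDeg.odd _ _ hy
    have h2 := HasDeg.odd _ _ hx'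
    rw [add_zero] at h1 h2
    refine sub_mem ?_ (Submodule.smul_mem _ _ ?_)
    · exact tmul_mem (i := p + p') (j := q + q') (by omega) (tmul_mem rfl hx hx') (tmul_mem rfl hy hy')
    · exact tmul_mem (i := p + p') (j := q + q') (by omega) (tmul_mem rfl hx h2) (tmul_mem rfl h1 hy')
  refine hasDeg_tensor ?_
  intro i j s hs t ht
  rw [add_zero]; exact key i j s hs t ht
end mid
end GrMod

namespace DGC
variable {k : Type u} [CommRing k] (C : DGC.{u, v} k) (D : DGC.{u, w} k)

theorem Δ_odd (x : C.carrier) : odd k _ (C.Δ x) = C.Δ (odd k _ x) := odd_even C.Δ_deg (by simp) x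
theorem Δ_sgn (x : C.carrier) : C.Δ (sgn k _ x) =
    TensorProduct.map (sgn k _) (sgn k _) (C.Δ x) := by
  rw [← sgn_even C.Δ_deg (by simp)]
  generalize C.Δ x = t
  induction t with
  | zero => simp
  | add s t hs ht => simp only [map_add, hs, ht]
  | tmul a b => simp [sgn_tmul]

/-- `d ⊗ 1 + 1 ⊗ d` -/
def tensorD : C.carrier ⊗[k] D.carrier →ₗ[k] C.carrier ⊗[k] D.carrier :=
  TensorProduct.map C.d LinearMap.id + TensorProduct.map (sgn k _) D.d

@[simp] theorem tensorD_tmul (x : C.carrier) (y : D.carrier) :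
    tensorD C D (x ⊗ₜ y) = C.d x ⊗ₜ y + sgn k _ x ⊗ₜ D.d y := rfl

/-- `Δ(x ⊗ y) = ∑ ± (x₁ ⊗ y₁) ⊗ (x₂ ⊗ y₂)` -/
def tensorΔ : C.carrier ⊗[k] D.carrier →ₗ[k]
    (C.carrier ⊗[k] D.carrier) ⊗[k] (C.carrier ⊗[k] D.carrier) :=
  mid k _ _ _ _ ∘ₗ TensorProduct.map C.Δ D.Δ

@[simp] theorem tensorΔ_tmul (x : C.carrier) (y : D.carrier) :
    tensorΔ C D (x ⊗ₜ y) = mid k _ _ _ _ (C.Δ x ⊗ₜ D.Δ y) := rfl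

/-- `x ⊗ y ↦ ε(x) ε(y)` -/
def tensorε : C.carrier ⊗[k] D.carrier →ₗ[k] k :=
  LinearMap.mul' k k ∘ₗ TensorProduct.map C.ε D.ε

@[simp] theorem tensorε_tmul (x : C.carrier) (y : D.carrier) :
    tensorε C D (x ⊗ₜ y) = C.ε x * D.ε y := rfl

theorem tensor_coassoc (x : C.carrier ⊗[k] D.carrier) :
    TensorProduct.assoc k _ _ _
      (TensorProduct.map (tensorΔ C D) LinearMap.id (tensorΔ C D x)) =
    TensorProduct.map LinearMap.id (tensorΔ C D) (tensorΔ C D x) := by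
  have L1 : ∀ s t, TensorProduct.map (tensorΔ C D) LinearMap.id (mid k C.carrier C.carrier D.carrier D.carrier (s ⊗ₜ t)) =
      TensorProduct.map (mid k _ _ _ _) LinearMap.id (mid k _ _ _ _
        (TensorProduct.map C.Δ LinearMap.id s ⊗ₜ TensorProduct.map D.Δ LinearMap.id t)) := by
    intro s t
    induction s with
    | zero => simp
    | add s s' hs hs' => simp only [map_add, TensorProduct.add_tmul, hs, hs']
    | tmul a b =>
    induction t with
    | zero => simp
    | add s s' hs hs' => simp only [map_add, TensorProduct.tmul_add, hs, hs']
    | tmul e f => simp [mid_tmul, Δ_odd]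
  have L2 : ∀ s t, TensorProduct.map LinearMap.id (tensorΔ C D) (mid k C.carrier C.carrier D.carrier D.carrier (s ⊗ₜ t)) =
      TensorProduct.map LinearMap.id (mid k _ _ _ _) (mid k _ _ _ _
        (TensorProduct.map LinearMap.id C.Δ s ⊗ₜ TensorProduct.map LinearMap.id D.Δ t)) := by
    intro s t
    induction s with
    | zero => simp
    | add s s' hs hs' => simp only [map_add, TensorProduct.add_tmul, hs, hs']
    | tmul a b =>
    induction t with
    | zero => simp
    | add s s' hs hs' => simp only [map_add, TensorProduct.tmul_add, hs, hs']
    | tmul e f => simp [mid_tmul, Δ_odd]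
  have L3 : ∀ s t, TensorProduct.assoc k _ _ _
      (TensorProduct.map (mid k C.carrier C.carrier D.carrier D.carrier) LinearMap.id
        (mid k _ C.carrier _ D.carrier (s ⊗ₜ t))) =
      TensorProduct.map LinearMap.id (mid k _ _ _ _) (mid k _ _ _ _
        (TensorProduct.assoc k _ _ _ s ⊗ₜ TensorProduct.assoc k _ _ _ t)) := by
    intro s t
    induction s with
    | zero => simp
    | add s s' hs hs' => simp only [map_add, TensorProduct.add_tmul, hs, hs']
    | tmul s c =>
    induction s with
    | zero => simp
    | add s s' hs hs' => simp only [map_add, TensorProduct.add_tmul, hs, hs']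
    | tmul a b =>
    induction t with
    | zero => simp
    | add s s' hs hs' => simp only [map_add, TensorProduct.tmul_add, hs, hs']
    | tmul t g =>
    induction t with
    | zero => simp
    | add s s' hs hs' => simp only [map_add, TensorProduct.tmul_add, TensorProduct.add_tmul, hs, hs']
    | tmul e f =>
      simp only [mid_tmul, TensorProduct.assoc_tmul, odd_tmul, TensorProduct.tmul_add,
        TensorProduct.tmul_sub, TensorProduct.add_tmul, TensorProduct.sub_tmul, map_add, map_sub,
        TensorProduct.map_tmul, LinearMap.id_apply, TensorProduct.tmul_smul, map_smul,
        ← TensorProduct.smul_tmul', odd_odd]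
      module
  induction x with
  | zero => simp
  | add s t hs ht => simp only [map_add, hs, ht]
  | tmul x y =>
    rw [tensorΔ_tmul, L1, L2, L3, C.coassoc, D.coassoc]

theorem tensor_counit_left (x : C.carrier ⊗[k] D.carrier) :
    TensorProduct.lid k _ (TensorProduct.map (tensorε C D) LinearMap.id (tensorΔ C D x)) = x := by
  have L : ∀ s t, TensorProduct.lid k _ (TensorProduct.map (tensorε C D) LinearMap.id
      (mid k C.carrier C.carrier D.carrier D.carrier (s ⊗ₜ t))) = TensorProduct.lid k _ (TensorProduct.map C.ε LinearMap.id s) ⊗ₜ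
        TensorProduct.lid k _ (TensorProduct.map D.ε LinearMap.id t) := by
    intro s t
    induction s with
    | zero => simp
    | add s s' hs hs' => simp only [map_add, TensorProduct.add_tmul, hs, hs']
    | tmul a b =>
    induction t with
    | zero => simp
    | add s s' hs hs' => simp only [map_add, TensorProduct.tmul_add, hs, hs']
    | tmul e f =>
      simp [mid_tmul, fun_odd D.ε_deg, ← TensorProduct.smul_tmul', TensorProduct.tmul_smul, mul_smul]
      exact smul_comm _ _ _
  induction x with
  | zero => simp
  | add s t hs ht => simp only [map_add, hs, ht]
  | tmul x y => rw [tensorΔ_tmul, L, C.counit_left, D.counit_left]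

theorem tensor_counit_right (x : C.carrier ⊗[k] D.carrier) :
    TensorProduct.rid k _ (TensorProduct.map LinearMap.id (tensorε C D) (tensorΔ C D x)) = x := by
  have L : ∀ s t, TensorProduct.rid k _ (TensorProduct.map LinearMap.id (tensorε C D)
      (mid k C.carrier C.carrier D.carrier D.carrier (s ⊗ₜ t))) = TensorProduct.rid k _ (TensorProduct.map LinearMap.id C.ε s) ⊗ₜ
        TensorProduct.rid k _ (TensorProduct.map LinearMap.id D.ε t) := by
    intro s t
    induction s with
    | zero => simp
    | add s s' hs hs' => simp only [map_add, TensorProduct.add_tmul, hs, hs']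
    | tmul a b =>
    induction t with
    | zero => simp
    | add s s' hs hs' => simp only [map_add, TensorProduct.tmul_add, hs, hs']
    | tmul e f =>
      simp [mid_tmul, fun_odd C.ε_deg, ← TensorProduct.smul_tmul', TensorProduct.tmul_smul, mul_smul]
      exact smul_comm _ _ _
  induction x with
  | zero => simp
  | add s t hs ht => simp only [map_add, hs, ht]
  | tmul x y => rw [tensorΔ_tmul, L, C.counit_right, D.counit_right]

theorem sgn_d (x : C.carrier) : sgn k _ (C.d x) = - C.d (sgn k _ x) := sgn_odd C.d_deg (by decide) x
theorem d_odd (x : C.carrier) : C.d (odd k _ x) = C.d x - odd k _ (C.d x) := by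
  rw [odd_odd' C.d_deg (by decide)]; abel

theorem tensor_Δ_d (x : C.carrier ⊗[k] D.carrier) : tensorΔ C D (tensorD C D x) =
    TensorProduct.map (tensorD C D) LinearMap.id (tensorΔ C D x) +
    TensorProduct.map (sgn k _) (tensorD C D) (tensorΔ C D x) := by
  have L : ∀ s t, mid k _ _ _ _
      ((TensorProduct.map C.d LinearMap.id s + TensorProduct.map (sgn k _) C.d s) ⊗ₜ t) +
      mid k _ _ _ _ (TensorProduct.map (sgn k _) (sgn k _) s ⊗ₜ
        (TensorProduct.map D.d LinearMap.id t + TensorProduct.map (sgn k _) D.d t)) =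
      TensorProduct.map (tensorD C D) LinearMap.id (mid k C.carrier C.carrier D.carrier D.carrier (s ⊗ₜ t)) +
      TensorProduct.map (sgn k _) (tensorD C D) (mid k C.carrier C.carrier D.carrier D.carrier (s ⊗ₜ t)) := by
    intro s t
    induction s with
    | zero => simp
    | add s s' hs hs' =>
      simp only [map_add, TensorProduct.add_tmul, TensorProduct.tmul_add] at hs hs' ⊢
      linear_combination (norm := module) hs + hs'
    | tmul a b =>
    induction t with
    | zero => simp
    | add s s' hs hs' =>
      simp only [map_add, TensorProduct.add_tmul, TensorProduct.tmul_add] at hs hs' ⊢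
      linear_combination (norm := module) hs + hs'
    | tmul e f =>
      simp only [mid_tmul, tensorD_tmul, sgn_tmul, TensorProduct.tmul_add,
        TensorProduct.add_tmul, map_add, map_sub,
        TensorProduct.map_tmul, LinearMap.id_apply, map_smul]
      simp only [C.d_odd, D.d_odd, sgn, odd_odd, map_sub, LinearMap.sub_apply, LinearMap.smul_apply,
        LinearMap.id_apply, map_smul, TensorProduct.tmul_sub, TensorProduct.sub_tmul,
        TensorProduct.tmul_smul, ← TensorProduct.smul_tmul']
      module
  induction x with
  | zero => simp
  | add s t hs ht => simp only [map_add, hs, ht]; abel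
  | tmul x y =>
    simp only [tensorD_tmul, map_add, tensorΔ_tmul, C.Δ_d, D.Δ_d, Δ_sgn, L]

/-- The tensor product of coaugmented DGCs. -/
def tensor : DGC k where
  carrier := C.carrier ⊗[k] D.carrier
  d := tensorD C D
  d_deg := (HasDeg.map C.d_deg HasDeg.id (add_zero _)).add (HasDeg.map HasDeg.sgn D.d_deg (zero_add _))
  d_d x := by
    induction x with
    | zero => simp
    | add s t hs ht => simp only [map_add, hs, ht, add_zero]
    | tmul x y => simp [C.d_d, D.d_d, sgn_d, TensorProduct.neg_tmul]
  Δ := tensorΔ C D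
  Δ_deg := mid_deg.comp (HasDeg.map C.Δ_deg D.Δ_deg (add_zero 0)) (add_zero 0)
  ε := tensorε C D
  ε_deg := by
    refine hasDeg_tensor ?_
    intro i j x hx y hy
    rw [tensorε_tmul]
    by_cases hi : i = 0
    · by_cases hj : j = 0
      · subst hi hj; exact mem_ground _
      · rw [fun_zero D.ε_deg hj hy]; simp
    · rw [fun_zero C.ε_deg hi hx]; simp
  η := LinearMap.toSpanSingleton k _ (C.η 1 ⊗ₜ D.η 1)
  η_deg := hasDeg_smul (tmul_mem (i := 0 + 0) (j := 0 + 0) (by simp)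
    (C.η_deg _ _ (mem_ground 1)) (D.η_deg _ _ (mem_ground 1)))
  coassoc := tensor_coassoc C D
  counit_left := tensor_counit_left C D
  counit_right := tensor_counit_right C D
  Δ_d := tensor_Δ_d C D
  ε_d x := by
    induction x with
    | zero => simp
    | add s t hs ht => simp only [map_add, hs, ht, add_zero]
    | tmul x y => simp [C.ε_d, D.ε_d]
  ε_η c := by simp [C.ε_η, D.ε_η]
  Δ_η := by
    have : odd k _ (D.η 1) = 0 := odd_fix (by simpa using D.η_deg _ _ (mem_ground 1))
    simp [C.Δ_η, D.Δ_η, mid_tmul, this]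
  d_η c := by simp [C.d_η, D.d_η]
end DGC

/-! ### The bar construction -/
namespace DGA
variable {k : Type u} [CommRing k] (A : DGA.{u, v} k)

/-- The augmentation ideal. -/
abbrev augIdeal : Submodule k A.carrier := LinearMap.ker A.ε.toLinearMap

instance : GrMod k A.augIdeal := kerGr A.ε.toLinearMap A.ε_deg 1 one_mem_deg (map_one A.ε)

/-- The desuspension `s⁻¹Ā` of the augmentation ideal, `(s⁻¹Ā)_n = Ā_{n+1}`. -/
abbrev V : Type v := Shift 1 A.augIdeal

/-- `a ↦ [a - ε(a)]`; on the augmentation ideal this is `s⁻¹`. -/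
def br : A.carrier →ₗ[k] A.V :=
  (Shift.mk k 1).toLinearMap ∘ₗ toKer A.ε.toLinearMap 1 (map_one A.ε)

/-- `s : s⁻¹Ā → Ā ⊆ A`. -/
def unbr : A.V →ₗ[k] A.carrier :=
  A.augIdeal.subtype ∘ₗ (Shift.mk k 1).symm.toLinearMap

@[simp] theorem unbr_br (a : A.carrier) : A.unbr (A.br a) = a - A.ε a • (1 : A.carrier) := rfl
@[simp] theorem ε_unbr (v : A.V) : A.ε (A.unbr v) = 0 := ((Shift.mk k 1).symm v : A.augIdeal).2
@[simp] theorem br_unbr (v : A.V) : A.br (A.unbr v) = v := by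
  apply (Shift.mk k 1).symm.injective
  apply Subtype.ext
  change A.unbr v - A.ε (A.unbr v) • 1 = _
  rw [ε_unbr, zero_smul, sub_zero]
  rfl
@[simp] theorem br_one : A.br 1 = 0 := by
  have := A.br_unbr (A.br 1)
  simpa using this.symm

theorem br_deg : HasDeg A.br (-1) := by
  intro n x hx
  refine Shift.hasDeg_mk 1 n _ ?_
  exact sub_mem hx (smul_mem_deg A.ε_deg one_mem_deg hx)

theorem unbr_deg : HasDeg A.unbr 1 := by
  intro n x hx
  exact Shift.hasDeg_mk_symm (V := A.augIdeal) 1 n x hx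

theorem unbr_sgn (v : A.V) : A.unbr (sgn k _ v) = - sgn k _ (A.unbr v) := by
  rw [sgn_odd A.unbr_deg (by decide), neg_neg]

/-- `d_{s⁻¹Ā} = - s⁻¹ d s`. -/
def barD : A.V →ₗ[k] A.V := - (A.br ∘ₗ A.d ∘ₗ A.unbr)

/-- `s⁻¹ μ (s ⊗ s)`, that is `[a] ⊗ [b] ↦ (-1)^{|[a]|} [ab]`. -/
def barM : A.V →ₗ[k] A.V →ₗ[k] A.V :=
  ((LinearMap.mul k A.carrier).compl₁₂ (A.unbr ∘ₗ sgn k A.V) A.unbr).compr₂ A.br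

theorem barD_apply (v : A.V) : A.barD v = - A.br (A.d (A.unbr v)) := rfl
theorem barM_apply (v w : A.V) : A.barM v w = A.br (A.unbr (sgn k _ v) * A.unbr w) := rfl

theorem barD_deg : HasDeg A.barD 1 :=
  ((A.br_deg.comp (A.d_deg.comp A.unbr_deg rfl) (by norm_num))).neg

theorem isBar : TC.IsBar A.barD A.barM where
  d_deg := A.barD_deg
  m_deg i j v hv w hw := by
    have h1 := A.unbr_deg _ _ (HasDeg.sgn _ _ hv)
    have h2 := A.unbr_deg _ _ hw
    have := A.br_deg _ _ (mul_mem_deg rfl h1 h2)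
    rw [barM_apply]
    convert this using 1
    congr 1
    omega
  d_d v := by simp [barD_apply, A.d_d, A.ε_d]
  d_m v w := by
    have h : ∀ v, sgn k _ (A.barD v) = - A.barD (sgn k _ v) := fun v =>
      sgn_odd A.barD_deg (by decide) v
    simp only [barM_apply, h, sgn_sgn]
    simp [barD_apply, A.d_mul, A.ε_d, A.ε_sgn, A.unbr_sgn, A.d_sgn, sgn_sgn]
  m_m v w u := by
    simp only [barM_apply, sgn_sgn, A.unbr_sgn, unbr_br]
    simp [A.ε_sgn, sgn_mul, mul_assoc, sgn_sgn]

/-- The bar construction: the tensor coalgebra on `s⁻¹Ā`, with the sum of the tensor differentials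
and of the bar-deletion maps as differential. -/
def bar : DGC k := TC.dgc A.isBar
end DGA

/-! ### Maps from a coalgebra to a tensor coalgebra -/
namespace TC
theorem map_sub_right {k M N P Q : Type*} [CommRing k] [AddCommGroup M] [AddCommGroup N]
    [AddCommGroup P] [AddCommGroup Q] [Module k M] [Module k N] [Module k P] [Module k Q]
    (f : M →ₗ[k] P) (g g' : N →ₗ[k] Q) :
    TensorProduct.map f (g - g') = TensorProduct.map f g - TensorProduct.map f g' := by
  ext; simp [TensorProduct.tmul_sub]

section lift
variable {k : Type u} [CommRing k] {V : Type w} [AddCommGroup V] [Module k V]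
  (C : DGC.{u, v} k)
local notation "T" => TensorAlgebra k V
local notation "ι" => TensorAlgebra.ι k

variable {C} in
/-- `c ↦ ∑ f(c₁) E(c₂)`, the product of a letter and a value being given by `a`. -/
def fold {M : Type*} [AddCommGroup M] [Module k M] (a : V →ₗ[k] M →ₗ[k] M)
    (f : C.carrier →ₗ[k] V) (E : C.carrier →ₗ[k] M) : C.carrier →ₗ[k] M :=
  TensorProduct.lift a ∘ₗ TensorProduct.map f E ∘ₗ C.Δ

variable (k V) in
/-- Multiplication of a word by a letter. -/
def act : V →ₗ[k] T →ₗ[k] T := LinearMap.mul k T ∘ₗ ι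

@[simp] theorem act_apply (v : V) (x : T) : act k V v x = ι v * x := rfl

/-- The map `F` satisfies `F(c) = ε(c) + ∑ f(c₁) F(c₂)`. -/
def IsRec (f : C.carrier →ₗ[k] V) (F : C.carrier →ₗ[k] T) : Prop :=
  ∀ c, F c = C.ε c • 1 + fold (act k V) f F c

/-- The recursion `E(c) = ∑ f(c₁) E(c₂)` has only the solution zero. -/
def HasInd (f : C.carrier →ₗ[k] V) : Prop :=
  ∀ (M : Type (max u w)) [AddCommGroup M] [Module k M] (a : V →ₗ[k] M →ₗ[k] M)
    (E : C.carrier →ₗ[k] M), (∀ c, E c = fold a f E c) → E = 0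

variable {C}
variable {f : C.carrier →ₗ[k] V} {F : C.carrier →ₗ[k] TensorAlgebra k V}

theorem IsRec.Δ (hF : IsRec C f F) (hf : HasInd C f) (c : C.carrier) :
    decon k V (F c) = TensorProduct.map F F (C.Δ c) := by
  have h1 : ∀ c, decon k V (F c) = 1 ⊗ₜ F c + fold lmul f (decon k V ∘ₗ F) c := by
    intro c
    have h : ∀ s, decon k V (TensorProduct.lift (act k V) (TensorProduct.map f F s)) =
        1 ⊗ₜ TensorProduct.lift (act k V) (TensorProduct.map f F s) +
        TensorProduct.lift lmul (TensorProduct.map f (decon k V ∘ₗ F) s) := by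
      intro s
      induction s with
      | zero => simp
      | add s t hs ht => simp only [map_add, hs, ht, TensorProduct.tmul_add]; abel
      | tmul a b => simp
    rw [hF c, map_add, map_smul, decon_one, TensorProduct.tmul_add, add_assoc]
    simp only [fold, LinearMap.comp_apply]
    rw [h, TensorProduct.tmul_smul]
  have h2 : ∀ c, TensorProduct.map F F (C.Δ c) = 1 ⊗ₜ F c +
      fold lmul f (TensorProduct.map F F ∘ₗ C.Δ) c := by
    intro c
    have hFe : F = (LinearMap.toSpanSingleton k T 1) ∘ₗ C.ε + fold (act k V) f F := by
      ext c; exact hF c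
    have e1 : ∀ s, TensorProduct.map ((LinearMap.toSpanSingleton k T 1) ∘ₗ C.ε) F s =
        1 ⊗ₜ F (TensorProduct.lid k _ (TensorProduct.map C.ε LinearMap.id s)) := by
      intro s
      induction s with
      | zero => simp
      | add s t hs ht => simp only [map_add, hs, ht, TensorProduct.tmul_add]
      | tmul a b => simp [← TensorProduct.smul_tmul']
    let G := TensorProduct.lift lmul ∘ₗ TensorProduct.map f (TensorProduct.map F F)
    have e2 : ∀ s, TensorProduct.map (fold (act k V) f F) F s =
        G (TensorProduct.assoc k _ _ _ (TensorProduct.map C.Δ LinearMap.id s)) := by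
      intro s
      induction s with
      | zero => simp
      | add s t hs ht => simp only [map_add, hs, ht]
      | tmul a b =>
        simp only [TensorProduct.map_tmul, fold, LinearMap.comp_apply, LinearMap.id_apply]
        generalize C.Δ a = t
        induction t with
        | zero => simp
        | add s t hs ht => simp only [map_add, hs, ht, TensorProduct.add_tmul]
        | tmul p q => simp [G]
    have e3 : ∀ s, G (TensorProduct.map LinearMap.id C.Δ s) =
        TensorProduct.lift lmul (TensorProduct.map f (TensorProduct.map F F ∘ₗ C.Δ) s) := by
      intro s
      induction s with
      | zero => simp
      | add s t hs ht => simp only [map_add, hs, ht]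
      | tmul a b => simp [G]
    have e0 : TensorProduct.map F F = TensorProduct.map ((LinearMap.toSpanSingleton k T 1) ∘ₗ C.ε +
      fold (act k V) f F) F := by rw [← hFe]
    refine (LinearMap.congr_fun e0 _).trans ?_
    rw [TensorProduct.map_add_left, LinearMap.add_apply, e1, C.counit_left, e2, C.coassoc, e3]
    rfl
  have := hf _ lmul (decon k V ∘ₗ F - TensorProduct.map F F ∘ₗ C.Δ) (by
    intro c
    have h3 : fold lmul f (decon k V ∘ₗ F - TensorProduct.map F F ∘ₗ C.Δ) c =
      fold lmul f (decon k V ∘ₗ F) c - fold lmul f (TensorProduct.map F F ∘ₗ C.Δ) c := by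
      simp [fold, map_sub_right]
    rw [h3, LinearMap.sub_apply, LinearMap.comp_apply, LinearMap.comp_apply, h1, h2]
    abel)
  have := LinearMap.congr_fun this c
  simpa [sub_eq_zero] using this

variable [GrMod k V] {d₁ : V →ₗ[k] V} {m : V →ₗ[k] V →ₗ[k] V}

theorem IsRec.d (hF : IsRec C f F) (hf : HasInd C (sgn k V ∘ₗ f)) (hdeg : HasDeg f 0)
    (ht : ∀ c, d₁ (f c) + TensorProduct.lift m (TensorProduct.map f f (C.Δ c)) = f (C.d c))
    (c : C.carrier) : F (C.d c) = coder d₁ m (F c) := by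
  have h1 : ∀ c, coder d₁ m (F c) = fold (act k V) (d₁ ∘ₗ f) F c +
      TensorProduct.lift (merge m).flip (TensorProduct.map f F (C.Δ c)) +
      fold (act k V) (sgn k V ∘ₗ f) (coder d₁ m ∘ₗ F) c := by
    intro c
    rw [hF c, map_add, map_smul, coder_one, smul_zero, zero_add]
    simp only [fold, LinearMap.comp_apply]
    generalize C.Δ c = s
    induction s with
    | zero => simp
    | add s t hs ht => simp only [map_add, hs, ht]; abel
    | tmul a b => simp
  have h2 : ∀ c, TensorProduct.lift (merge m).flip (TensorProduct.map f F (C.Δ c)) =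
      fold (act k V) (TensorProduct.lift m ∘ₗ TensorProduct.map f f ∘ₗ C.Δ) F c := by
    intro c
    let H : C.carrier ⊗[k] (C.carrier ⊗[k] C.carrier) →ₗ[k] T := TensorProduct.lift (act k V) ∘ₗ
      TensorProduct.map (TensorProduct.lift m) LinearMap.id ∘ₗ
      (TensorProduct.assoc k V V T).symm.toLinearMap ∘ₗ
      TensorProduct.map f (TensorProduct.map f F)
    have e1 : ∀ s, TensorProduct.lift (merge m).flip (TensorProduct.map f F s) =
        H (TensorProduct.map LinearMap.id C.Δ s) := by
      intro s
      induction s with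
      | zero => simp
      | add s t hs ht => simp only [map_add, hs, ht]
      | tmul a b =>
        simp only [TensorProduct.map_tmul, TensorProduct.lift.tmul, LinearMap.flip_apply]
        rw [hF b, map_add, map_smul, LinearMap.add_apply, LinearMap.smul_apply, merge_one, smul_zero,
          zero_add]
        simp only [fold, LinearMap.comp_apply]
        generalize C.Δ b = t
        induction t with
        | zero => simp
        | add s t hs ht =>
          simp only [map_add, LinearMap.add_apply, hs, ht, TensorProduct.tmul_add]
        | tmul p q => simp [H]
    have e2 : ∀ s, H (TensorProduct.assoc k _ _ _ (TensorProduct.map C.Δ LinearMap.id s)) =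
        TensorProduct.lift (act k V) (TensorProduct.map
          (TensorProduct.lift m ∘ₗ TensorProduct.map f f ∘ₗ C.Δ) F s) := by
      intro s
      induction s with
      | zero => simp
      | add s t hs ht => simp only [map_add, hs, ht]
      | tmul a b =>
        simp only [TensorProduct.map_tmul, LinearMap.comp_apply, LinearMap.id_apply]
        generalize C.Δ a = t
        induction t with
        | zero => simp
        | add s t hs ht => simp only [map_add, hs, ht, TensorProduct.add_tmul]
        | tmul p q => simp [H]
    rw [e1, ← C.coassoc, e2]; rfl
  have h3 : ∀ c, F (C.d c) = fold (act k V) (f ∘ₗ C.d) F c +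
      fold (act k V) (sgn k V ∘ₗ f) (F ∘ₗ C.d) c := by
    intro c
    rw [hF, C.ε_d, zero_smul, zero_add]
    simp only [fold, LinearMap.comp_apply, C.Δ_d, map_add]
    generalize C.Δ c = s
    induction s with
    | zero => simp
    | add s t hs ht =>
      simp only [map_add] at hs ht ⊢
      linear_combination (norm := module) hs + ht
    | tmul a b => simp [sgn_even hdeg]
  have h4 : f ∘ₗ C.d = d₁ ∘ₗ f + TensorProduct.lift m ∘ₗ TensorProduct.map f f ∘ₗ C.Δ := by
    ext c; exact (ht c).symm
  have := hf _ (act k V) (F ∘ₗ C.d - coder d₁ m ∘ₗ F) (by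
    intro c
    have h5 : fold (act k V) (sgn k V ∘ₗ f) (F ∘ₗ C.d - coder d₁ m ∘ₗ F) c =
      fold (act k V) (sgn k V ∘ₗ f) (F ∘ₗ C.d) c -
      fold (act k V) (sgn k V ∘ₗ f) (coder d₁ m ∘ₗ F) c := by
      simp [fold, map_sub_right]
    rw [h5, LinearMap.sub_apply, LinearMap.comp_apply, LinearMap.comp_apply, h1, h2, h3, h4]
    have h6 : ∀ g g' : C.carrier →ₗ[k] V, fold (act k V) (g + g') F c =
        fold (act k V) g F c + fold (act k V) g' F c := by
      intro g g'; simp [fold, TensorProduct.map_add_left]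
    rw [h6]; abel)
  have := LinearMap.congr_fun this c
  simpa [sub_eq_zero] using this
end lift
end TC

/-! ### Shuffles -/
namespace TC
variable {k : Type u} [CommRing k] {V₁ : Type v} [AddCommGroup V₁] [Module k V₁] [GrMod k V₁]
  {V₂ : Type w} [AddCommGroup V₂] [Module k V₂] [GrMod k V₂]
  {V : Type x} [AddCommGroup V] [Module k V]

/-- `x ↦ w · G(x)` with the Koszul sign `(-1)^{|w||x|}` for moving `w` past `x`. -/
def tail (i₂ : V₂ →ₗ[k] V) : V₂ →ₗ[k] (TensorAlgebra k V₁ →ₗ[k] TensorAlgebra k V) →ₗ[k]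
    (TensorAlgebra k V₁ →ₗ[k] TensorAlgebra k V) :=
  LinearMap.mk₂ k (fun w G => LinearMap.mulLeft k (TensorAlgebra.ι k (i₂ w)) ∘ₗ G -
      (2 : k) • (LinearMap.mulLeft k (TensorAlgebra.ι k (i₂ (odd k V₂ w))) ∘ₗ G ∘ₗ odd k _))
    (by intros; ext; simp [add_mul]; module) (by intros; ext; simp; module)
    (by intros; ext; simp [mul_add]; module) (by intros; ext; simp; module)

theorem tail_apply (i₂ : V₂ →ₗ[k] V) (w : V₂) (G : TensorAlgebra k V₁ →ₗ[k] TensorAlgebra k V)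
    (x : TensorAlgebra k V₁) : tail i₂ w G x = TensorAlgebra.ι k (i₂ w) * G x -
      (2 : k) • (TensorAlgebra.ι k (i₂ (odd k V₂ w)) * G (odd k _ x)) := rfl

/-- `x ↦ ∑ ± x' · w · G(x'')`, the sum over all ways to cut the word `x = x'x''`: the letter `w` is
inserted at each place of `x`, with the Koszul sign for moving it past `x''`. -/
def ins (i₁ : V₁ →ₗ[k] V) (i₂ : V₂ →ₗ[k] V) :
    V₂ →ₗ[k] (TensorAlgebra k V₁ →ₗ[k] TensorAlgebra k V) →ₗ[k]
      (TensorAlgebra k V₁ →ₗ[k] TensorAlgebra k V) :=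
  LinearMap.mk₂ k (fun w G => LinearMap.mul' k _ ∘ₗ
      TensorProduct.map (TensorAlgebra.lift k (TensorAlgebra.ι k ∘ₗ i₁)).toLinearMap
        (tail i₂ w G) ∘ₗ decon k V₁)
    (by intros; simp [TensorProduct.map_add_right, LinearMap.add_comp, LinearMap.comp_add])
    (by intros; simp [TensorProduct.map_smul_right, LinearMap.smul_comp, LinearMap.comp_smul])
    (by intros; simp [TensorProduct.map_add_right, LinearMap.add_comp, LinearMap.comp_add])
    (by intros; simp [TensorProduct.map_smul_right, LinearMap.smul_comp, LinearMap.comp_smul])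

/-- The sum of all shuffles of a word `y` in `V₂` with a word `x` in `V₁`, by recursion on `y`:
`w y` and `x` are shuffled by inserting `w` somewhere in `x` and shuffling `y` with the letters of
`x` to the right of `w`. -/
def shuf (i₁ : V₁ →ₗ[k] V) (i₂ : V₂ →ₗ[k] V) :
    TensorAlgebra k V₂ →ₗ[k] TensorAlgebra k V₁ →ₗ[k] TensorAlgebra k V :=
  wordRec (TensorAlgebra.lift k (TensorAlgebra.ι k ∘ₗ i₁)).toLinearMap 0 (ins i₁ i₂)

/-- The sum of all shuffles of a word `x` in `V₁` and a word `y` in `V₂`, with Koszul signs, as a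
sum of words in `V`. -/
def shuffle (i₁ : V₁ →ₗ[k] V) (i₂ : V₂ →ₗ[k] V) :
    TensorAlgebra k V₁ ⊗[k] TensorAlgebra k V₂ →ₗ[k] TensorAlgebra k V :=
  TensorProduct.lift (shuf i₁ i₂).flip

variable (i₁ : V₁ →ₗ[k] V) (i₂ : V₂ →ₗ[k] V)
local notation "ι" => TensorAlgebra.ι k

theorem ins_one (w : V₂) (G : TensorAlgebra k V₁ →ₗ[k] TensorAlgebra k V) :
    ins i₁ i₂ w G 1 = ι (i₂ w) * G 1 := by
  simp [ins, tail_apply, GrMod.odd_one]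

theorem ins_cons (w : V₂) (G : TensorAlgebra k V₁ →ₗ[k] TensorAlgebra k V) (v : V₁)
    (x : TensorAlgebra k V₁) :
    ins i₁ i₂ w G (ι v * x) = tail i₂ w G (ι v * x) + ι (i₁ v) * ins i₁ i₂ w G x := by
  simp only [ins, LinearMap.mk₂_apply, LinearMap.comp_apply, decon_cons, map_add]
  congr 1
  · simp
  · generalize decon k V₁ x = t
    induction t with
    | zero => simp
    | add s t hs ht => simp only [map_add, hs, ht, mul_add]
    | tmul a b => simp [mul_assoc]

theorem shuffle_one_one : shuffle i₁ i₂ (1 ⊗ₜ 1) = 1 := by simp [shuffle, shuf]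

theorem shuffle_cons_one (v : V₁) (x : TensorAlgebra k V₁) :
    shuffle i₁ i₂ ((ι v * x) ⊗ₜ 1) = ι (i₁ v) * shuffle i₁ i₂ (x ⊗ₜ 1) := by
  simp [shuffle, shuf]

theorem shuffle_one_cons (w : V₂) (y : TensorAlgebra k V₂) :
    shuffle i₁ i₂ (1 ⊗ₜ (ι w * y)) = ι (i₂ w) * shuffle i₁ i₂ (1 ⊗ₜ y) := by
  simp [shuffle, shuf, ins_one]

/-- The first letter of a shuffle of `v x` and `w y` is either `v` or `w`. -/
theorem shuffle_cons_cons (v : V₁) (x : TensorAlgebra k V₁) (w : V₂) (y : TensorAlgebra k V₂) :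
    shuffle i₁ i₂ ((ι v * x) ⊗ₜ (ι w * y)) =
      ι (i₁ v) * shuffle i₁ i₂ (x ⊗ₜ (ι w * y)) + (ι (i₂ w) * shuffle i₁ i₂ ((ι v * x) ⊗ₜ y) -
        (2 : k) • (ι (i₂ (odd k _ w)) * shuffle i₁ i₂ (odd k _ (ι v * x) ⊗ₜ y))) := by
  simp only [shuffle, TensorProduct.lift.tmul, LinearMap.flip_apply, shuf, wordRec_cons,
    ins_cons, LinearMap.zero_apply, zero_add, tail_apply]
  abel

/-- The projection on the words of length one. -/
def letter (k : Type u) [CommRing k] (W : Type v) [AddCommGroup W] [Module k W] :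
    TensorAlgebra k W →ₗ[k] W :=
  wordRec 0 (LinearMap.mk₂ k (fun w x => counit k W x • w) (by intros; simp)
    (by intro c w x; simp only [smul_comm c]) (by intros; simp [add_smul]) (by intros; simp [mul_smul])) 0

section letter
variable {W : Type w} [AddCommGroup W] [Module k W]
@[simp] theorem letter_one : letter k W 1 = 0 := by simp [letter]
@[simp] theorem letter_cons (w : W) (x : TensorAlgebra k W) :
    letter k W (ι w * x) = counit k W x • w := by simp [letter]
@[simp] theorem letter_ι (w : W) : letter k W (ι w) = w := by
  have := letter_cons w (1 : TensorAlgebra k W)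
  simpa using this

theorem letter_merge (m : W →ₗ[k] W →ₗ[k] W) (v : W) (x : TensorAlgebra k W) :
    letter k W (merge m x v) = m v (letter k W x) := by
  refine word_induction x ?_ (fun c x h => ?_) (fun x y hx hy => ?_) ?_
  · simp
  · simp only [map_smul, h, LinearMap.smul_apply]
  · simp only [map_add, hx, hy, LinearMap.add_apply]
  · simp

theorem letter_counit (x : TensorAlgebra k W) {M : Type*} [AddCommGroup M] [Module k M]
    (f : TensorAlgebra k W →ₗ[k] M) :
    TensorProduct.lift ((LinearMap.lsmul k M ∘ₗ counit k W).compl₂ f) (decon k W x) = f x := by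
  conv_rhs => rw [← counit_left x]
  generalize decon k W x = t
  induction t with
  | zero => simp
  | add s t hs ht => simp only [map_add, hs, ht]
  | tmul a b => simp

variable [GrMod k W]
theorem letter_deg : HasDeg (letter k W) 0 := by
  refine word_hasDeg (by simp) ?_
  intro i j v hv x hx _
  rw [letter_cons]
  by_cases hj : j = 0
  · subst hj; simpa using Submodule.smul_mem _ _ hv
  · rw [fun_zero counit_deg hj hx]; simp

variable (d₁ : W →ₗ[k] W) (m : W →ₗ[k] W →ₗ[k] W)
theorem letter_coder (x : TensorAlgebra k W) : letter k W (coder d₁ m x) = d₁ (letter k W x) +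
    TensorProduct.lift m (TensorProduct.map (letter k W) (letter k W) (decon k W x)) := by
  refine word_induction x ?_ (fun c x h => ?_) (fun x y hx hy => ?_) ?_
  · simp
  · simp only [map_smul, h, smul_add]
  · simp only [map_add, hx, hy]; abel
  · intro v x _
    have h : TensorProduct.lift m (TensorProduct.map (letter k W) (letter k W)
        (lmul v (decon k W x))) = m v (letter k W x) := by
      refine Eq.trans ?_ (letter_counit x (m v ∘ₗ letter k W))
      generalize decon k W x = t
      induction t with
      | zero => simp
      | add s t hs ht => simp only [map_add, hs, ht]
      | tmul a b => simp
    simp [letter_merge, counit_coder, h]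
end letter

/-- The component of the shuffle map in words of length one. -/
def letters : TensorAlgebra k V₁ ⊗[k] TensorAlgebra k V₂ →ₗ[k] V :=
  (TensorProduct.rid k V).toLinearMap ∘ₗ
    TensorProduct.map (i₁ ∘ₗ letter k V₁) (counit k V₂) +
  (TensorProduct.lid k V).toLinearMap ∘ₗ
    TensorProduct.map (counit k V₁) (i₂ ∘ₗ letter k V₂)

@[simp] theorem letters_tmul (x : TensorAlgebra k V₁) (y : TensorAlgebra k V₂) :
    letters i₁ i₂ (x ⊗ₜ y) = counit k V₂ y • i₁ (letter k V₁ x) +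
      counit k V₁ x • i₂ (letter k V₂ y) := by simp [letters]

@[simp] theorem counit_odd (x : TensorAlgebra k V₁) : counit k V₁ (odd k _ x) = 0 :=
  fun_odd counit_deg x
@[simp] theorem letter_odd (x : TensorAlgebra k V₁) :
    letter k V₁ (odd k _ x) = odd k _ (letter k V₁ x) := (odd_even letter_deg (by simp) x).symm

section fold
variable {M : Type*} [AddCommGroup M] [Module k M] (a : V →ₗ[k] M →ₗ[k] M)
  (E : TensorAlgebra k V₁ ⊗[k] TensorAlgebra k V₂ →ₗ[k] M)

/-- `∑ letters(c₁) E(c₂)` -/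
def tfold : (TensorAlgebra k V₁ ⊗[k] TensorAlgebra k V₁) ⊗[k]
    (TensorAlgebra k V₂ ⊗[k] TensorAlgebra k V₂) →ₗ[k] M :=
  TensorProduct.lift a ∘ₗ TensorProduct.map (letters i₁ i₂) E ∘ₗ mid k _ _ _ _

theorem tfold_one_one (x : TensorAlgebra k V₁) (y : TensorAlgebra k V₂) :
    tfold i₁ i₂ a E ((1 ⊗ₜ x) ⊗ₜ (1 ⊗ₜ y)) = 0 := by
  simp [tfold, mid_tmul, GrMod.odd_one]

theorem tfold_one_cons (x : TensorAlgebra k V₁) (w : V₂) (y : TensorAlgebra k V₂) :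
    tfold i₁ i₂ a E ((1 ⊗ₜ x) ⊗ₜ lmul w (decon k V₂ y)) =
      a (i₂ w) (E (x ⊗ₜ y)) - (2 : k) • a (i₂ (odd k _ w)) (E (odd k _ x ⊗ₜ y)) := by
  have h : ∀ t, tfold i₁ i₂ a E ((1 ⊗ₜ x) ⊗ₜ lmul w t) =
      TensorProduct.lift ((LinearMap.lsmul k M ∘ₗ counit k V₂).compl₂
        (a (i₂ w) ∘ₗ E ∘ₗ TensorProduct.mk k _ _ x -
          (2 : k) • (a (i₂ (odd k _ w)) ∘ₗ E ∘ₗ TensorProduct.mk k _ _ (odd k _ x)))) t := by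
    intro t
    induction t with
    | zero => simp
    | add s t hs ht => simp only [map_add, TensorProduct.tmul_add, hs, ht]
    | tmul p q =>
      simp [tfold, mid_tmul, smul_sub]
      exact smul_comm _ _ _
  rw [h, letter_counit]
  simp

theorem tfold_cons_one (v : V₁) (x : TensorAlgebra k V₁) (y : TensorAlgebra k V₂) :
    tfold i₁ i₂ a E (lmul v (decon k V₁ x) ⊗ₜ (1 ⊗ₜ y)) = a (i₁ v) (E (x ⊗ₜ y)) := by
  have h : ∀ t, tfold i₁ i₂ a E (lmul v t ⊗ₜ (1 ⊗ₜ y)) =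
      TensorProduct.lift ((LinearMap.lsmul k M ∘ₗ counit k V₁).compl₂
        (a (i₁ v) ∘ₗ E ∘ₗ (TensorProduct.mk k _ _).flip y)) t := by
    intro t
    induction t with
    | zero => simp
    | add s t hs ht => simp only [map_add, TensorProduct.add_tmul, hs, ht]
    | tmul p q => simp [tfold, mid_tmul, GrMod.odd_one]
  rw [h, letter_counit]
  simp

theorem tfold_cons_cons (v : V₁) (s : TensorAlgebra k V₁ ⊗[k] TensorAlgebra k V₁) (w : V₂)
    (t : TensorAlgebra k V₂ ⊗[k] TensorAlgebra k V₂) :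
    tfold i₁ i₂ a E (lmul v s ⊗ₜ lmul w t) = 0 := by
  induction s with
  | zero => simp
  | add s t hs ht => simp only [map_add, TensorProduct.add_tmul, hs, ht, add_zero]
  | tmul p q =>
  induction t with
  | zero => simp
  | add s t hs ht => simp only [map_add, TensorProduct.tmul_add, hs, ht, add_zero]
  | tmul p' q' => simp [tfold, mid_tmul]

theorem tfold_zero
    (h : ∀ x y, E (x ⊗ₜ y) = tfold i₁ i₂ a E (decon k V₁ x ⊗ₜ decon k V₂ y)) : E = 0 := by
  refine TensorProduct.ext' fun x y => ?_
  rw [LinearMap.zero_apply]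
  revert x
  refine word_induction y ?_ (fun c y h x => ?_) (fun y y' hy hy' x => ?_) ?_
  · intro x
    refine word_induction x ?_ (fun c y h => ?_) (fun y y' hy hy' => ?_) ?_
    · rw [h, decon_one, decon_one, tfold_one_one]
    · rw [← TensorProduct.smul_tmul', map_smul, h, smul_zero]
    · rw [TensorProduct.add_tmul, map_add, hy, hy', add_zero]
    · intro v x hx
      rw [h, decon_one, decon_cons, TensorProduct.add_tmul, map_add, tfold_one_one, tfold_cons_one,
        hx, map_zero, add_zero]
  · rw [TensorProduct.tmul_smul, map_smul, h, smul_zero]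
  · rw [TensorProduct.tmul_add, map_add, hy, hy', add_zero]
  · intro w y hy x
    refine word_induction x ?_ (fun c y h => ?_) (fun y y' hy hy' => ?_) ?_
    · rw [h, decon_one, decon_cons, TensorProduct.tmul_add, map_add, tfold_one_one, tfold_one_cons,
        hy, hy]
      simp
    · rw [← TensorProduct.smul_tmul', map_smul, h, smul_zero]
    · rw [TensorProduct.add_tmul, map_add, hy, hy', add_zero]
    · intro v x hx
      rw [h, decon_cons, decon_cons, TensorProduct.tmul_add, TensorProduct.add_tmul,
        TensorProduct.add_tmul, map_add, map_add, map_add, tfold_one_one, tfold_one_cons,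
        tfold_cons_one, tfold_cons_cons, hx, hy, hy]
      simp

theorem shuffle_rec (x : TensorAlgebra k V₁) (y : TensorAlgebra k V₂) :
    shuffle i₁ i₂ (x ⊗ₜ y) = (counit k V₁ x * counit k V₂ y) • 1 +
      tfold i₁ i₂ (act k V) (shuffle i₁ i₂) (decon k V₁ x ⊗ₜ decon k V₂ y) := by
  refine word_induction x ?_ (fun c x h => ?_) (fun x x' hx hx' => ?_) (fun v x _ => ?_)
  · refine word_induction y ?_ (fun c y h => ?_) (fun y y' hy hy' => ?_) (fun w y _ => ?_)
    · rw [decon_one, decon_one, tfold_one_one, shuffle_one_one]; simp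
    · simp only [TensorProduct.tmul_smul, map_smul, h, smul_add, mul_smul, smul_assoc]
      simp [smul_comm c]
    · simp only [TensorProduct.tmul_add, map_add, hy, hy', mul_add, add_smul]; abel
    · rw [decon_one, decon_cons, TensorProduct.tmul_add, map_add, tfold_one_one, tfold_one_cons,
        shuffle_one_cons]
      simp [GrMod.odd_one]
  · simp only [← TensorProduct.smul_tmul', map_smul, h, smul_add]
    simp [mul_smul]
  · simp only [TensorProduct.add_tmul, map_add, hx, hx', add_mul, add_smul]; abel
  · refine word_induction y ?_ (fun c y h => ?_) (fun y y' hy hy' => ?_) (fun w y _ => ?_)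
    · rw [decon_one, decon_cons, TensorProduct.add_tmul, map_add, tfold_one_one, tfold_cons_one,
        shuffle_cons_one]
      simp
    · simp only [TensorProduct.tmul_smul, map_smul, h, smul_add]
      simp
    · simp only [TensorProduct.tmul_add, map_add, hy, hy', mul_add, add_smul]; abel
    · rw [decon_cons, decon_cons, TensorProduct.tmul_add, TensorProduct.add_tmul,
        TensorProduct.add_tmul, map_add, map_add, map_add, tfold_one_one, tfold_one_cons,
        tfold_cons_one, tfold_cons_cons, shuffle_cons_cons]
      simp
end fold

end TC

namespace GrMod
/-- Induction on homogeneous words. -/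
theorem word_deg_induction {k : Type u} [CommRing k] {V : Type v} [AddCommGroup V] [Module k V]
    [GrMod k V] {P : ℤ → TensorAlgebra k V → Prop} (one : P 0 1) (zero : ∀ n, P n 0)
    (smul : ∀ n (c : k) x, P n x → P n (c • x)) (add : ∀ n x y, P n x → P n y → P n (x + y))
    (cons : ∀ i j, ∀ v ∈ deg k V i, ∀ x ∈ deg k (TensorAlgebra k V) j, P j x →
      P (i + j) (TensorAlgebra.ι k v * x))
    {n : ℤ} {t : TensorAlgebra k V} (ht : t ∈ deg k (TensorAlgebra k V) n) : P n t := by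
  refine Submodule.span_induction ?_ (zero n) (fun x y _ _ hx hy => add n x y hx hy)
    (fun c x _ hx => smul n c x hx) ht
  rintro _ ⟨l, hl, rfl, rfl⟩
  clear ht
  induction l with
  | nil => simpa using one
  | cons q l ih =>
    simp only [List.map_cons, List.prod_cons, List.sum_cons]
    exact cons _ _ _ (hl q (by simp)) _
      (Submodule.subset_span ⟨l, fun q hq => hl q (by simp [hq]), rfl, rfl⟩)
      (ih (fun q hq => hl q (by simp [hq])))
end GrMod

namespace TC
variable {k : Type u} [CommRing k] {V₁ : Type v} [AddCommGroup V₁] [Module k V₁] [GrMod k V₁]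
  {V₂ : Type w} [AddCommGroup V₂] [Module k V₂] [GrMod k V₂]
  {V : Type x} [AddCommGroup V] [Module k V] [GrMod k V] {i₁ : V₁ →ₗ[k] V} {i₂ : V₂ →ₗ[k] V}
local notation "ι" => TensorAlgebra.ι k

theorem shuffle_deg (h₁ : HasDeg i₁ 0) (h₂ : HasDeg i₂ 0) : HasDeg (shuffle i₁ i₂) 0 := by
  refine hasDeg_tensor ?_
  intro i j x hx y hy
  have hi : ∀ {n} {v : V₁}, v ∈ deg k V₁ n → ι (i₁ v) ∈ deg k _ n := fun hv =>
    wordDeg_ι (by simpa using h₁ _ _ hv)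
  have hj : ∀ {n} {v : V₂}, v ∈ deg k V₂ n → ι (i₂ v) ∈ deg k _ n := fun hv =>
    wordDeg_ι (by simpa using h₂ _ _ hv)
  rw [add_zero]
  revert i x
  refine word_deg_induction (P := fun j y => ∀ i, ∀ x ∈ deg k (TensorAlgebra k V₁) i,
    shuffle i₁ i₂ (x ⊗ₜ y) ∈ deg k _ (i + j)) ?_ ?_ ?_ ?_ ?_ hy
  · intro i x hx
    have e : shuffle i₁ i₂ (x ⊗ₜ 1) = TensorAlgebra.lift k (ι ∘ₗ i₁) x := by simp [shuffle, shuf]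
    rw [e, add_zero]
    simpa using hasDeg_lift (f := ι ∘ₗ i₁) (hasDeg_ι.comp h₁ (add_zero 0)) i x hx
  · intro n i x hx; simp
  · intro n c y h i x hx
    rw [TensorProduct.tmul_smul, map_smul]; exact Submodule.smul_mem _ _ (h i x hx)
  · intro n y y' h h' i x hx
    rw [TensorProduct.tmul_add, map_add]; exact add_mem (h i x hx) (h' i x hx)
  · intro a b w hw y hy ih i x hx
    have ho : odd k V₂ w ∈ deg k V₂ a := by simpa using HasDeg.odd _ _ hw
    refine word_deg_induction (P := fun i x =>
      shuffle i₁ i₂ (x ⊗ₜ (ι w * y)) ∈ deg k _ (i + (a + b))) ?_ ?_ ?_ ?_ ?_ hx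
    · rw [shuffle_one_cons]
      exact mul_mem_deg (by omega) (hj hw) (ih 0 1 one_mem_deg)
    · simp
    · intro n c x h
      rw [← TensorProduct.smul_tmul', map_smul]; exact Submodule.smul_mem _ _ h
    · intro n x x' h h'
      rw [TensorProduct.add_tmul, map_add]; exact add_mem h h'
    · intro p q v hv x hx h
      rw [shuffle_cons_cons]
      have hvx : ι v * x ∈ deg k (TensorAlgebra k V₁) (p + q) := mul_mem_deg rfl (wordDeg_ι hv) hx
      have hvo : odd k _ (ι v * x) ∈ deg k (TensorAlgebra k V₁) (p + q) := by
        simpa using HasDeg.odd _ _ hvx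
      refine add_mem ?_ (sub_mem ?_ (Submodule.smul_mem _ _ ?_))
      · exact mul_mem_deg (by omega) (hi hv) h
      · exact mul_mem_deg (by omega) (hj hw) (ih _ _ hvx)
      · exact mul_mem_deg (by omega) (hj ho) (ih _ _ hvo)

variable {d₁ : V₁ →ₗ[k] V₁} {m₁ : V₁ →ₗ[k] V₁ →ₗ[k] V₁} {d₂ : V₂ →ₗ[k] V₂}
  {m₂ : V₂ →ₗ[k] V₂ →ₗ[k] V₂} {d : V →ₗ[k] V} {m : V →ₗ[k] V →ₗ[k] V}

variable (i₁ i₂ d₁ m₁ d₂ m₂ d m) in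
/-- The hypotheses under which the shuffle map is a map of differential coalgebras. -/
structure IsShuffle : Prop where
  deg₁ : HasDeg i₁ 0
  deg₂ : HasDeg i₂ 0
  map_d₁ : ∀ v, i₁ (d₁ v) = d (i₁ v)
  map_d₂ : ∀ v, i₂ (d₂ v) = d (i₂ v)
  map_m₁ : ∀ v w, i₁ (m₁ v w) = m (i₁ v) (i₁ w)
  map_m₂ : ∀ v w, i₂ (m₂ v w) = m (i₂ v) (i₂ w)
  comm : ∀ v w, m (i₁ v) (i₂ w) + m (i₂ w) (i₁ v) -
    (2 : k) • m (i₂ (odd k _ w)) (i₁ (odd k _ v)) = 0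

theorem letters_Δ (x : TensorAlgebra k V₁) (y : TensorAlgebra k V₂) :
    TensorProduct.lift m (TensorProduct.map (letters i₁ i₂) (letters i₁ i₂)
      (mid k _ _ _ _ (decon k V₁ x ⊗ₜ decon k V₂ y))) =
    counit k V₂ y • TensorProduct.lift m (TensorProduct.map (i₁ ∘ₗ letter k V₁)
      (i₁ ∘ₗ letter k V₁) (decon k V₁ x)) +
    (m (i₁ (letter k V₁ x)) (i₂ (letter k V₂ y)) + m (i₂ (letter k V₂ y)) (i₁ (letter k V₁ x)) -
    (2 : k) • m (i₂ (odd k _ (letter k V₂ y))) (i₁ (odd k _ (letter k V₁ x)))) +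
    counit k V₁ x • TensorProduct.lift m (TensorProduct.map (i₂ ∘ₗ letter k V₂)
      (i₂ ∘ₗ letter k V₂) (decon k V₂ y)) := by
  have key : ∀ s t, TensorProduct.lift m (TensorProduct.map (letters i₁ i₂) (letters i₁ i₂)
      (mid k _ _ _ _ (s ⊗ₜ t))) =
    TensorProduct.lift ((LinearMap.lsmul k k ∘ₗ counit k V₂).compl₂ (counit k V₂)) t •
      TensorProduct.lift m (TensorProduct.map (i₁ ∘ₗ letter k V₁) (i₁ ∘ₗ letter k V₁) s) +
    (m (i₁ (letter k V₁ (TensorProduct.rid k _ (TensorProduct.map LinearMap.id (counit k V₁) s))))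
      (i₂ (TensorProduct.lift ((LinearMap.lsmul k V₂ ∘ₗ counit k V₂).compl₂ (letter k V₂)) t)) +
     m (i₂ (letter k V₂ (TensorProduct.rid k _ (TensorProduct.map LinearMap.id (counit k V₂) t))))
      (i₁ (TensorProduct.lift ((LinearMap.lsmul k V₁ ∘ₗ counit k V₁).compl₂ (letter k V₁)) s)) -
    (2 : k) •
     m (i₂ (odd k _ (letter k V₂ (TensorProduct.rid k _
          (TensorProduct.map LinearMap.id (counit k V₂) t)))))
      (i₁ (odd k _ (TensorProduct.lift ((LinearMap.lsmul k V₁ ∘ₗ counit k V₁).compl₂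
        (letter k V₁)) s)))) +
    TensorProduct.lift ((LinearMap.lsmul k k ∘ₗ counit k V₁).compl₂ (counit k V₁)) s •
      TensorProduct.lift m (TensorProduct.map (i₂ ∘ₗ letter k V₂) (i₂ ∘ₗ letter k V₂) t) := by
    intro s t
    induction s with
    | zero => simp
    | add s s' hs hs' =>
      simp only [map_add, TensorProduct.add_tmul, hs, hs', LinearMap.add_apply]; module
    | tmul p q =>
    induction t with
    | zero => simp
    | add s s' hs hs' =>
      simp only [map_add, TensorProduct.tmul_add, hs, hs', LinearMap.add_apply]; module
    | tmul p' q' =>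
      simp [mid_tmul]
      module
  rw [key, letter_counit, letter_counit, letter_counit, letter_counit, counit_right, counit_right]

theorem tensor_ext {C : DGC.{u, v} k} {D : DGC.{u, w} k} {M : Type*} [AddCommGroup M] [Module k M]
    {f g : (C.tensor D).carrier →ₗ[k] M}
    (h : ∀ (x : C.carrier) (y : D.carrier), f (x ⊗ₜ[k] y : C.carrier ⊗[k] D.carrier) =
      g (x ⊗ₜ[k] y : C.carrier ⊗[k] D.carrier)) : f = g :=
  TensorProduct.ext' h

theorem letters_deg (h₁ : HasDeg i₁ 0) (h₂ : HasDeg i₂ 0) : HasDeg (letters i₁ i₂) 0 := by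
  refine hasDeg_tensor ?_
  intro i j x hx y hy
  rw [letters_tmul, add_zero]
  have h1 : i₁ (letter k V₁ x) ∈ deg k V i := by
    simpa using h₁ _ _ (letter_deg _ _ hx)
  have h2 : i₂ (letter k V₂ y) ∈ deg k V j := by
    simpa using h₂ _ _ (letter_deg _ _ hy)
  refine add_mem ?_ ?_
  · by_cases hj : j = 0
    · subst hj; rw [add_zero]; exact Submodule.smul_mem _ _ h1
    · rw [fun_zero counit_deg hj hy]; simp
  · by_cases hj : i = 0
    · subst hj; rw [zero_add]; exact Submodule.smul_mem _ _ h2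
    · rw [fun_zero counit_deg hj hx]; simp

theorem sgn_letters :
    sgn k V ∘ₗ letters i₁ i₂ = letters (sgn k V ∘ₗ i₁) (sgn k V ∘ₗ i₂) := by
  refine TensorProduct.ext' fun x y => ?_
  simp

theorem letters_tw (S : IsShuffle i₁ i₂ d₁ m₁ d₂ m₂ d m) (x : TensorAlgebra k V₁)
    (y : TensorAlgebra k V₂) : d (letters i₁ i₂ (x ⊗ₜ y)) + TensorProduct.lift m (TensorProduct.map
      (letters i₁ i₂) (letters i₁ i₂) (mid k _ _ _ _ (decon k V₁ x ⊗ₜ decon k V₂ y))) =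
    letters i₁ i₂ (coder d₁ m₁ x ⊗ₜ y + sgn k _ x ⊗ₜ coder d₂ m₂ y) := by
  rw [letters_Δ, S.comm, add_zero, map_add]
  simp only [letters_tmul, letter_coder, counit_coder, fun_sgn counit_deg, map_add, map_smul,
    S.map_d₁, S.map_d₂, zero_smul, add_zero, zero_add, smul_add]
  have e₁ : ∀ t, i₁ (TensorProduct.lift m₁ (TensorProduct.map (letter k V₁) (letter k V₁) t))
      = TensorProduct.lift m (TensorProduct.map (i₁ ∘ₗ letter k V₁)
        (i₁ ∘ₗ letter k V₁) t) := by
    intro t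
    induction t with
    | zero => simp
    | add s t hs ht => simp only [map_add, hs, ht]
    | tmul a b => simp [S.map_m₁]
  have e₂ : ∀ t, i₂ (TensorProduct.lift m₂ (TensorProduct.map (letter k V₂) (letter k V₂) t))
      = TensorProduct.lift m (TensorProduct.map (i₂ ∘ₗ letter k V₂)
        (i₂ ∘ₗ letter k V₂) t) := by
    intro t
    induction t with
    | zero => simp
    | add s t hs ht => simp only [map_add, hs, ht]
    | tmul a b => simp [S.map_m₂]
  rw [e₁, e₂]; abel

theorem shuffle_counit (x : TensorAlgebra k V₁) (y : TensorAlgebra k V₂) :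
    counit k V (shuffle i₁ i₂ (x ⊗ₜ y)) = counit k V₁ x * counit k V₂ y := by
  have h0 : ∀ s, counit k V (tfold i₁ i₂ (act k V) (shuffle i₁ i₂) s) = 0 := by
    intro s
    rw [tfold, LinearMap.comp_apply, LinearMap.comp_apply]
    generalize mid k _ _ _ _ s = t
    induction t with
    | zero => simp
    | add s t hs ht => simp only [map_add, hs, ht, add_zero]
    | tmul a b => simp
  rw [shuffle_rec, map_add, h0]; simp

variable (H₁ : IsBar d₁ m₁) (H₂ : IsBar d₂ m₂) (H : IsBar d m)

theorem letters_ind (j₁ : V₁ →ₗ[k] V) (j₂ : V₂ →ₗ[k] V) :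
    HasInd ((dgc H₁).tensor (dgc H₂)) (letters j₁ j₂) := by
  intro M _ _ a E h
  exact tfold_zero j₁ j₂ a E (fun x y => h (x ⊗ₜ[k] y : TensorAlgebra k V₁ ⊗[k] TensorAlgebra k V₂))

variable (i₁ i₂) in
/-- The shuffle map on the tensor product of coalgebras. -/
abbrev shuffleL : ((dgc H₁).tensor (dgc H₂)).carrier →ₗ[k] TensorAlgebra k V := shuffle i₁ i₂

variable (i₁ i₂) in
/-- Its component in words of length one. -/
abbrev lettersL : ((dgc H₁).tensor (dgc H₂)).carrier →ₗ[k] V := letters i₁ i₂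

theorem shuffle_isRec : IsRec _ (lettersL i₁ i₂ H₁ H₂) (shuffleL i₁ i₂ H₁ H₂) := by
  have h : shuffleL i₁ i₂ H₁ H₂ = (LinearMap.toSpanSingleton k _ 1) ∘ₗ ((dgc H₁).tensor (dgc H₂)).ε +
      fold (act k V) (lettersL i₁ i₂ H₁ H₂) (shuffleL i₁ i₂ H₁ H₂) :=
    tensor_ext (shuffle_rec i₁ i₂)
  exact LinearMap.congr_fun h

/-- The shuffle map as a map of coaugmented differential coalgebras. -/
def shuffleHom (S : IsShuffle i₁ i₂ d₁ m₁ d₂ m₂ d m) :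
    DGCHom ((dgc H₁).tensor (dgc H₂)) (dgc H) where
  toLin := shuffleL i₁ i₂ H₁ H₂
  map_deg := shuffle_deg S.deg₁ S.deg₂
  map_d := by
    have h : d ∘ₗ lettersL i₁ i₂ H₁ H₂ + TensorProduct.lift m ∘ₗ TensorProduct.map
        (lettersL i₁ i₂ H₁ H₂) (lettersL i₁ i₂ H₁ H₂) ∘ₗ ((dgc H₁).tensor (dgc H₂)).Δ =
        lettersL i₁ i₂ H₁ H₂ ∘ₗ ((dgc H₁).tensor (dgc H₂)).d := tensor_ext (letters_tw S)
    have hs : HasInd ((dgc H₁).tensor (dgc H₂)) (sgn k V ∘ₗ lettersL i₁ i₂ H₁ H₂) := by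
      have := letters_ind H₁ H₂ (sgn k V ∘ₗ i₁) (sgn k V ∘ₗ i₂)
      rw [← sgn_letters] at this
      exact this
    exact (shuffle_isRec H₁ H₂).d hs (letters_deg S.deg₁ S.deg₂) (LinearMap.congr_fun h)
  map_Δ := (shuffle_isRec H₁ H₂).Δ (letters_ind H₁ H₂ _ _)
  map_ε := by
    have h : counit k V ∘ₗ shuffleL i₁ i₂ H₁ H₂ = ((dgc H₁).tensor (dgc H₂)).ε :=
      tensor_ext shuffle_counit
    exact LinearMap.congr_fun h
  map_η c := by
    change shuffle i₁ i₂ (c • ((1 : k) • 1) ⊗ₜ ((1 : k) • 1)) = c • 1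
    simp [shuffle_one_one]
end TC

namespace DGA
section tm
variable {k : Type u} [CommRing k] (A : DGA.{u, v} k) (B : DGA.{u, w} k)

/-- The bilinear map `(a, b) ↦ a ⊗ b`. -/
def tm : A.carrier →ₗ[k] B.carrier →ₗ[k] (A.tensor B).carrier := gt k A.carrier B.carrier

theorem tm_mul (a a' : A.carrier) (b b' : B.carrier) : A.tm B a b * A.tm B a' b' =
    A.tm B (a * a') (b * b') - (2 : k) • A.tm B (a * odd k _ a') (odd k _ b * b') :=
  gt_mul a a' b b'
theorem tm_one : A.tm B 1 1 = 1 := rfl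
theorem tm_d (a : A.carrier) (b : B.carrier) : (A.tensor B).d (A.tm B a b) =
    A.tm B (A.d a) b + A.tm B (sgn k _ a) (B.d b) := rfl
theorem tm_ε (a : A.carrier) (b : B.carrier) : (A.tensor B).ε (A.tm B a b) = A.ε a * B.ε b := rfl
theorem tm_sgn (a : A.carrier) (b : B.carrier) : sgn k (A.tensor B).carrier (A.tm B a b) =
    A.tm B (sgn k _ a) (sgn k _ b) := sgn_gt a b
theorem tm_mem {i j n : ℤ} (h : i + j = n) {a : A.carrier} {b : B.carrier}
    (ha : a ∈ deg k _ i) (hb : b ∈ deg k _ j) : A.tm B a b ∈ deg k (A.tensor B).carrier n :=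
  gt_mem h ha hb
theorem tm_ext {M : Type*} [AddCommGroup M] [Module k M] {f g : (A.tensor B).carrier →ₗ[k] M}
    (h : ∀ a b, f (A.tm B a b) = g (A.tm B a b)) : f = g :=
  TensorProduct.ext' h
@[elab_as_elim]
theorem tm_induction {P : (A.tensor B).carrier → Prop} (t : (A.tensor B).carrier)
    (tm : ∀ a b, P (A.tm B a b)) (add : ∀ s t, P s → P t → P (s + t)) : P t :=
  gt_induction (k := k) (A := A.carrier) (B := B.carrier) t tm add
/-- A linear map on the tensor product is homogeneous if it is so on the tensors of homogeneous
elements. -/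
theorem tm_hasDeg {M : Type*} [AddCommGroup M] [Module k M] [GrMod k M]
    {f : (A.tensor B).carrier →ₗ[k] M} {n : ℤ}
    (h : ∀ i j, ∀ a ∈ deg k A.carrier i, ∀ b ∈ deg k B.carrier j,
      f (A.tm B a b) ∈ deg k M (i + j + n)) : HasDeg f n := by
  intro p t ht
  refine gt_deg_induction (k := k) (A := A.carrier) (B := B.carrier)
    (P := fun t => f t ∈ deg k M (p + n)) ht ?_ ?_ ?_
  · rintro i j rfl a ha b hb; exact h i j a ha b hb
  · intro x y hx hy; exact (map_add f x y).symm ▸ add_mem hx hy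
  · intro c x hx; exact (map_smul f c x).symm ▸ Submodule.smul_mem _ _ hx

/-- The linear map induced by a bilinear map. -/
def tlift {M : Type*} [AddCommGroup M] [Module k M]
    (f : A.carrier →ₗ[k] B.carrier →ₗ[k] M) : (A.tensor B).carrier →ₗ[k] M :=
  TensorProduct.lift f ∘ₗ (GradedTensorProduct.of k (deg k A.carrier) (deg k B.carrier)).symm.toLinearMap
@[simp] theorem tlift_tm {M : Type*} [AddCommGroup M] [Module k M]
    (f : A.carrier →ₗ[k] B.carrier →ₗ[k] M) (a : A.carrier) (b : B.carrier) :
    A.tlift B f (A.tm B a b) = f a b := rfl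

theorem unbr_odd (v : A.V) : A.unbr (odd k _ v) = A.unbr v - odd k _ (A.unbr v) := by
  rw [odd_odd' A.unbr_deg (by decide)]; abel

/-- `[a] ↦ [a ⊗ 1]` -/
def inl : A.V →ₗ[k] (A.tensor B).V := (A.tensor B).br ∘ₗ (A.tm B).flip 1 ∘ₗ A.unbr
/-- `[b] ↦ [1 ⊗ b]` -/
def inr : B.V →ₗ[k] (A.tensor B).V := (A.tensor B).br ∘ₗ A.tm B 1 ∘ₗ B.unbr

theorem inl_apply (v : A.V) : A.inl B v = (A.tensor B).br (A.tm B (A.unbr v) 1) := rfl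
theorem inr_apply (v : B.V) : A.inr B v = (A.tensor B).br (A.tm B 1 (B.unbr v)) := rfl

theorem unbr_inl (v : A.V) : (A.tensor B).unbr (A.inl B v) = A.tm B (A.unbr v) 1 := by
  simp [inl_apply, tm_ε]
theorem unbr_inr (v : B.V) : (A.tensor B).unbr (A.inr B v) = A.tm B 1 (B.unbr v) := by
  simp [inr_apply, tm_ε]

theorem isShuffle : TC.IsShuffle (A.inl B) (A.inr B) A.barD A.barM B.barD B.barM
    (A.tensor B).barD (A.tensor B).barM where
  deg₁ n v hv := by
    have := (A.tensor B).br_deg _ _ (A.tm_mem B rfl (A.unbr_deg n v hv) (one_mem_deg (k := k)))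
    rw [inl_apply]; simpa using this
  deg₂ n v hv := by
    have := (A.tensor B).br_deg _ _ (A.tm_mem B rfl (one_mem_deg (k := k)) (B.unbr_deg n v hv))
    rw [inr_apply]; simpa using this
  map_d₁ v := by
    rw [barD_apply, barD_apply, unbr_inl, map_neg, inl_apply]
    simp [tm_d, B.d_one, A.ε_d]
  map_d₂ v := by
    rw [barD_apply, barD_apply, unbr_inr, map_neg, inr_apply]
    simp [tm_d, A.d_one, B.ε_d, sgn_one]
  map_m₁ v w := by
    rw [barM_apply, barM_apply, unbr_sgn, unbr_sgn, unbr_inl, unbr_inl, inl_apply]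
    simp [tm_mul, GrMod.odd_one, tm_sgn, sgn_one, A.ε_sgn]
  map_m₂ v w := by
    rw [barM_apply, barM_apply, unbr_sgn, unbr_sgn, unbr_inr, unbr_inr, inr_apply]
    simp [tm_mul, GrMod.odd_one, tm_sgn, sgn_one, B.ε_sgn]
  comm v w := by
    simp only [barM_apply, unbr_sgn, unbr_inr, unbr_inl, tm_sgn, unbr_odd, sgn_one]
    simp only [neg_mul, map_sub, LinearMap.sub_apply, mul_sub, sub_mul, tm_mul, mul_one, one_mul,
      GrMod.odd_one, map_zero, mul_zero, zero_mul, smul_zero, sub_zero]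
    simp only [map_neg, map_sub, sgn, odd_odd, LinearMap.sub_apply,
      LinearMap.smul_apply, LinearMap.id_apply, map_smul, smul_sub]
    module

/-- The shuffle map `∇ : BA ⊗ BB → B(A ⊗ B)`, which sends `[a₁|⋯|aₚ] ⊗ [b₁|⋯|b_q]` to the sum of
all `(p, q)`-shuffles, with Koszul signs, of `[a₁ ⊗ 1|⋯|aₚ ⊗ 1|1 ⊗ b₁|⋯|1 ⊗ b_q]`. -/
def nabla : DGCHom (A.bar.tensor B.bar) (A.tensor B).bar :=
  TC.shuffleHom A.isBar B.isBar (A.tensor B).isBar (A.isShuffle B)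
end tm
end DGA

/-! ### The cobar construction -/
namespace DGC
section cup
variable {k : Type u} [CommRing k] (C : DGC.{u, v} k) {X : Type w} [Ring X] [Algebra k X]

variable {C} in
/-- `c ↦ ∑ f(c₁) g(c₂)`. -/
def conv (f g : C.carrier →ₗ[k] X) : C.carrier →ₗ[k] X :=
  LinearMap.mul' k X ∘ₗ TensorProduct.map f g ∘ₗ C.Δ

variable {C}
variable (f f' g g' h : C.carrier →ₗ[k] X)

theorem conv_congr (c : C.carrier) (F : C.carrier ⊗[k] C.carrier →ₗ[k] X)
    (h : ∀ a b, F (a ⊗ₜ b) = f a * g b) : F (C.Δ c) = conv f g c := by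
  have : F = LinearMap.mul' k X ∘ₗ TensorProduct.map f g := TensorProduct.ext' (by simpa using h)
  rw [this]; rfl

theorem conv_add_left : conv (f + f') g = conv f g + conv f' g := by
  simp [conv, TensorProduct.map_add_left, LinearMap.add_comp, LinearMap.comp_add]
theorem conv_add_right : conv f (g + g') = conv f g + conv f g' := by
  simp [conv, TensorProduct.map_add_right, LinearMap.add_comp, LinearMap.comp_add]
theorem conv_smul_left (c : k) : conv (c • f) g = c • conv f g := by
  simp [conv, TensorProduct.map_smul_left, LinearMap.smul_comp, LinearMap.comp_smul]
theorem conv_smul_right (c : k) : conv f (c • g) = c • conv f g := by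
  simp [conv, TensorProduct.map_smul_right, LinearMap.smul_comp, LinearMap.comp_smul]
theorem conv_neg_left : conv (-f) g = - conv f g := by
  refine eq_neg_of_add_eq_zero_left ?_
  rw [← conv_add_left, neg_add_cancel]; simp [conv]
theorem conv_neg_right : conv f (-g) = - conv f g := by
  refine eq_neg_of_add_eq_zero_left ?_
  rw [← conv_add_right, neg_add_cancel]; simp [conv]
theorem conv_sub_left : conv (f - f') g = conv f g - conv f' g := by
  rw [sub_eq_add_neg, conv_add_left, conv_neg_left, sub_eq_add_neg]
theorem conv_sub_right : conv f (g - g') = conv f g - conv f g' := by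
  rw [sub_eq_add_neg, conv_add_right, conv_neg_right, sub_eq_add_neg]

theorem conv_assoc : conv (conv f g) h = conv f (conv g h) := by
  ext c
  let G : C.carrier ⊗[k] (C.carrier ⊗[k] C.carrier) →ₗ[k] X := LinearMap.mul' k X ∘ₗ
    TensorProduct.map f (LinearMap.mul' k X ∘ₗ TensorProduct.map g h)
  have e1 : ∀ s, (LinearMap.mul' k X ∘ₗ TensorProduct.map (conv f g) h) s =
      G (TensorProduct.assoc k _ _ _ (TensorProduct.map C.Δ LinearMap.id s)) := by
    intro s
    induction s with
    | zero => simp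
    | add s t hs ht => simp only [map_add, hs, ht]
    | tmul a b =>
      simp only [conv, LinearMap.comp_apply, TensorProduct.map_tmul, LinearMap.id_apply]
      generalize C.Δ a = t
      induction t with
      | zero => simp
      | add s t hs ht => simp only [map_add, TensorProduct.add_tmul, hs, ht]
      | tmul p q => simp [G, mul_assoc]
  have e2 : ∀ s, (LinearMap.mul' k X ∘ₗ TensorProduct.map f (conv g h)) s =
      G (TensorProduct.map LinearMap.id C.Δ s) := by
    intro s
    induction s with
    | zero => simp
    | add s t hs ht => simp only [map_add, hs, ht]
    | tmul a b => simp [conv, G]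
  exact (e1 _).trans ((congrArg G (C.coassoc c)).trans (e2 _).symm)

theorem conv_sgn : conv f g ∘ₗ sgn k _ = conv (f ∘ₗ sgn k _) (g ∘ₗ sgn k _) := by
  ext c
  simp only [conv, LinearMap.comp_apply, Δ_sgn]
  rw [TensorProduct.map_comp, LinearMap.comp_apply]

theorem conv_d : conv f g ∘ₗ C.d = conv (f ∘ₗ C.d) g + conv (f ∘ₗ sgn k _) (g ∘ₗ C.d) := by
  ext c
  simp only [conv, LinearMap.comp_apply, Δ_d, map_add, LinearMap.add_apply]
  congr 1
  · generalize C.Δ c = t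
    induction t with
    | zero => simp
    | add s t hs ht => simp only [map_add, hs, ht]
    | tmul p q => simp
  · generalize C.Δ c = t
    induction t with
    | zero => simp
    | add s t hs ht => simp only [map_add, hs, ht]
    | tmul p q => simp

theorem map_conv {Y : Type*} [Ring Y] [Algebra k Y] (φ : X →ₐ[k] Y) :
    φ.toLinearMap ∘ₗ conv f g = conv (φ.toLinearMap ∘ₗ f) (φ.toLinearMap ∘ₗ g) := by
  ext c
  exact conv_congr (φ.toLinearMap ∘ₗ f) (φ.toLinearMap ∘ₗ g) c
    (φ.toLinearMap ∘ₗ LinearMap.mul' k X ∘ₗ TensorProduct.map f g) (by simp)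

theorem conv_deg [GrMod k X] [SetLike.GradedMonoid (deg k X)] {m n p : ℤ} (hf : HasDeg f m)
    (hg : HasDeg g n) (hp : m + n = p) : HasDeg (conv f g) p := by
  have h1 : HasDeg (LinearMap.mul' k X ∘ₗ TensorProduct.map f g) p := by
    refine hasDeg_tensor ?_
    intro i j x hx y hy
    exact mul_mem_deg (by omega) (hf _ _ hx) (hg _ _ hy)
  exact h1.comp C.Δ_deg (zero_add p)

variable [GrMod k X]
theorem deriv_conv {d : X →ₗ[k] X} (hd : ∀ x y, d (x * y) = d x * y + sgn k X x * d y) :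
    d ∘ₗ conv f g = conv (d ∘ₗ f) g + conv (sgn k X ∘ₗ f) (d ∘ₗ g) := by
  ext c
  simp only [conv, LinearMap.comp_apply, LinearMap.add_apply]
  generalize C.Δ c = t
  induction t with
  | zero => simp
  | add s t hs ht => simp only [map_add, hs, ht]; abel
  | tmul p q => simp [hd]
end cup

section cobar
variable {k : Type u} [CommRing k] (C : DGC.{u, v} k)

theorem η_mem : C.η 1 ∈ deg k C.carrier 0 := by simpa using C.η_deg _ _ (mem_ground 1)

instance : GrMod k (C.carrier ⧸ LinearMap.range C.η) := quotGr C.η C.η_mem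

/-- The suspension `sC̄` of the coaugmentation coideal `C̄ = coker η`, `(sC̄)_n = C̄_{n-1}`. -/
abbrev W : Type v := Shift (-1) (C.carrier ⧸ LinearMap.range C.η)

/-- `c ↦ s c̄` -/
def sus : C.carrier →ₗ[k] C.W := (Shift.mk k (-1)).toLinearMap ∘ₗ (LinearMap.range C.η).mkQ

theorem sus_deg : HasDeg C.sus 1 := by
  intro n x hx
  have : (LinearMap.range C.η).mkQ x ∈ deg k (C.carrier ⧸ LinearMap.range C.η) n := ⟨x, hx, rfl⟩
  have h := Shift.hasDeg_mk (k := k) (-1) n _ this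
  rwa [neg_neg] at h

theorem sus_η (c : k) : C.sus (C.η c) = 0 := by
  have : (LinearMap.range C.η).mkQ (C.η c) = 0 := by simp
  simp [sus, this]

theorem sus_surj : Function.Surjective C.sus := by
  intro w
  obtain ⟨c, hc⟩ := Submodule.mkQ_surjective _ ((Shift.mk k (-1)).symm w)
  exact ⟨c, by rw [sus, LinearMap.comp_apply, hc]; simp⟩

theorem sus_mem {n : ℤ} {w : C.W} (hw : w ∈ deg k C.W n) :
    ∃ c ∈ deg k C.carrier (n - 1), C.sus c = w := by
  obtain ⟨y, ⟨c, hc, rfl⟩, rfl⟩ := hw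
  exact ⟨c, hc, rfl⟩

/-- The map on `sC̄` induced by a map on `C` that vanishes on the coaugmentation. -/
def desc {M : Type*} [AddCommGroup M] [Module k M] (f : C.carrier →ₗ[k] M) (hf : f (C.η 1) = 0) :
    C.W →ₗ[k] M :=
  (LinearMap.range C.η).liftQ f (by
    rintro _ ⟨c, rfl⟩
    have : C.η c = c • C.η 1 := by rw [← map_smul]; simp
    simp [this, hf]) ∘ₗ (Shift.mk k (-1)).symm.toLinearMap

@[simp] theorem desc_sus {M : Type*} [AddCommGroup M] [Module k M] (f : C.carrier →ₗ[k] M)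
    (hf : f (C.η 1) = 0) (c : C.carrier) : C.desc f hf (C.sus c) = f c := rfl

theorem desc_deg {M : Type*} [AddCommGroup M] [Module k M] [GrMod k M] {f : C.carrier →ₗ[k] M}
    {hf : f (C.η 1) = 0} {n : ℤ} (h : HasDeg f (n + 1)) : HasDeg (C.desc f hf) n := by
  intro m w hw
  obtain ⟨c, hc, rfl⟩ := C.sus_mem hw
  rw [desc_sus]
  have := h _ _ hc
  rwa [show m - 1 + (n + 1) = m + n by ring] at this

/-- `c ↦ ⟨c⟩`, the tautological twisting cochain. -/
def cell : C.carrier →ₗ[k] TensorAlgebra k C.W := TensorAlgebra.ι k ∘ₗ C.sus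

theorem cell_deg : HasDeg C.cell 1 := hasDeg_ι.comp C.sus_deg (add_zero 1)
theorem cell_η (c : k) : C.cell (C.η c) = 0 := by simp [cell, sus_η]
theorem sgn_cell : sgn k _ ∘ₗ C.cell = - (C.cell ∘ₗ sgn k _) := by
  ext c; exact sgn_odd C.cell_deg (by decide) c

@[elab_as_elim]
theorem cell_induction {P : TensorAlgebra k C.W → Prop} (x : TensorAlgebra k C.W)
    (one : P 1) (smul : ∀ (c : k) x, P x → P (c • x)) (add : ∀ x y, P x → P y → P (x + y))
    (cons : ∀ c x, P x → P (C.cell c * x)) : P x := by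
  refine word_induction x one smul add ?_
  intro v x hx
  obtain ⟨c, rfl⟩ := C.sus_surj v
  exact cons c x hx

theorem η_sgn : sgn k _ (C.η 1) = C.η 1 := sgn_fix C.η_mem

/-- The differential on generators, `⟨c⟩ ↦ - ⟨dc⟩ + ∑ (-1)^{|c₁|} ⟨c₁⟩⟨c₂⟩`. -/
def cobarGen : C.carrier →ₗ[k] TensorAlgebra k C.W :=
  - (C.cell ∘ₗ C.d) + conv (C.cell ∘ₗ sgn k _) C.cell

theorem cobarGen_η : C.cobarGen (C.η 1) = 0 := by
  simp [cobarGen, conv, C.Δ_η, C.d_η, cell_η]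

theorem cobarGen_deg : HasDeg C.cobarGen 2 :=
  (C.cell_deg.comp C.d_deg rfl).neg.add (conv_deg _ _ (C.cell_deg.comp HasDeg.sgn rfl) C.cell_deg rfl)

/-- The derivation extending `cobarGen`:
`D(v x) = D(v) x + (-1)^{|v|} v D(x)`. -/
def cobarD : TensorAlgebra k C.W →ₗ[k] TensorAlgebra k C.W :=
  wordRec 0 (LinearMap.mul k _ ∘ₗ C.desc C.cobarGen C.cobarGen_η)
    (LinearMap.mul k _ ∘ₗ TensorAlgebra.ι k ∘ₗ sgn k _)

theorem cobarD_one : C.cobarD 1 = 0 := by simp [cobarD]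
theorem cobarD_cons (c : C.carrier) (x : TensorAlgebra k C.W) : C.cobarD (C.cell c * x) =
    C.cobarGen c * x + sgn k _ (C.cell c) * C.cobarD x := by
  simp [cobarD, cell, sgn_ι]
theorem cobarD_cell (c : C.carrier) : C.cobarD (C.cell c) = C.cobarGen c := by
  have := C.cobarD_cons c 1
  simpa [cobarD_one] using this

theorem cobarD_mul (x y : TensorAlgebra k C.W) : C.cobarD (x * y) =
    C.cobarD x * y + sgn k _ x * C.cobarD y := by
  refine C.cell_induction x ?_ (fun c x h => ?_) (fun x y hx hy => ?_) ?_
  · simp [cobarD_one, sgn_one]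
  · simp [h]
  · simp only [add_mul, map_add, hx, hy]; abel
  · intro c x h
    simp only [mul_assoc, cobarD_cons, h, sgn_mul, mul_add, add_mul]; abel

theorem cobarD_deg : HasDeg C.cobarD 1 := by
  refine word_hasDeg (by simp [cobarD_one]) ?_
  intro i j v hv x hx h
  obtain ⟨c, hc, rfl⟩ := C.sus_mem hv
  change C.cobarD (C.cell c * x) ∈ _
  rw [cobarD_cons]
  refine add_mem ?_ ?_
  · exact mul_mem_deg (by omega) (C.cobarGen_deg _ _ hc) hx
  · exact mul_mem_deg (by omega) (HasDeg.sgn _ _ (C.cell_deg _ _ hc)) h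

theorem d_sgn : C.d ∘ₗ sgn k _ = - (sgn k _ ∘ₗ C.d) := by
  ext c; simp [sgn_d]
theorem sgn_comp_sgn {V : Type*} [AddCommGroup V] [Module k V] [GrMod k V] :
    sgn k V ∘ₗ sgn k V = LinearMap.id := by
  ext c; simp [sgn_sgn]

theorem cobarD_cobarGen : C.cobarD ∘ₗ C.cobarGen = 0 := by
  have e : C.cobarD ∘ₗ C.cell = C.cobarGen := by ext c; exact C.cobarD_cell c
  have e1 : sgn k _ ∘ₗ C.cell ∘ₗ sgn k _ = - C.cell := by
    rw [← LinearMap.comp_assoc, sgn_cell, LinearMap.neg_comp, LinearMap.comp_assoc, sgn_comp_sgn,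
      LinearMap.comp_id]
  have e2 : C.cell ∘ₗ C.d ∘ₗ C.d = 0 := by ext c; simp [C.d_d]
  have e3 : C.cell ∘ₗ sgn k _ ∘ₗ C.d = - (C.cell ∘ₗ C.d ∘ₗ sgn k _) := by
    rw [d_sgn]; simp
  have e4 : (C.cell ∘ₗ sgn k C.carrier) ∘ₗ sgn k C.carrier = C.cell := by
    rw [LinearMap.comp_assoc, sgn_comp_sgn, LinearMap.comp_id]
  conv_lhs => rw [cobarGen]
  rw [LinearMap.comp_add, LinearMap.comp_neg, ← LinearMap.comp_assoc, e,
    deriv_conv _ _ C.cobarD_mul, e1, e, ← LinearMap.comp_assoc, e, cobarGen, LinearMap.add_comp,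
    LinearMap.add_comp, conv_d, conv_sgn, e4, conv_neg_left, conv_add_left, conv_add_right,
    conv_assoc, LinearMap.neg_comp, LinearMap.neg_comp, LinearMap.comp_assoc, e2,
    LinearMap.comp_assoc, e3, conv_neg_left, conv_neg_left, conv_neg_right, LinearMap.comp_assoc]
  abel

theorem cobarD_cobarD (x : TensorAlgebra k C.W) : C.cobarD (C.cobarD x) = 0 := by
  refine C.cell_induction x ?_ (fun c x h => ?_) (fun x y hx hy => ?_) ?_
  · simp [cobarD_one]
  · simp [h]
  · simp [hx, hy]
  · intro c x h
    have h1 : C.cobarD (C.cobarGen c) = 0 := LinearMap.congr_fun C.cobarD_cobarGen c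
    have h2 : C.cobarD (sgn k _ (C.cell c)) = - sgn k _ (C.cobarGen c) := by
      rw [← cobarD_cell, sgn_odd C.cobarD_deg (by decide), neg_neg]
    rw [cobarD_cons, map_add, cobarD_mul, cobarD_mul, h, h1, h2]
    simp

theorem counit_mul (x y : TensorAlgebra k C.W) : TC.counit k C.W (x * y) =
    TC.counit k C.W x * TC.counit k C.W y := by simp [TC.counit]
theorem counit_cell (c : C.carrier) : TC.counit k C.W (C.cell c) = 0 := by
  simp [TC.counit, cell, TensorAlgebra.algebraMapInv]

theorem counit_conv (f g : C.carrier →ₗ[k] TensorAlgebra k C.W)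
    (hf : ∀ c, TC.counit k C.W (f c) = 0) (c : C.carrier) :
    TC.counit k C.W (conv f g c) = 0 := by
  simp only [conv, LinearMap.comp_apply]
  generalize C.Δ c = t
  induction t with
  | zero => simp
  | add s t hs ht => simp only [map_add, hs, ht, add_zero]
  | tmul p q => simp [counit_mul, hf]

theorem counit_cobarD (x : TensorAlgebra k C.W) : TC.counit k C.W (C.cobarD x) = 0 := by
  refine C.cell_induction x ?_ (fun c x h => ?_) (fun x y hx hy => ?_) ?_
  · simp [cobarD_one]
  · simp [h]
  · simp [hx, hy]
  · intro c x h
    rw [cobarD_cons, map_add, counit_mul, counit_mul, h, mul_zero, add_zero, cobarGen,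
      LinearMap.add_apply, map_add, counit_conv _ (C.cell ∘ₗ sgn k _) C.cell (fun c => C.counit_cell _)]
    simp [counit_cell]

/-- The cobar construction: the tensor algebra on `sC̄`, with the derivation determined by
`⟨c⟩ ↦ - ⟨dc⟩ + ∑ (-1)^{|c₁|} ⟨c₁⟩⟨c₂⟩`. -/
def cobar : DGA k where
  carrier := TensorAlgebra k C.W
  d := C.cobarD
  d_deg := C.cobarD_deg
  d_d := C.cobarD_cobarD
  d_mul := C.cobarD_mul
  ε := TensorAlgebra.algebraMapInv
  ε_deg := TC.counit_deg
  ε_d := C.counit_cobarD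

/-- Twisting cochains: maps of degree `1` with `ε t = 0 = t η` and `d t + t d = t ∪ t`, where
`(t ∪ t)(c) = ∑ (-1)^{|c₁|} t(c₁) t(c₂)`. -/
structure IsTwisting (X : DGA.{u, w} k) (t : C.carrier →ₗ[k] X.carrier) : Prop where
  deg : HasDeg t 1
  η : t (C.η 1) = 0
  ε : ∀ c, X.ε (t c) = 0
  tw : ∀ c, X.d (t c) + t (C.d c) = conv (t ∘ₗ sgn k _) t c

variable {C} in
/-- The DGA map `ΩC → X` induced by a twisting cochain `t`, with `⟨c⟩ ↦ t(c)`. -/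
def IsTwisting.hom {X : DGA.{u, w} k} {t : C.carrier →ₗ[k] X.carrier} (ht : C.IsTwisting X t) :
    DGAHom C.cobar X where
  toAlgHom := TensorAlgebra.lift k (C.desc t ht.η)
  map_deg := hasDeg_lift (C.desc_deg (by simpa using ht.deg))
  map_d x := by
    have hc : ∀ c, TensorAlgebra.lift k (C.desc t ht.η) (C.cell c) = t c := by simp [cell]
    have hcl : (TensorAlgebra.lift k (C.desc t ht.η)).toLinearMap ∘ₗ C.cell = t := by ext c; exact hc c
    have hs : ∀ x, TensorAlgebra.lift k (C.desc t ht.η) (sgn k _ x) =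
        sgn k _ (TensorAlgebra.lift k (C.desc t ht.η) x) := fun x =>
      (sgn_even (hasDeg_lift (C.desc_deg (hf := ht.η) (by simpa using ht.deg))) (by simp) x).symm
    change TensorAlgebra.lift k (C.desc t ht.η) (C.cobarD x) =
      X.d (TensorAlgebra.lift k (C.desc t ht.η) x)
    refine C.cell_induction x ?_ (fun c x h => ?_) (fun x y hx hy => ?_) ?_
    · simp [cobarD_one, X.d_one]
    · simp [h]
    · simp [hx, hy]
    · intro c x h
      have hg : TensorAlgebra.lift k (C.desc t ht.η) (C.cobarGen c) = X.d (t c) := by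
        have := LinearMap.congr_fun (map_conv (C.cell ∘ₗ sgn k _) C.cell
          (TensorAlgebra.lift k (C.desc t ht.η))) c
        rw [← LinearMap.comp_assoc, hcl, ← ht.tw c] at this
        rw [cobarGen, LinearMap.add_apply, map_add]
        simp only [LinearMap.comp_apply, AlgHom.toLinearMap_apply] at this
        rw [this]
        simp [hc]
      rw [cobarD_cons, map_add, map_mul, map_mul, map_mul, X.d_mul, hg, hs, hc, h]
  map_ε x := by
    change X.ε (TensorAlgebra.lift k (C.desc t ht.η) x) = TC.counit k C.W x
    refine C.cell_induction x ?_ (fun c x h => ?_) (fun x y hx hy => ?_) ?_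
    · simp [TC.counit]
    · simp [h]
    · simp [hx, hy]
    · intro c x h
      simp [cell, ht.ε]

/-- The tautological twisting cochain `C → ΩC`, `c ↦ ⟨c⟩`. -/
def taut : C.carrier →ₗ[k] C.cobar.carrier := C.cell

theorem taut_isTwisting : C.IsTwisting C.cobar C.taut where
  deg := C.cell_deg
  η := C.cell_η 1
  ε := C.counit_cell
  tw c := by
    change C.cobarD (C.cell c) + C.cell (C.d c) = conv (C.cell ∘ₗ sgn k _) C.cell c
    rw [cobarD_cell, cobarGen, LinearMap.add_apply, LinearMap.neg_apply, LinearMap.comp_apply]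
    abel

theorem taut_η (c : k) : C.taut (C.η c) = 0 := C.cell_η c

@[simp] theorem IsTwisting.hom_taut {X : DGA.{u, w} k} {t : C.carrier →ₗ[k] X.carrier}
    (ht : C.IsTwisting X t) (c : C.carrier) : ht.hom.toAlgHom (C.taut c) = t c := by
  change TensorAlgebra.lift k (C.desc t ht.η) (TensorAlgebra.ι k (C.sus c)) = t c
  simp
end cobar
end DGC

/-- The functor `Ω` on maps: `ΩF` is the DGA map with `⟨c⟩ ↦ ⟨F(c)⟩`. -/
def DGCHom.cobarMap {k : Type u} [CommRing k] {C : DGC.{u, v} k} {D : DGC.{u, w} k}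
    (F : DGCHom C D) : DGAHom C.cobar D.cobar :=
  DGC.IsTwisting.hom (t := D.taut ∘ₗ F.toLin)
    { deg := D.taut_isTwisting.deg.comp F.map_deg (zero_add 1)
      η := by simp [F.map_η, D.taut_η]
      ε := fun c => D.taut_isTwisting.ε _
      tw := by
        intro c
        have h := D.taut_isTwisting.tw (F.toLin c)
        simp only [LinearMap.comp_apply, F.map_d]
        refine h.trans ?_
        simp only [DGC.conv, LinearMap.comp_apply, F.map_Δ]
        generalize C.Δ c = t
        induction t with
        | zero => simp
        | add s t hs ht => simp only [map_add, hs, ht]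
        | tmul p q => simp [sgn_even F.map_deg] }

/-! ### The map `γ` -/
namespace DGC
section gamma
variable {k : Type u} [CommRing k] (C : DGC.{u, v} k) (D : DGC.{u, w} k)

theorem counit_lift {M : Type*} [AddCommGroup M] [Module k M] (f : C.carrier →ₗ[k] M)
    (x : C.carrier) :
    TensorProduct.lift ((LinearMap.lsmul k M ∘ₗ C.ε).compl₂ f) (C.Δ x) = f x := by
  conv_rhs => rw [← C.counit_left x]
  generalize C.Δ x = t
  induction t with
  | zero => simp
  | add s t hs ht => simp only [map_add, hs, ht]
  | tmul a b => simp

theorem counit_lift_right {M : Type*} [AddCommGroup M] [Module k M] (f : C.carrier →ₗ[k] M)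
    (x : C.carrier) :
    TensorProduct.lift ((LinearMap.lsmul k M ∘ₗ C.ε).compl₂ f).flip (C.Δ x) = f x := by
  conv_rhs => rw [← C.counit_right x]
  generalize C.Δ x = t
  induction t with
  | zero => simp
  | add s t hs ht => simp only [map_add, hs, ht]
  | tmul a b => simp

theorem taut_sgn (x : C.carrier) : C.taut (sgn k _ x) = - sgn k _ (C.taut x) := by
  rw [sgn_odd C.taut_isTwisting.deg (by decide), neg_neg]
theorem taut_odd (x : C.carrier) : C.taut (odd k _ x) = C.taut x - odd k _ (C.taut x) := by
  rw [odd_odd' C.taut_isTwisting.deg (by decide)]; abel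

/-- The bilinear map `(c, c') ↦ c ⊗ c'`. -/
def tp : C.carrier →ₗ[k] D.carrier →ₗ[k] (C.tensor D).carrier := TensorProduct.mk k _ _

theorem tp_ext {M : Type*} [AddCommGroup M] [Module k M] {f g : (C.tensor D).carrier →ₗ[k] M}
    (h : ∀ x y, f (C.tp D x y) = g (C.tp D x y)) : f = g := TensorProduct.ext' h
theorem tp_d (x : C.carrier) (y : D.carrier) : (C.tensor D).d (C.tp D x y) =
    C.tp D (C.d x) y + C.tp D (sgn k _ x) (D.d y) := rfl
theorem tp_η : (C.tensor D).η 1 = C.tp D (C.η 1) (D.η 1) := one_smul k (C.η 1 ⊗ₜ[k] D.η 1)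
theorem tp_hasDeg {M : Type*} [AddCommGroup M] [Module k M] [GrMod k M]
    {f : (C.tensor D).carrier →ₗ[k] M} {n : ℤ}
    (h : ∀ i j, ∀ x ∈ deg k C.carrier i, ∀ y ∈ deg k D.carrier j,
      f (C.tp D x y) ∈ deg k M (i + j + n)) : HasDeg f n :=
  hasDeg_tensor (k := k) h

/-- `c ↦ ⟨c⟩ ⊗ 1` -/
def tautl : C.carrier →ₗ[k] (C.cobar.tensor D.cobar).carrier :=
  (C.cobar.tm D.cobar).flip 1 ∘ₗ C.taut
/-- `c' ↦ 1 ⊗ ⟨c'⟩` -/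
def tautr : D.carrier →ₗ[k] (C.cobar.tensor D.cobar).carrier :=
  C.cobar.tm D.cobar 1 ∘ₗ D.taut

theorem tautl_apply (x : C.carrier) : C.tautl D x = C.cobar.tm D.cobar (C.taut x) 1 := rfl
theorem tautr_apply (y : D.carrier) : C.tautr D y = C.cobar.tm D.cobar 1 (D.taut y) := rfl

/-- The twisting cochain `t_C ⊗ ηε + ηε ⊗ t_D : C ⊗ D → ΩC ⊗ ΩD`,
`c ⊗ c' ↦ ε(c') ⟨c⟩ ⊗ 1 + ε(c) 1 ⊗ ⟨c'⟩`. -/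
def gammaT : (C.tensor D).carrier →ₗ[k] (C.cobar.tensor D.cobar).carrier :=
  TensorProduct.lift (((LinearMap.lsmul k _ ∘ₗ D.ε).compl₂ (C.tautl D)).flip +
    (LinearMap.lsmul k _ ∘ₗ C.ε).compl₂ (C.tautr D))

theorem gammaT_tmul (x : C.carrier) (y : D.carrier) :
    C.gammaT D (C.tp D x y) =
      D.ε y • C.tautl D x + C.ε x • C.tautr D y := rfl

theorem tautl_tautr (x : C.carrier) (y : D.carrier) :
    C.tautl D (sgn k _ x) * C.tautr D y + C.tautr D (sgn k _ y) * C.tautl D x -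
      (2 : k) • (C.tautr D (sgn k _ (odd k _ y)) * C.tautl D (odd k _ x)) = 0 := by
  simp only [tautl_apply, tautr_apply, taut_sgn, taut_odd]
  simp only [neg_mul, map_neg, map_sub, LinearMap.sub_apply, LinearMap.neg_apply, mul_sub, sub_mul,
    DGA.tm_mul, mul_one, one_mul, GrMod.odd_one, map_zero, mul_zero, zero_mul,
    smul_zero, sub_zero]
  simp only [sgn, odd_odd, LinearMap.sub_apply, map_sub,
      LinearMap.smul_apply, LinearMap.id_apply, map_smul, smul_sub]
  module

theorem gammaT_conv (x : C.carrier) (y : D.carrier) :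
    conv (C.gammaT D ∘ₗ sgn k _) (C.gammaT D) (C.tp D x y) =
      D.ε y • conv (C.tautl D ∘ₗ sgn k _) (C.tautl D) x +
      C.ε x • conv (C.tautr D ∘ₗ sgn k _) (C.tautr D) y := by
  let T : C.carrier ⊗[k] D.carrier →ₗ[k] (C.cobar.tensor D.cobar).carrier := C.gammaT D
  have hT : ∀ a b, T (a ⊗ₜ b) = D.ε b • C.tautl D a + C.ε a • C.tautr D b := C.gammaT_tmul D
  have key : ∀ s t, LinearMap.mul' k _ (TensorProduct.map (T ∘ₗ sgn k _) T (mid k _ _ _ _ (s ⊗ₜ t))) =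
      TensorProduct.lift ((LinearMap.lsmul k k ∘ₗ D.ε).compl₂ D.ε) t •
        LinearMap.mul' k _ (TensorProduct.map (C.tautl D ∘ₗ sgn k _) (C.tautl D) s) +
      (C.tautl D (sgn k _
          (TensorProduct.lift ((LinearMap.lsmul k _ ∘ₗ C.ε).compl₂ LinearMap.id).flip s)) *
        C.tautr D (TensorProduct.lift ((LinearMap.lsmul k _ ∘ₗ D.ε).compl₂ LinearMap.id) t) +
      C.tautr D (sgn k _
          (TensorProduct.lift ((LinearMap.lsmul k _ ∘ₗ D.ε).compl₂ LinearMap.id).flip t)) *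
        C.tautl D (TensorProduct.lift ((LinearMap.lsmul k _ ∘ₗ C.ε).compl₂ LinearMap.id) s) -
      (2 : k) • (C.tautr D (sgn k _ (odd k _
          (TensorProduct.lift ((LinearMap.lsmul k _ ∘ₗ D.ε).compl₂ LinearMap.id).flip t))) *
        C.tautl D (odd k _
          (TensorProduct.lift ((LinearMap.lsmul k _ ∘ₗ C.ε).compl₂ LinearMap.id) s)))) +
      TensorProduct.lift ((LinearMap.lsmul k k ∘ₗ C.ε).compl₂ C.ε) s •
        LinearMap.mul' k _ (TensorProduct.map (C.tautr D ∘ₗ sgn k _) (C.tautr D) t) := by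
    intro s t
    induction s with
    | zero => simp
    | add s s' hs hs' =>
      simp only [map_add, TensorProduct.add_tmul, hs, hs', add_mul, mul_add]; module
    | tmul p q =>
    induction t with
    | zero => simp
    | add s s' hs hs' =>
      simp only [map_add, TensorProduct.tmul_add, hs, hs', add_mul, mul_add]; module
    | tmul p' q' =>
      simp only [mid_tmul, hT, fun_odd D.ε_deg, fun_odd C.ε_deg, fun_sgn D.ε_deg, fun_sgn C.ε_deg,
        add_mul, mul_add, map_sub, map_smul, TensorProduct.map_tmul, LinearMap.mul'_apply,
        LinearMap.comp_apply, sgn_tmul, TensorProduct.lift.tmul, LinearMap.compl₂_apply,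
        LinearMap.flip_apply, LinearMap.lsmul_apply, LinearMap.id_apply, smul_mul_assoc,
        mul_smul_comm, zero_smul, add_zero, zero_add, smul_eq_mul]
      module
  refine (key (C.Δ x) (D.Δ y)).trans ?_
  rw [counit_lift, counit_lift, counit_lift, counit_lift, counit_lift_right, counit_lift_right]
  simp only [LinearMap.id_apply]
  rw [tautl_tautr, add_zero]
  rfl

theorem tautl_tw (x : C.carrier) : (C.cobar.tensor D.cobar).d (C.tautl D x) + C.tautl D (C.d x) =
    conv (C.tautl D ∘ₗ sgn k _) (C.tautl D) x := by
  have h := C.taut_isTwisting.tw x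
  have e : conv (C.tautl D ∘ₗ sgn k _) (C.tautl D) x =
      (C.cobar.tm D.cobar).flip 1 (conv (C.taut ∘ₗ sgn k _) C.taut x) := by
    symm
    refine conv_congr _ _ x ((C.cobar.tm D.cobar).flip 1 ∘ₗ LinearMap.mul' k _ ∘ₗ
      TensorProduct.map (C.taut ∘ₗ sgn k _) C.taut) ?_
    intro a b
    simp [tautl_apply, DGA.tm_mul, GrMod.odd_one]
  rw [e, ← h, tautl_apply, DGA.tm_d, DGA.d_one, map_zero, add_zero, map_add]
  rfl

theorem tautr_tw (x : D.carrier) : (C.cobar.tensor D.cobar).d (C.tautr D x) + C.tautr D (D.d x) =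
    conv (C.tautr D ∘ₗ sgn k _) (C.tautr D) x := by
  have h := D.taut_isTwisting.tw x
  have e : conv (C.tautr D ∘ₗ sgn k _) (C.tautr D) x =
      C.cobar.tm D.cobar 1 (conv (D.taut ∘ₗ sgn k _) D.taut x) := by
    symm
    refine conv_congr _ _ x (C.cobar.tm D.cobar 1 ∘ₗ LinearMap.mul' k _ ∘ₗ
      TensorProduct.map (D.taut ∘ₗ sgn k _) D.taut) ?_
    intro a b
    simp [tautr_apply, DGA.tm_mul, GrMod.odd_one]
  rw [e, ← h, tautr_apply, DGA.tm_d, DGA.d_one, sgn_one, map_zero, LinearMap.zero_apply, zero_add,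
    map_add]
  rfl

theorem gammaT_isTwisting : (C.tensor D).IsTwisting (C.cobar.tensor D.cobar) (C.gammaT D) where
  deg := by
    refine tp_hasDeg C D ?_
    intro i j x hx y hy
    rw [gammaT_tmul]
    have h1 : C.tautl D x ∈ deg k _ (i + 1) :=
      DGA.tm_mem _ _ (add_zero _) (C.taut_isTwisting.deg _ _ hx) (one_mem_deg (k := k))
    have h2 : C.tautr D y ∈ deg k _ (j + 1) :=
      DGA.tm_mem _ _ (zero_add _) (one_mem_deg (k := k)) (D.taut_isTwisting.deg _ _ hy)
    refine add_mem ?_ ?_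
    · by_cases hj : j = 0
      · subst hj; rw [add_zero]; exact Submodule.smul_mem _ _ h1
      · rw [fun_zero D.ε_deg hj hy]; simp
    · by_cases hj : i = 0
      · subst hj; rw [zero_add]; exact Submodule.smul_mem _ _ h2
      · rw [fun_zero C.ε_deg hj hx]; simp
  η := by
    rw [tp_η, gammaT_tmul, tautl_apply, tautr_apply, taut_η, taut_η]
    simp
  ε c := by
    have h : (C.cobar.tensor D.cobar).ε.toLinearMap ∘ₗ C.gammaT D = 0 := by
      refine C.tp_ext D fun x y => ?_
      simp [gammaT_tmul, tautl_apply, tautr_apply, DGA.tm_ε, C.taut_isTwisting.ε,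
        D.taut_isTwisting.ε]
    exact LinearMap.congr_fun h c
  tw c := by
    have h : (C.cobar.tensor D.cobar).d ∘ₗ C.gammaT D + C.gammaT D ∘ₗ (C.tensor D).d =
        conv (C.gammaT D ∘ₗ sgn k _) (C.gammaT D) := by
      refine C.tp_ext D fun x y => ?_
      rw [gammaT_conv, ← tautl_tw, ← tautr_tw]
      rw [LinearMap.add_apply, LinearMap.comp_apply, LinearMap.comp_apply, tp_d, map_add]
      rw [gammaT_tmul, gammaT_tmul, gammaT_tmul, map_add, map_smul, map_smul, C.ε_d, D.ε_d,
        fun_sgn C.ε_deg]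
      module
    exact LinearMap.congr_fun h c

/-- The map `γ : Ω(C ⊗ D) → ΩC ⊗ ΩD`, the DGA map with
`⟨c ⊗ c'⟩ ↦ ε(c') ⟨c⟩ ⊗ 1 + ε(c) 1 ⊗ ⟨c'⟩`. -/
def gamma : DGAHom (C.tensor D).cobar (C.cobar.tensor D.cobar) := (C.gammaT_isTwisting D).hom
end gamma
end DGC

/-! ### Trivialized extensions and the lifting of the tautological twisting cochain -/

/-- A trivialized extension: a DGA map `α : X → A` with a (not necessarily multiplicative) cochain
section `β` and a homotopy `h` from `β α` to the identity with `α h = 0`. -/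
structure TrivExt {k : Type u} [CommRing k] (X : DGA.{u, w} k) (A : DGA.{u, v} k) where
  α : DGAHom X A
  β : A.carrier →ₗ[k] X.carrier
  h : X.carrier →ₗ[k] X.carrier
  β_deg : HasDeg β 0
  h_deg : HasDeg h (-1)
  β_one : β 1 = 1
  β_d : ∀ a, β (A.d a) = X.d (β a)
  α_β : ∀ a, α.toAlgHom (β a) = a
  α_h : ∀ x, α.toAlgHom (h x) = 0
  d_h : ∀ x, X.d (h x) + h (X.d x) = x - β (α.toAlgHom x)

namespace TC
section word
variable {k : Type u} [CommRing k] {V : Type v} [AddCommGroup V] [Module k V]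

/-- The word `v₁⋯vₙ`. -/
def word (l : List V) : TensorAlgebra k V := (l.map (TensorAlgebra.ι k)).prod

@[simp] theorem word_nil : word (k := k) ([] : List V) = 1 := rfl
@[simp] theorem word_cons (v : V) (l : List V) :
    word (k := k) (v :: l) = TensorAlgebra.ι k v * word l := by simp [word]

theorem list_ext {M : Type*} [AddCommGroup M] [Module k M] {f g : TensorAlgebra k V →ₗ[k] M}
    (h : ∀ l, f (word l) = g (word l)) : f = g := by
  refine LinearMap.ext fun x => ?_
  have hx : x ∈ Submodule.span k (Set.range (word (k := k) (V := V))) := by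
    refine word_induction (P := fun x => x ∈ Submodule.span k (Set.range (word (k := k) (V := V)))) x
      (Submodule.subset_span ⟨[], rfl⟩) (fun c x hx => Submodule.smul_mem _ c hx)
      (fun x y hx hy => add_mem hx hy) ?_
    intro v x hx
    refine Submodule.span_induction ?_ ?_ ?_ ?_ hx
    · rintro _ ⟨l, rfl⟩
      exact Submodule.subset_span ⟨v :: l, by simp⟩
    · rw [mul_zero]; exact zero_mem _
    · intro x y _ _ hx hy
      rw [mul_add]; exact add_mem hx hy
    · intro c x _ hx
      rw [mul_smul_comm]; exact Submodule.smul_mem _ _ hx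
  refine Submodule.span_induction ?_ (by simp) (fun x y _ _ hx hy => by simp only [map_add, hx, hy])
    (fun c x _ hx => by simp only [map_smul, hx]) hx
  rintro _ ⟨l, rfl⟩; exact h l

theorem decon_word (l : List V) : decon k V (word l) =
    ∑ i ∈ Finset.range (l.length + 1), word (l.take i) ⊗ₜ[k] word (l.drop i) := by
  induction l with
  | nil => simp
  | cons v l ih =>
    rw [List.length_cons, Finset.sum_range_succ', word_cons, decon_cons, ih, map_sum, add_comm]
    simp

theorem sgn_word [GrMod k V] (l : List V) :
    sgn k _ (word (k := k) l) = word (l.map (sgn k V)) := by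
  induction l with
  | nil => simp [sgn_one]
  | cons v l ih => simp [sgn_cons, ih]

variable (k V) in
/-- The components of an element by word length. -/
def wlen : TensorAlgebra k V →ₗ[k] (ℕ →₀ TensorAlgebra k V) :=
  wordRec (Finsupp.single 0 1) 0 (LinearMap.mk₂ k
    (fun v y => Finsupp.lmapDomain _ k Nat.succ
      (Finsupp.mapRange.linearMap (LinearMap.mulLeft k (TensorAlgebra.ι k v)) y))
    (by intro v v' y; rw [← map_add]; congr 1; ext; simp [add_mul])
    (by intro c v y; rw [← map_smul]; congr 1; ext; simp)
    (by intros; simp only [map_add]) (by intros; simp only [map_smul]))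

theorem wlen_word (l : List V) : wlen k V (word l) = Finsupp.single l.length (word l) := by
  induction l with
  | nil => simp [wlen]
  | cons v l ih =>
    rw [word_cons, wlen, wordRec_cons, ← wlen, ih, LinearMap.zero_apply, LinearMap.zero_apply,
      zero_add, LinearMap.mk₂_apply, Finsupp.mapRange.linearMap_apply, Finsupp.mapRange_single,
      Finsupp.lmapDomain_apply, Finsupp.mapDomain_single]
    simp
end word
end TC

namespace DGA
section bar
variable {k : Type u} [CommRing k] (A : DGA.{u, v} k)

/-- The tautological twisting cochain `BA → s⁻¹Ā ≅ Ā ⊆ A`. -/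
def taut : A.bar.carrier →ₗ[k] A.carrier := A.unbr ∘ₗ TC.letter k A.V

theorem taut_tw (c : TensorAlgebra k A.V) : A.d (A.unbr (TC.letter k A.V c)) +
    A.unbr (TC.letter k A.V (TC.coder A.barD A.barM c)) = LinearMap.mul' k _ (TensorProduct.map
      ((A.unbr ∘ₗ TC.letter k A.V) ∘ₗ sgn k _) (A.unbr ∘ₗ TC.letter k A.V) (TC.decon k A.V c)) := by
  rw [TC.letter_coder, map_add, barD_apply, map_neg, unbr_br, A.ε_d, zero_smul, sub_zero,
    ← add_assoc, add_neg_cancel, zero_add]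
  generalize TC.decon k A.V c = t
  induction t with
  | zero => simp
  | add s t hs ht => simp only [map_add, hs, ht]
  | tmul a b =>
    have : TC.letter k A.V (sgn k _ a) = sgn k _ (TC.letter k A.V a) :=
      (sgn_even TC.letter_deg (by simp) _).symm
    simp [barM_apply, this]

theorem taut_isTwisting : A.bar.IsTwisting A A.taut where
  deg := A.unbr_deg.comp TC.letter_deg (zero_add 1)
  η := by
    change A.unbr (TC.letter k A.V ((1 : k) • 1)) = 0
    simp
  ε c := A.ε_unbr _
  tw c := A.taut_tw c

/-- The word `[v₁|⋯|vₙ]`. -/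
def word (l : List A.V) : A.bar.carrier := TC.word l

theorem word_ext {M : Type*} [AddCommGroup M] [Module k M] {f g : A.bar.carrier →ₗ[k] M}
    (h : ∀ l, f (A.word l) = g (A.word l)) : f = g :=
  TC.list_ext (k := k) (V := A.V) h

theorem sgn_word (l : List A.V) : sgn k _ (A.word l) = A.word (l.map (sgn k _)) :=
  TC.sgn_word l

theorem conv_word {X : Type*} [Ring X] [Algebra k X] (f g : A.bar.carrier →ₗ[k] X)
    (l : List A.V) : DGC.conv f g (A.word l) =
      ∑ i ∈ Finset.range (l.length + 1), f (A.word (l.take i)) * g (A.word (l.drop i)) := by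
  let f' : TensorAlgebra k A.V →ₗ[k] X := f
  let g' : TensorAlgebra k A.V →ₗ[k] X := g
  have h2 : (LinearMap.mul' k X ∘ₗ TensorProduct.map f' g') (TC.decon k A.V (TC.word l)) =
      ∑ i ∈ Finset.range (l.length + 1), f' (TC.word (l.take i)) * g' (TC.word (l.drop i)) := by
    rw [TC.decon_word, map_sum]; simp
  exact h2

variable {A}
variable {X : DGA.{u, w} k} (E : TrivExt X A)

/-- The iterates `τ₀ = 0`, `τₙ₊₁ = β t + h (τₙ ∪ τₙ)`. -/
def _root_.TrivExt.iter : ℕ → A.bar.carrier →ₗ[k] X.carrier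
  | 0 => 0
  | n + 1 => E.β ∘ₗ A.taut + E.h ∘ₗ DGC.conv (TrivExt.iter n ∘ₗ sgn k _) (TrivExt.iter n)

/-- The solution `τ : BA → X` of the equation `τ = β t + h (τ ∪ τ)`; on words of length `n`
it is the iterate `τₙ`. -/
def _root_.TrivExt.tilde : A.bar.carrier →ₗ[k] X.carrier :=
  Finsupp.lsum ℕ E.iter ∘ₗ TC.wlen k A.V

theorem tilde_word (l : List A.V) : E.tilde (A.word l) = E.iter l.length (A.word l) := by
  have h : TC.wlen k A.V (A.word l) = Finsupp.single l.length (A.word l) := TC.wlen_word l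
  refine (congrArg (Finsupp.lsum ℕ E.iter) h).trans ?_
  simp

theorem taut_nil : A.taut (A.word []) = 0 := by
  have := TC.letter_one (k := k) (W := A.V)
  exact (congrArg A.unbr this).trans (map_zero _)

theorem iter_nil (n : ℕ) : E.iter n (A.word []) = 0 := by
  induction n with
  | zero => rfl
  | succ n ih =>
    simp only [TrivExt.iter, LinearMap.add_apply, LinearMap.comp_apply, conv_word, taut_nil]
    simp [ih]

theorem iter_stable (n : ℕ) : ∀ l : List A.V, l.length ≤ n → ∀ m, n ≤ m →
    E.iter m (A.word l) = E.iter n (A.word l) := by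
  induction n with
  | zero =>
    intro l hl m _
    rw [List.length_eq_zero_iff.mp (Nat.le_zero.mp hl), iter_nil, iter_nil]
  | succ n ih =>
    intro l hl m hm
    obtain ⟨m, rfl⟩ : ∃ m', m = m' + 1 := ⟨m - 1, by omega⟩
    simp only [TrivExt.iter, LinearMap.add_apply, LinearMap.comp_apply, conv_word, sgn_word]
    congr 2
    refine Finset.sum_congr rfl fun i hi => ?_
    have hi' : i ≤ l.length := by simpa [Nat.lt_succ_iff] using hi
    by_cases h0 : i = 0
    · subst h0; simp [iter_nil]
    by_cases h1 : i = l.length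
    · subst h1; simp [iter_nil]
    rw [ih _ (by simp; omega) m (by omega), ih _ (by simp; omega) m (by omega)]

theorem tilde_eq : E.tilde =
    E.β ∘ₗ A.taut + E.h ∘ₗ DGC.conv (E.tilde ∘ₗ sgn k _) E.tilde := by
  refine A.word_ext fun l => ?_
  rw [tilde_word, ← iter_stable E l.length l le_rfl (l.length + 1) (by omega)]
  simp only [TrivExt.iter, LinearMap.add_apply, LinearMap.comp_apply, conv_word, sgn_word, tilde_word]
  congr 2
  refine Finset.sum_congr rfl fun i hi => ?_
  have hi' : i ≤ l.length := by simpa [Nat.lt_succ_iff] using hi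
  rw [iter_stable E _ _ le_rfl l.length (by simp), iter_stable E _ _ le_rfl l.length (by simp)]

theorem tilde_nil : E.tilde (A.word []) = 0 := by rw [tilde_word, iter_nil]

theorem iter_deg (n : ℕ) : HasDeg (E.iter n) 1 := by
  induction n with
  | zero => exact HasDeg.zero 1
  | succ n ih =>
    exact (E.β_deg.comp A.taut_isTwisting.deg rfl).add (E.h_deg.comp
      (DGC.conv_deg _ _ (ih.comp HasDeg.sgn (zero_add 1)) ih (by norm_num : (1 : ℤ) + 1 = 2)) (by norm_num))

theorem tilde_deg : HasDeg E.tilde 1 := by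
  let F : TensorAlgebra k A.V →ₗ[k] X.carrier := E.tilde
  suffices h : HasDeg F 1 from h
  intro n x hx
  refine Submodule.span_induction (p := fun x _ => F x ∈ deg k X.carrier (n + 1)) ?_ ?_ ?_ ?_ hx
  · rintro _ ⟨l, hl, rfl, rfl⟩
    have e : (l.map fun p => TensorAlgebra.ι k p.2).prod = TC.word (l.map Prod.snd) := by
      simp [TC.word, Function.comp_def]
    have h0 : TC.word (l.map Prod.snd) ∈ deg k (TensorAlgebra k A.V) (l.map Prod.fst).sum :=
      Submodule.subset_span ⟨l, hl, rfl, e.symm⟩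
    have h1 : A.word (l.map Prod.snd) ∈ deg k A.bar.carrier (l.map Prod.fst).sum := h0
    have h2 := iter_deg E (l.map Prod.snd).length _ _ h1
    have h3 : E.tilde (A.word (l.map Prod.snd)) = E.iter (l.map Prod.snd).length _ := tilde_word E _
    rw [← h3] at h2
    rw [e]; exact h2
  · rw [map_zero]; exact zero_mem _
  · intro x y _ _ hx hy; rw [map_add]; exact add_mem hx hy
  · intro c x _ hx; rw [map_smul]; exact Submodule.smul_mem _ _ hx

theorem α_tilde : E.α.toAlgHom.toLinearMap ∘ₗ E.tilde = A.taut := by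
  rw [tilde_eq]
  ext c
  simp [E.α_β, E.α_h]

theorem word_nil : A.bar.η 1 = A.word [] := one_smul k (1 : TensorAlgebra k A.V)

/-- The defect of the twisting equation. -/
def defect : A.bar.carrier →ₗ[k] X.carrier :=
  X.d ∘ₗ E.tilde + E.tilde ∘ₗ A.bar.d - DGC.conv (E.tilde ∘ₗ sgn k _) E.tilde

theorem defect_rec : defect E =
    - (E.h ∘ₗ (DGC.conv (defect E ∘ₗ sgn k _) E.tilde - DGC.conv E.tilde (defect E))) := by
  have hK : E.tilde = E.β ∘ₗ A.taut + E.h ∘ₗ DGC.conv (E.tilde ∘ₗ sgn k _) E.tilde := tilde_eq E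
  have hα := α_tilde E
  have hs : sgn k _ ∘ₗ E.tilde = - (E.tilde ∘ₗ sgn k _) := by
    ext c; exact sgn_odd (tilde_deg E) (by decide) c
  generalize hτ : E.tilde = τ at *
  generalize hKK : DGC.conv (τ ∘ₗ sgn k _) τ = K at *
  generalize hE : defect E = F at *
  have hF : X.d ∘ₗ τ = F + K - τ ∘ₗ A.bar.d := by
    rw [← hE, defect, hτ, hKK]; abel
  have hαK : ∀ c, E.α.toAlgHom (K c) = A.d (A.taut c) + A.taut (A.bar.d c) := by
    intro c
    rw [A.taut_isTwisting.tw c, ← hα, ← hKK, LinearMap.comp_assoc, ← DGC.map_conv]; rfl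
  have hmain : F = - (E.h ∘ₗ (X.d ∘ₗ K - K ∘ₗ A.bar.d)) := by
    have h1 : X.d ∘ₗ τ = X.d ∘ₗ (E.β ∘ₗ A.taut + E.h ∘ₗ K) := congrArg _ hK
    have h2 : τ ∘ₗ A.bar.d = (E.β ∘ₗ A.taut + E.h ∘ₗ K) ∘ₗ A.bar.d := congrArg (· ∘ₗ A.bar.d) hK
    have h3 : F = X.d ∘ₗ τ + τ ∘ₗ A.bar.d - K := by rw [hF]; abel
    rw [h3, h1, h2]
    ext c
    have h4 := E.d_h (K c)
    rw [hαK, map_add, E.β_d] at h4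
    simp only [LinearMap.add_apply, LinearMap.sub_apply, LinearMap.comp_apply, LinearMap.neg_apply,
      map_add, map_sub]
    rw [← sub_eq_zero] at h4
    rw [← sub_eq_zero, ← h4]
    abel
  have e1 : sgn k _ ∘ₗ τ ∘ₗ sgn k _ = - τ := by
    rw [← LinearMap.comp_assoc, hs, LinearMap.neg_comp, LinearMap.comp_assoc, DGC.sgn_comp_sgn,
      LinearMap.comp_id]
  have e4 : (τ ∘ₗ sgn k A.bar.carrier) ∘ₗ sgn k A.bar.carrier = τ := by
    rw [LinearMap.comp_assoc, DGC.sgn_comp_sgn, LinearMap.comp_id]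
  have e3 : (τ ∘ₗ sgn k _) ∘ₗ A.bar.d = - ((τ ∘ₗ A.bar.d) ∘ₗ sgn k _) := by
    rw [LinearMap.comp_assoc, LinearMap.comp_assoc, DGC.d_sgn, LinearMap.comp_neg, neg_neg]
  have hKs : K ∘ₗ sgn k _ = DGC.conv τ (τ ∘ₗ sgn k _) := by
    rw [← hKK, DGC.conv_sgn, e4]
  have hd : X.d ∘ₗ K - K ∘ₗ A.bar.d = DGC.conv (F ∘ₗ sgn k _) τ - DGC.conv τ F := by
    have h5 : DGC.conv (K ∘ₗ sgn k _) τ = DGC.conv τ K := by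
      rw [hKs, DGC.conv_assoc, hKK]
    have h6 : X.d ∘ₗ K = DGC.conv ((F + K - τ ∘ₗ A.bar.d) ∘ₗ sgn k _) τ -
        DGC.conv τ (F + K - τ ∘ₗ A.bar.d) := by
      rw [← hF, ← hKK, DGC.deriv_conv _ _ X.d_mul, e1, DGC.conv_neg_left, ← LinearMap.comp_assoc,
        sub_eq_add_neg]
    have h7 : K ∘ₗ A.bar.d = - DGC.conv ((τ ∘ₗ A.bar.d) ∘ₗ sgn k _) τ +
        DGC.conv τ (τ ∘ₗ A.bar.d) := by
      rw [← hKK, DGC.conv_d, e3, e4, DGC.conv_neg_left]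
    rw [h6, h7, LinearMap.sub_comp, LinearMap.add_comp, DGC.conv_sub_left, DGC.conv_add_left,
      DGC.conv_sub_right, DGC.conv_add_right, h5]
    abel
  rw [← hd]; exact hmain

theorem defect_word (n : ℕ) : ∀ l : List A.V, l.length ≤ n → defect E (A.word l) = 0 := by
  have h0 : defect E (A.word []) = 0 := by
    have hd : A.bar.d (A.word []) = 0 := by rw [← word_nil, A.bar.d_η]
    simp only [defect, LinearMap.sub_apply, LinearMap.add_apply, LinearMap.comp_apply, conv_word,
      tilde_nil, hd]
    simp [tilde_nil]
  induction n with
  | zero => intro l hl; rw [List.length_eq_zero_iff.mp (Nat.le_zero.mp hl), h0]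
  | succ n ih =>
    intro l hl
    rw [defect_rec]
    simp only [LinearMap.neg_apply, LinearMap.comp_apply, LinearMap.sub_apply, conv_word, sgn_word]
    rw [Finset.sum_eq_zero, Finset.sum_eq_zero]
    · simp
    · intro i hi
      have hi' : i ≤ l.length := by simpa [Nat.lt_succ_iff] using hi
      by_cases hi0 : i = 0
      · subst hi0; simp [tilde_nil]
      · rw [ih _ (by simp; omega), mul_zero]
    · intro i hi
      have hi' : i ≤ l.length := by simpa [Nat.lt_succ_iff] using hi
      by_cases hi0 : i = l.length
      · subst hi0; simp [tilde_nil]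
      · rw [ih _ (by simp; omega), zero_mul]

theorem tilde_isTwisting : A.bar.IsTwisting X E.tilde where
  deg := tilde_deg E
  η := by rw [word_nil, tilde_nil]
  ε c := by
    have h : E.α.toAlgHom (E.tilde c) = A.taut c := LinearMap.congr_fun (α_tilde E) c
    rw [← E.α.map_ε, h, A.taut_isTwisting.ε]
  tw c := by
    have h : defect E = 0 := A.word_ext fun l => defect_word E l.length l le_rfl
    have := LinearMap.congr_fun h c
    simpa [defect, sub_eq_zero] using this

/-- The DGA map `ΩBA → X` over `A` determined by a trivialized extension `X → A`. -/
def _root_.TrivExt.lift : DGAHom A.bar.cobar X := (tilde_isTwisting E).hom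
end bar
end DGA

/-! ### The contraction of `ΩBA` onto `A` -/
namespace DGA
section cobarBar
variable {k : Type u} [CommRing k] (A : DGA.{u, v} k)

/-- The word `[a | c]`. -/
def pre : A.carrier →ₗ[k] A.bar.carrier →ₗ[k] A.bar.carrier :=
  (LinearMap.mul k (TensorAlgebra k A.V) ∘ₗ TensorAlgebra.ι k ∘ₗ A.br :
    A.carrier →ₗ[k] TensorAlgebra k A.V →ₗ[k] TensorAlgebra k A.V)

/-- `c ↦ c - ε(c)` -/
def red : A.bar.carrier →ₗ[k] A.bar.carrier := LinearMap.id - A.bar.ε.smulRight (A.bar.η 1)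

theorem red_apply (c : A.bar.carrier) : A.red c = c - A.bar.ε c • A.bar.η 1 := rfl

theorem bar_η : A.bar.η 1 = (1 : TensorAlgebra k A.V) := one_smul k (1 : TensorAlgebra k A.V)

@[elab_as_elim]
theorem bar_induction {P : A.bar.carrier → Prop} (c : A.bar.carrier) (one : P (A.bar.η 1))
    (smul : ∀ (r : k) x, P x → P (r • x)) (add : ∀ x y, P x → P y → P (x + y))
    (cons : ∀ a, A.ε a = 0 → ∀ x, P x → P (A.pre a x)) : P c := by
  refine word_induction (k := k) (V := A.V) (P := P) c (A.bar_η ▸ one) smul add ?_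
  intro v x hx
  have := cons (A.unbr v) (A.ε_unbr v) x hx
  have e : A.pre (A.unbr v) x = TensorAlgebra.ι k v * (show TensorAlgebra k A.V from x) := by
    change TensorAlgebra.ι k (A.br (A.unbr v)) * _ = _
    rw [br_unbr]
  rwa [e] at this

theorem br_sgn (a : A.carrier) : A.br (sgn k _ a) = - sgn k _ (A.br a) := by
  rw [sgn_odd A.br_deg (by decide), neg_neg]

theorem pre_sgn (a : A.carrier) (c : A.bar.carrier) :
    sgn k _ (A.pre a c) = - A.pre (sgn k _ a) (sgn k _ c) := by
  have key : ∀ c : TensorAlgebra k A.V, sgn k _ (TensorAlgebra.ι k (A.br a) * c) =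
      - (TensorAlgebra.ι k (A.br (sgn k _ a)) * sgn k _ c) := by
    intro c
    rw [br_sgn, map_neg, neg_mul, neg_neg, TC.sgn_cons]
  exact key c

theorem pre_one (c : A.bar.carrier) : A.pre 1 c = 0 := by
  change TensorAlgebra.ι k (A.br 1) * (show TensorAlgebra k A.V from c) = 0
  rw [br_one, map_zero, zero_mul]

theorem pre_ε (a : A.carrier) (c : A.bar.carrier) : A.bar.ε (A.pre a c) = 0 :=
  TC.counit_cons (k := k) (V := A.V) _ _

theorem pre_Δ (a : A.carrier) (c : A.bar.carrier) : A.bar.Δ (A.pre a c) =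
    A.bar.η 1 ⊗ₜ A.pre a c + TensorProduct.map (A.pre a) LinearMap.id (A.bar.Δ c) := by
  rw [bar_η]
  exact TC.decon_cons (k := k) (V := A.V) _ _

/-- Multiplication of the first letter of a word by `a`. -/
def mrg (a : A.carrier) (c : A.bar.carrier) : A.bar.carrier := TC.merge A.barM c (A.br a)

theorem mrg_η (a : A.carrier) : A.mrg a (A.bar.η 1) = 0 := by
  rw [bar_η]; exact TC.merge_one _ _

theorem mrg_pre (a b : A.carrier) (hb : A.ε b = 0) (c : A.bar.carrier) :
    A.mrg (sgn k _ a) (A.pre b c) = - A.pre (a * b) c + A.ε a • A.pre b c := by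
  have key : ∀ c : TensorAlgebra k A.V, TC.merge A.barM (TensorAlgebra.ι k (A.br b) * c)
      (A.br (sgn k _ a)) = - (TensorAlgebra.ι k (A.br (a * b)) * c) +
        A.ε a • (TensorAlgebra.ι k (A.br b) * c) := by
    intro c
    rw [TC.merge_cons, barM_apply, unbr_sgn]
    simp only [unbr_br, hb, map_sub, sgn_sgn, map_smul, sgn_one, A.ε_sgn, zero_smul, sub_zero]
    simp only [neg_mul, map_neg, sub_mul, smul_mul_assoc, one_mul, map_sub, map_smul]
    abel
  exact key c

theorem pre_d (a : A.carrier) (c : A.bar.carrier) : A.bar.d (A.pre a c) =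
    - A.pre (A.d a) c + A.mrg a c - A.pre (sgn k _ a) (A.bar.d c) := by
  have key : ∀ c : TensorAlgebra k A.V, TC.coder A.barD A.barM (TensorAlgebra.ι k (A.br a) * c) =
      - (TensorAlgebra.ι k (A.br (A.d a)) * c) + TC.merge A.barM c (A.br a) -
        TensorAlgebra.ι k (A.br (sgn k _ a)) * TC.coder A.barD A.barM c := by
    intro c
    rw [TC.coder_cons, barD_apply, unbr_br, map_sub, map_smul, A.d_one, smul_zero, sub_zero,
      br_sgn, map_neg, map_neg, neg_mul, neg_mul, sub_neg_eq_add]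
  exact key c

theorem taut_η' : A.taut (A.bar.η 1) = 0 := A.taut_isTwisting.η

theorem taut_pre (a : A.carrier) (ha : A.ε a = 0) (c : A.bar.carrier) :
    A.taut (A.pre a c) = A.bar.ε c • a := by
  have h : TC.letter k A.V (TensorAlgebra.ι k (A.br a) * (show TensorAlgebra k A.V from c)) =
    A.bar.ε c • A.br a := TC.letter_cons _ _
  refine (congrArg A.unbr h).trans ?_
  rw [map_smul, unbr_br, ha, zero_smul, sub_zero]

theorem red_η : A.red (A.bar.η 1) = 0 := by rw [red_apply, A.bar.ε_η, one_smul, sub_self]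
theorem red_pre (a : A.carrier) (c : A.bar.carrier) : A.red (A.pre a c) = A.pre a c := by
  rw [red_apply, pre_ε, zero_smul, sub_zero]
theorem red_d (c : A.bar.carrier) : A.red (A.bar.d c) = A.bar.d c := by
  rw [red_apply, A.bar.ε_d, zero_smul, sub_zero]
theorem red_sgn (c : A.bar.carrier) : sgn k _ (A.red c) = A.red (sgn k _ c) := by
  rw [red_apply, red_apply, map_sub, map_smul, A.bar.η_sgn, fun_sgn A.bar.ε_deg]

/-- `(a, c) ↦ -⟨[(-1)^{|a|} a | c - ε(c)]⟩` -/
def sig : A.carrier →ₗ[k] A.bar.carrier →ₗ[k] TensorAlgebra k A.bar.W :=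
  - ((A.pre ∘ₗ sgn k _).compl₂ A.red).compr₂ A.bar.cell

theorem sig_apply (a : A.carrier) (c : A.bar.carrier) :
    A.sig a c = - A.bar.cell (A.pre (sgn k _ a) (A.red c)) := rfl

theorem sig_η (a : A.carrier) : A.sig a (A.bar.η 1) = 0 := by
  rw [sig_apply, red_η, map_zero, map_zero, neg_zero]

theorem sgn_sig (a : A.carrier) (c : A.bar.carrier) :
    sgn k _ (A.sig a c) = A.sig (sgn k _ a) (sgn k _ c) := by
  have h : ∀ z, sgn k _ (A.bar.cell z) = - A.bar.cell (sgn k _ z) :=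
    fun z => LinearMap.congr_fun A.bar.sgn_cell z
  rw [sig_apply, sig_apply, map_neg, h, pre_sgn, map_neg, red_sgn, neg_neg]

/-- The section `a ↦ ε(a) + ⟨[a - ε(a)]⟩` -/
def beta : A.carrier →ₗ[k] TensorAlgebra k A.bar.W :=
  A.ε.toLinearMap.smulRight 1 + A.bar.cell ∘ₗ A.pre.flip (A.bar.η 1)

theorem beta_apply (a : A.carrier) :
    A.beta a = A.ε a • (1 : TensorAlgebra k A.bar.W) + A.bar.cell (A.pre a (A.bar.η 1)) := rfl

/-- `(b, c ⊗ c') ↦ sig(b t(±c), c')` -/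
def sig2 (b : A.carrier) : A.bar.carrier ⊗[k] A.bar.carrier →ₗ[k] TensorAlgebra k A.bar.W :=
  TensorProduct.lift (A.sig ∘ₗ LinearMap.mulLeft k b ∘ₗ A.taut ∘ₗ sgn k _)

theorem sig2_tmul (b : A.carrier) (c c' : A.bar.carrier) :
    A.sig2 b (c ⊗ₜ c') = A.sig (b * A.taut (sgn k _ c)) c' := rfl

theorem sig2_Δ_η (b : A.carrier) : A.sig2 b (A.bar.Δ (A.bar.η 1)) = 0 := by
  rw [A.bar.Δ_η, sig2_tmul, sig_η]

theorem sig2_Δ_pre (a b : A.carrier) (hb : A.ε b = 0) (c : A.bar.carrier) :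
    A.sig2 (sgn k _ a) (A.bar.Δ (A.pre b c)) = - A.sig (sgn k _ (a * b)) c := by
  rw [pre_Δ, map_add, sig2_tmul, A.bar.η_sgn, taut_η', mul_zero, map_zero, LinearMap.zero_apply,
    zero_add]
  refine Eq.trans ?_ (A.bar.counit_lift (- A.sig (sgn k _ (a * b))) c)
  generalize A.bar.Δ c = t
  induction t with
  | zero => simp
  | add s t hs ht => simp only [map_add, hs, ht]
  | tmul p q =>
    rw [TensorProduct.map_tmul, LinearMap.id_apply, sig2_tmul, pre_sgn, map_neg,
      taut_pre _ _ (by rw [A.ε_sgn, hb]), fun_sgn A.bar.ε_deg, mul_neg, mul_smul_comm, ← sgn_mul,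
      map_neg, map_smul]
    simp

theorem conv_pre {X : Type*} [Ring X] [Algebra k X] (f g : A.bar.carrier →ₗ[k] X)
    (hf : f (A.bar.η 1) = 0) (a : A.carrier) (c : A.bar.carrier) :
    DGC.conv f g (A.pre a c) = DGC.conv (f ∘ₗ A.pre a) g c := by
  simp only [DGC.conv, LinearMap.comp_apply, pre_Δ, map_add, TensorProduct.map_tmul,
    LinearMap.mul'_apply, hf, zero_mul, zero_add]
  rw [← LinearMap.comp_apply (TensorProduct.map f g), ← TensorProduct.map_comp]
  rfl

theorem cell_η' : A.bar.cell (A.bar.η 1) = 0 := A.bar.cell_η 1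

theorem cobarD_cell_pre (a : A.carrier) (c : A.bar.carrier) :
    A.bar.cobarD (A.bar.cell (A.pre (sgn k _ a) c)) =
      - A.bar.cell (A.pre (sgn k _ (A.d a)) c) - A.bar.cell (A.mrg (sgn k _ a) c)
      + A.bar.cell (A.pre a (A.bar.d c)) -
      DGC.conv (A.bar.cell ∘ₗ A.pre a ∘ₗ sgn k _) A.bar.cell c := by
  have e : (A.bar.cell ∘ₗ sgn k _) ∘ₗ A.pre (sgn k _ a) =
      - (A.bar.cell ∘ₗ A.pre a ∘ₗ sgn k _) := by
    ext z
    simp [pre_sgn, sgn_sgn]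
  rw [DGC.cobarD_cell, DGC.cobarGen, LinearMap.add_apply, conv_pre _ _ _
    (by rw [LinearMap.comp_apply, A.bar.η_sgn, cell_η']), e, DGC.conv_neg_left,
    LinearMap.neg_apply, LinearMap.neg_apply, LinearMap.comp_apply, pre_d, A.d_sgn, sgn_sgn]
  simp only [map_neg, map_sub, map_add, LinearMap.neg_apply]
  abel

theorem conv_sig (a : A.carrier) (c : A.bar.carrier) :
    DGC.conv (A.sig (sgn k _ a) ∘ₗ sgn k _) A.bar.cell c =
      - DGC.conv (A.bar.cell ∘ₗ A.pre a ∘ₗ sgn k _) A.bar.cell c +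
      A.bar.cell (A.pre a (A.bar.η 1)) * A.bar.cell c := by
  have e : A.sig (sgn k _ a) ∘ₗ sgn k _ = - (A.bar.cell ∘ₗ A.pre a ∘ₗ sgn k _) +
      A.bar.ε.smulRight (A.bar.cell (A.pre a (A.bar.η 1))) := by
    ext z
    simp only [LinearMap.comp_apply, sig_apply, sgn_sgn, red_apply, map_sub, map_smul,
      fun_sgn A.bar.ε_deg, LinearMap.add_apply, LinearMap.neg_apply, LinearMap.smulRight_apply]
    abel
  rw [e, DGC.conv_add_left, DGC.conv_neg_left, LinearMap.add_apply, LinearMap.neg_apply]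
  congr 1
  refine Eq.trans ?_ (A.bar.counit_lift
    (LinearMap.mulLeft k (A.bar.cell (A.pre a (A.bar.η 1))) ∘ₗ A.bar.cell) c)
  symm
  refine DGC.conv_congr _ _ c _ ?_
  intro p q
  simp

theorem sig_key (a : A.carrier) (c : A.bar.carrier) :
    A.bar.cobarD (A.sig a c) + A.sig (A.d a) c - A.sig (sgn k _ a) (A.bar.d c) +
      DGC.conv (A.sig (sgn k _ a) ∘ₗ sgn k _) A.bar.cell c + A.sig2 (sgn k _ a) (A.bar.Δ c) =
      A.beta a * A.bar.cell c - A.beta (a * A.taut c) := by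
  refine A.bar_induction c ?_ (fun r x h => ?_) (fun x y hx hy => ?_) ?_
  · rw [conv_sig, sig2_Δ_η, taut_η', cell_η', sig_η, sig_η, A.bar.d_η]
    simp [DGC.conv, A.bar.Δ_η, cell_η']
  · simp only [map_smul, mul_smul_comm, ← smul_add, ← smul_sub, h]
  · simp only [map_add, mul_add]
    linear_combination (norm := abel) hx + hy
  · intro b hb c _
    rw [conv_sig, sig2_Δ_pre _ _ _ hb, sig_apply, sig_apply, sig_apply, sig_apply, red_d, red_pre,
      map_neg, cobarD_cell_pre, mrg_pre _ _ _ hb, sgn_sgn, sgn_sgn, taut_pre _ _ hb, red_apply,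
      beta_apply, beta_apply]
    simp only [map_sub, map_add, map_neg, map_smul, mul_smul_comm, map_mul, hb, mul_zero,
      zero_smul, zero_add, add_mul, smul_mul_assoc, one_mul, LinearMap.smul_apply,
      smul_eq_mul]
    abel

/-- `(c, y, a) ↦ sig(a, c) y` -/
def contrG : A.bar.carrier →ₗ[k] TensorAlgebra k A.bar.W →ₗ[k] A.carrier →ₗ[k]
    TensorAlgebra k A.bar.W :=
  LinearMap.mk₂ k (fun c y => LinearMap.mulRight k y ∘ₗ A.sig.flip c)
    (by intro c c' F; refine LinearMap.ext fun a => ?_; simp [add_mul])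
    (by intro r c F; refine LinearMap.ext fun a => ?_; simp)
    (by intro c F F'; refine LinearMap.ext fun a => ?_; simp [mul_add])
    (by intro r c F; refine LinearMap.ext fun a => ?_; simp)

/-- `(c, F) ↦ (a ↦ F(a t(c)))` -/
def contrH : A.bar.carrier →ₗ[k] (A.carrier →ₗ[k] TensorAlgebra k A.bar.W) →ₗ[k] A.carrier →ₗ[k]
    TensorAlgebra k A.bar.W :=
  LinearMap.mk₂ k (fun c F => F ∘ₗ LinearMap.mulRight k (A.taut c))
    (by intro c c' F; refine LinearMap.ext fun a => ?_; simp [mul_add])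
    (by intro r c F; refine LinearMap.ext fun a => ?_; simp)
    (by intro c F F'; refine LinearMap.ext fun a => ?_; simp)
    (by intro r c F; refine LinearMap.ext fun a => ?_; simp)

theorem contrG_η : A.contrG (A.bar.η 1) = 0 := by
  refine LinearMap.ext fun y => LinearMap.ext fun a => ?_
  simp [contrG, sig_η]
theorem contrH_η : A.contrH (A.bar.η 1) = 0 := by
  refine LinearMap.ext fun y => LinearMap.ext fun a => ?_
  simp [contrH, taut_η']

/-- The maps `K(y) : A → ΩBA`, with `K(1) = 0` and `K(⟨c⟩ y)(a) = sig(a, c) y + K(y)(a t(c))`. -/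
def contr : TensorAlgebra k A.bar.W →ₗ[k] A.carrier →ₗ[k] TensorAlgebra k A.bar.W :=
  wordRec 0
    (A.bar.desc (M := TensorAlgebra k A.bar.W →ₗ[k] A.carrier →ₗ[k] TensorAlgebra k A.bar.W)
      A.contrG A.contrG_η)
    (A.bar.desc (M := (A.carrier →ₗ[k] TensorAlgebra k A.bar.W) →ₗ[k] A.carrier →ₗ[k]
      TensorAlgebra k A.bar.W) A.contrH A.contrH_η)

theorem contr_one : A.contr 1 = 0 := by simp [contr]
theorem contr_cons (c : A.bar.carrier) (y : TensorAlgebra k A.bar.W) (a : A.carrier) :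
    A.contr (A.bar.cell c * y) a = A.sig a c * y + A.contr y (a * A.taut c) := by
  simp [contr, DGC.cell, contrG, contrH]

theorem contr_conv (c : A.bar.carrier) (y : TensorAlgebra k A.bar.W) (b : A.carrier) :
    A.contr (DGC.conv (A.bar.cell ∘ₗ sgn k _) A.bar.cell c * y) b =
      DGC.conv (A.sig b ∘ₗ sgn k _) A.bar.cell c * y + A.sig2 b (A.bar.Δ c) * y +
      A.contr y (b * DGC.conv (A.taut ∘ₗ sgn k _) A.taut c) := by
  simp only [DGC.conv, LinearMap.comp_apply]
  generalize A.bar.Δ c = t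
  induction t with
  | zero => simp
  | add s t hs ht => simp only [map_add, add_mul, mul_add, LinearMap.add_apply, hs, ht]; abel
  | tmul p q =>
    simp only [TensorProduct.map_tmul, LinearMap.mul'_apply, LinearMap.comp_apply, mul_assoc,
      contr_cons, sig2_tmul]
    abel

/-- The DGA map `α : ΩBA → A`, `⟨c⟩ ↦ t(c)`. -/
def alpha : DGAHom A.bar.cobar A := A.taut_isTwisting.hom

theorem alpha_cell (c : A.bar.carrier) :
    A.alpha.toAlgHom (show A.bar.cobar.carrier from A.bar.cell c) = A.taut c :=
  DGC.IsTwisting.hom_taut A.bar A.taut_isTwisting c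

theorem contr_htpy (y : TensorAlgebra k A.bar.W) : ∀ a,
    A.bar.cobarD (A.contr y a) + A.contr y (A.d a) + A.contr (A.bar.cobarD y) (sgn k _ a) =
      A.beta a * y - A.beta (a * A.alpha.toAlgHom (show A.bar.cobar.carrier from y)) := by
  let α : TensorAlgebra k A.bar.W →ₐ[k] A.carrier := A.alpha.toAlgHom
  change ∀ a, _ = A.beta a * y - A.beta (a * α y)
  have hα : ∀ c, α (A.bar.cell c) = A.taut c := A.alpha_cell
  refine A.bar.cell_induction y ?_ (fun c x h => ?_) (fun x y hx hy => ?_) ?_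
  · intro a
    simp [contr_one, DGC.cobarD_one]
  · intro a
    simp only [map_smul, mul_smul_comm, LinearMap.smul_apply, ← smul_add, ← smul_sub, h]
  · intro a
    simp only [map_add, mul_add, LinearMap.add_apply]
    linear_combination (norm := abel) hx a + hy a
  · intro c y h a
    have hs : sgn k _ (A.bar.cell c) = - A.bar.cell (sgn k _ c) :=
      LinearMap.congr_fun A.bar.sgn_cell c
    have ht : A.taut (sgn k _ c) = - sgn k _ (A.taut c) := by
      rw [sgn_odd A.taut_isTwisting.deg (by decide), neg_neg]
    have h1 := h (a * A.taut c)
    have h2 := A.sig_key a c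
    have h3 := A.taut_isTwisting.tw c
    rw [A.d_mul, sgn_mul] at h1
    rw [DGC.cobarD_cons, contr_cons, map_add, A.bar.cobarD_mul, contr_cons, DGC.cobarGen,
      LinearMap.add_apply, LinearMap.neg_apply, LinearMap.comp_apply, add_mul, map_add, map_add,
      LinearMap.add_apply, LinearMap.add_apply, contr_conv, ← h3, hs, neg_mul, neg_mul, map_neg,
      map_neg, LinearMap.neg_apply, LinearMap.neg_apply, contr_cons, contr_cons, sgn_sig, ht,
      map_mul α, hα]
    simp only [mul_add, mul_neg, map_add, map_neg] at h1 ⊢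
    rw [mul_assoc] at h1
    have h4 := congrArg (· * y) h2
    simp only [add_mul, sub_mul, mul_assoc] at h4
    linear_combination (norm := abel) h4 + h1

theorem alpha_contr (y : TensorAlgebra k A.bar.W) : ∀ a,
    A.alpha.toAlgHom (show A.bar.cobar.carrier from A.contr y a) = 0 := by
  let α : TensorAlgebra k A.bar.W →ₐ[k] A.carrier := A.alpha.toAlgHom
  change ∀ a, α (A.contr y a) = 0
  have hα : ∀ c, α (A.bar.cell c) = A.taut c := A.alpha_cell
  have hr : ∀ c, A.bar.ε (A.red c) = 0 := by
    intro c; rw [red_apply, map_sub, map_smul, A.bar.ε_η]; simp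
  have hp : ∀ a c, A.bar.ε c = 0 → A.taut (A.pre a c) = 0 := by
    intro a c hc
    have e : A.pre a c = A.pre (a - A.ε a • 1) c := by
      rw [map_sub, map_smul, LinearMap.sub_apply, LinearMap.smul_apply, pre_one, smul_zero, sub_zero]
    rw [e, taut_pre _ _ (by simp), hc, zero_smul]
  refine A.bar.cell_induction y ?_ (fun c x h => ?_) (fun x y hx hy => ?_) ?_
  · intro a; simp [contr_one]
  · intro a; rw [map_smul, LinearMap.smul_apply, map_smul, h, smul_zero]
  · intro a; rw [map_add, LinearMap.add_apply, map_add, hx, hy, add_zero]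
  · intro c y h a
    rw [contr_cons, map_add, map_mul, h, sig_apply, map_neg, hα, hp _ _ (hr c)]
    simp

theorem pre_mem {i j : ℤ} {a : A.carrier} (ha : a ∈ deg k _ i) {c : A.bar.carrier}
    (hc : c ∈ deg k _ j) : A.pre a c ∈ deg k A.bar.carrier (i - 1 + j) := by
  have h1 := A.br_deg _ _ ha
  exact mul_mem_deg (k := k) (A := TensorAlgebra k A.V) (by omega) (wordDeg_ι h1) hc

theorem η_mem' : A.bar.η 1 ∈ deg k A.bar.carrier 0 := A.bar.η_mem

theorem red_deg : HasDeg A.red 0 := by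
  intro n c hc
  rw [add_zero]
  exact sub_mem hc (smul_mem_deg A.bar.ε_deg A.η_mem' hc)

theorem sig_mem {i j : ℤ} {a : A.carrier} (ha : a ∈ deg k _ i) {c : A.bar.carrier}
    (hc : c ∈ deg k _ j) : A.sig a c ∈ deg k (TensorAlgebra k A.bar.W) (i + j) := by
  have := A.bar.cell_deg _ _ (A.pre_mem (HasDeg.sgn _ _ ha) (A.red_deg _ _ hc))
  rw [sig_apply]
  refine neg_mem ?_
  convert this using 1
  congr 1
  omega

theorem beta_deg : HasDeg A.beta 0 := by
  intro n a ha
  rw [add_zero]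
  rw [beta_apply]
  refine add_mem ?_ ?_
  · by_cases hn : n = 0
    · subst hn; exact Submodule.smul_mem _ _ (one_mem_deg (k := k))
    · have h0 : A.ε a = 0 := fun_zero A.ε_deg hn ha
      rw [h0, zero_smul]; exact zero_mem _
  have := A.bar.cell_deg _ _ (A.pre_mem ha A.η_mem')
  convert this using 1
  congr 1
  omega

theorem contr_mem {n : ℤ} {y : TensorAlgebra k A.bar.W} (hy : y ∈ deg k _ n) :
    ∀ (p : ℤ) (a : A.carrier), a ∈ deg k _ p →
      A.contr y a ∈ deg k (TensorAlgebra k A.bar.W) (p + n - 1) := by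
  refine word_deg_induction (P := fun n y => ∀ (p : ℤ) (a : A.carrier), a ∈ deg k _ p →
      A.contr y a ∈ deg k (TensorAlgebra k A.bar.W) (p + n - 1)) ?_ ?_ ?_ ?_ ?_ hy
  · intro p a _; rw [contr_one]; exact zero_mem _
  · intro n p a _; rw [map_zero]; exact zero_mem _
  · intro n c x h p a ha
    rw [map_smul]; exact Submodule.smul_mem _ _ (h p a ha)
  · intro n x y hx hy p a ha
    rw [map_add]; exact add_mem (hx p a ha) (hy p a ha)
  · intro i j v hv x hx h p a ha
    obtain ⟨c, hc, rfl⟩ := A.bar.sus_mem hv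
    change A.contr (A.bar.cell c * x) a ∈ _
    rw [contr_cons]
    refine add_mem ?_ ?_
    · exact mul_mem_deg (by omega) (A.sig_mem ha hc) hx
    · have := h _ _ (mul_mem_deg (k := k) rfl ha (A.taut_isTwisting.deg _ _ hc))
      convert this using 1
      congr 1
      omega

/-- The contraction of `ΩBA` onto `A`, with `α⟨c⟩ = t(c)`, `β(a) = ε(a) + ⟨[a - ε(a)]⟩` and the
homotopy `h` with `h(1) = 0 = h⟨c⟩` and
`h(⟨c₁⟩⋯⟨cₙ⟩) = ∑ᵢ sig(t(c₁)⋯t(cᵢ), cᵢ₊₁) ⟨cᵢ₊₂⟩⋯⟨cₙ⟩`. -/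
def cobarBar : TrivExt A.bar.cobar A where
  α := A.alpha
  β := A.beta
  h := A.contr.flip 1
  β_deg := A.beta_deg
  h_deg := by
    intro n y hy
    have := A.contr_mem hy 0 1 (one_mem_deg (k := k))
    change A.contr y 1 ∈ deg k (TensorAlgebra k A.bar.W) (n + -1)
    convert this using 1
    congr 1
    omega
  β_one := by
    change A.beta 1 = (1 : TensorAlgebra k A.bar.W)
    rw [beta_apply, pre_one]
    simp
  β_d a := by
    change A.beta (A.d a) = A.bar.cobarD (A.beta a)
    have h1 := A.cobarD_cell_pre (sgn k _ a) (A.bar.η 1)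
    rw [sgn_sgn, A.d_sgn, map_neg, sgn_sgn, mrg_η, A.bar.d_η] at h1
    rw [beta_apply, beta_apply, A.ε_d, map_add, map_smul, DGC.cobarD_one, h1]
    simp [DGC.conv, A.bar.Δ_η, cell_η']
  α_β a := by
    change A.alpha.toAlgHom (A.beta a) = a
    let α : TensorAlgebra k A.bar.W →ₐ[k] A.carrier := A.alpha.toAlgHom
    change α (A.beta a) = a
    have hα : ∀ c, α (A.bar.cell c) = A.taut c := A.alpha_cell
    have e : A.pre a (A.bar.η 1) = A.pre (a - A.ε a • 1) (A.bar.η 1) := by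
      rw [map_sub, map_smul, LinearMap.sub_apply, LinearMap.smul_apply, pre_one, smul_zero, sub_zero]
    rw [beta_apply, map_add, hα, e, taut_pre _ _ (by simp), A.bar.ε_η]
    simp
  α_h y := A.alpha_contr y 1
  d_h y := by
    have := A.contr_htpy y 1
    rw [A.d_one, map_zero, add_zero, sgn_one, one_mul] at this
    refine this.trans ?_
    have h1 : A.beta 1 = 1 := by rw [beta_apply, pre_one]; simp
    have h2 : ∀ z : TensorAlgebra k A.bar.W, A.beta 1 * z = z := by
      intro z; rw [h1, one_mul]
    exact congrArg (· - _) (h2 y)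
end cobarBar
end DGA

section tensorTE
variable {k : Type u} [CommRing k]

/-- The tensor product of two DGA maps. -/
def DGAHom.tensor {X : DGA.{u, x} k} {A : DGA.{u, v} k} {Y : DGA.{u, y} k}
    {B : DGA.{u, w} k} (f : DGAHom X A) (g : DGAHom Y B) :
    DGAHom (X.tensor Y) (A.tensor B) where
  toAlgHom := AlgHom.ofLinearMap
    (X.tlift Y ((A.tm B).compl₁₂ f.toAlgHom.toLinearMap g.toAlgHom.toLinearMap))
    (by
      rw [← DGA.tm_one, DGA.tlift_tm]
      simp [DGA.tm_one])
    (by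
      intro s t
      refine X.tm_induction Y s (fun a b => ?_) (fun s s' h h' => by simp only [add_mul, map_add, h, h'])
      refine X.tm_induction Y t (fun a' b' => ?_) (fun s s' h h' => by
        simp only [mul_add, map_add, h, h'])
      rw [DGA.tm_mul, map_sub, map_smul]
      simp only [DGA.tlift_tm, LinearMap.compl₁₂_apply, AlgHom.toLinearMap_apply, map_mul, DGA.tm_mul]
      have h1 : ∀ z, f.toAlgHom (odd k _ z) = odd k _ (f.toAlgHom z) := fun z =>
        (odd_even f.map_deg (by simp) z).symm
      have h2 : ∀ z, g.toAlgHom (odd k _ z) = odd k _ (g.toAlgHom z) := fun z =>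
        (odd_even g.map_deg (by simp) z).symm
      rw [h1, h2])
  map_deg := by
    refine X.tm_hasDeg Y ?_
    intro i j a ha b hb
    have h1 := f.map_deg _ _ ha
    have h2 := g.map_deg _ _ hb
    exact DGA.tm_mem _ _ (by omega) h1 h2
  map_d z := by
    refine X.tm_induction Y z (fun a b => ?_) (fun s s' h h' => by simp only [map_add, h, h'])
    have h1 : f.toAlgHom (sgn k _ a) = sgn k _ (f.toAlgHom a) := (sgn_even f.map_deg (by simp) a).symm
    simp only [AlgHom.ofLinearMap_apply, DGA.tm_d, map_add, DGA.tlift_tm, LinearMap.compl₁₂_apply,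
      AlgHom.toLinearMap_apply, f.map_d, g.map_d, h1]
  map_ε z := by
    refine X.tm_induction Y z (fun a b => ?_) (fun s s' h h' => by simp only [map_add, h, h'])
    simp only [AlgHom.ofLinearMap_apply, DGA.tlift_tm, LinearMap.compl₁₂_apply,
      AlgHom.toLinearMap_apply, DGA.tm_ε, f.map_ε, g.map_ε]

theorem DGAHom.tensor_tm {X : DGA.{u, x} k} {A : DGA.{u, v} k} {Y : DGA.{u, y} k}
    {B : DGA.{u, w} k} (f : DGAHom X A)
    (g : DGAHom Y B) (x : X.carrier) (y : Y.carrier) :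
    (f.tensor g).toAlgHom (X.tm Y x y) = A.tm B (f.toAlgHom x) (g.toAlgHom y) := rfl

namespace TrivExt
variable {X : DGA.{u, x} k} {A : DGA.{u, v} k} {Y : DGA.{u, y} k}
    {B : DGA.{u, w} k} (E : TrivExt X A) (F : TrivExt Y B)

/-- The endomorphism `β α`. -/
def βα : X.carrier →ₗ[k] X.carrier := E.β ∘ₗ E.α.toAlgHom.toLinearMap

theorem βα_apply (x : X.carrier) : E.βα x = E.β (E.α.toAlgHom x) := rfl
theorem βα_deg : HasDeg E.βα 0 := E.β_deg.comp E.α.map_deg (add_zero 0)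
theorem βα_sgn (x : X.carrier) : E.βα (sgn k _ x) = sgn k _ (E.βα x) :=
  (sgn_even E.βα_deg (by simp) x).symm
theorem h_sgn (x : X.carrier) : E.h (sgn k _ x) = - sgn k _ (E.h x) := by
  rw [sgn_odd E.h_deg (by decide), neg_neg]
theorem βα_d (x : X.carrier) : E.βα (X.d x) = X.d (E.βα x) := by
  rw [βα_apply, E.α.map_d, E.β_d, βα_apply]
theorem d_h_eq (x : X.carrier) : X.d (E.h x) = x - E.βα x - E.h (X.d x) := by
  rw [eq_sub_iff_add_eq, E.d_h, βα_apply]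

/-- `β ⊗ β` -/
def tensorβ : (A.tensor B).carrier →ₗ[k] (X.tensor Y).carrier :=
  A.tlift B ((X.tm Y).compl₁₂ E.β F.β)

theorem tensorβ_tm (a : A.carrier) (b : B.carrier) :
    E.tensorβ F (A.tm B a b) = X.tm Y (E.β a) (F.β b) := rfl

theorem tensorβ_deg : HasDeg (E.tensorβ F) 0 := by
  refine A.tm_hasDeg B ?_
  intro i j a ha b hb
  have h1 := E.β_deg _ _ ha
  have h2 := F.β_deg _ _ hb
  exact DGA.tm_mem _ _ (by omega) h1 h2

theorem tensorβ_one : E.tensorβ F 1 = 1 := by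
  rw [← DGA.tm_one, tensorβ_tm, E.β_one, F.β_one, DGA.tm_one]

theorem tensorβ_d (z : (A.tensor B).carrier) :
    E.tensorβ F ((A.tensor B).d z) = (X.tensor Y).d (E.tensorβ F z) := by
  refine A.tm_induction B z (fun a b => ?_) (fun s s' h h' => by simp only [map_add, h, h'])
  have h1 : E.β (sgn k _ a) = sgn k _ (E.β a) := (sgn_even E.β_deg (by simp) a).symm
  simp only [DGA.tm_d, map_add, tensorβ_tm, E.β_d, F.β_d, h1]

theorem tensor_α_β (z : (A.tensor B).carrier) :
    (E.α.tensor F.α).toAlgHom (E.tensorβ F z) = z := by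
  refine A.tm_induction B z (fun a b => ?_) (fun s s' h h' => by simp only [map_add, h, h'])
  rw [tensorβ_tm, DGAHom.tensor_tm, E.α_β, F.α_β]

/-- `h ⊗ 1 + β α ⊗ h` -/
def tensorh : (X.tensor Y).carrier →ₗ[k] (X.tensor Y).carrier :=
  X.tlift Y ((X.tm Y).compl₁₂ E.h LinearMap.id + (X.tm Y).compl₁₂ (E.βα ∘ₗ sgn k _) F.h)

theorem tensorh_tm (x : X.carrier) (y : Y.carrier) : E.tensorh F (X.tm Y x y) =
    X.tm Y (E.h x) y + X.tm Y (E.βα (sgn k _ x)) (F.h y) := rfl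

/-- `h ⊗ β α + 1 ⊗ h` -/
def tensorh' : (X.tensor Y).carrier →ₗ[k] (X.tensor Y).carrier :=
  X.tlift Y ((X.tm Y).compl₁₂ E.h F.βα + (X.tm Y).compl₁₂ (sgn k _) F.h)

theorem tensorh'_tm (x : X.carrier) (y : Y.carrier) : E.tensorh' F (X.tm Y x y) =
    X.tm Y (E.h x) (F.βα y) + X.tm Y (sgn k _ x) (F.h y) := rfl

/-- The tensor product of trivialized extensions, with `β = β₁ ⊗ β₂` and the homotopy
`h₁ ⊗ 1 + β₁ α₁ ⊗ h₂`. -/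
def tensor : TrivExt (X.tensor Y) (A.tensor B) where
  α := E.α.tensor F.α
  β := E.tensorβ F
  h := E.tensorh F
  β_deg := E.tensorβ_deg F
  h_deg := by
    refine X.tm_hasDeg Y ?_
    intro i j x hx y hy
    rw [tensorh_tm]
    exact add_mem (DGA.tm_mem _ _ (by omega) (E.h_deg _ _ hx) hy)
      (DGA.tm_mem _ _ (by omega) (E.βα_deg _ _ (HasDeg.sgn _ _ hx)) (F.h_deg _ _ hy))
  β_one := E.tensorβ_one F
  β_d := E.tensorβ_d F
  α_β := E.tensor_α_β F
  α_h z := by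
    refine X.tm_induction Y z (fun x y => ?_) (fun s s' h h' => by
      simp only [map_add, h, h', add_zero])
    rw [tensorh_tm, map_add, DGAHom.tensor_tm, DGAHom.tensor_tm, E.α_h, F.α_h]
    simp
  d_h z := by
    refine X.tm_induction Y z (fun x y => ?_) (fun s s' h h' => by
      simp only [map_add]; linear_combination (norm := abel) h + h')
    rw [DGAHom.tensor_tm, tensorβ_tm, ← βα_apply, ← βα_apply]
    simp only [DGA.tm_d, map_add, tensorh_tm, E.d_h_eq, F.d_h_eq, E.βα_sgn, E.h_sgn, sgn_sgn,
      X.d_sgn, ← E.βα_d, map_sub, map_neg, LinearMap.sub_apply, LinearMap.neg_apply]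
    abel

/-- The tensor product of trivialized extensions, with `β = β₁ ⊗ β₂` and the homotopy
`h₁ ⊗ β₂ α₂ + 1 ⊗ h₂`. -/
def tensor' : TrivExt (X.tensor Y) (A.tensor B) where
  α := E.α.tensor F.α
  β := E.tensorβ F
  h := E.tensorh' F
  β_deg := E.tensorβ_deg F
  h_deg := by
    refine X.tm_hasDeg Y ?_
    intro i j x hx y hy
    rw [tensorh'_tm]
    exact add_mem (DGA.tm_mem _ _ (by omega) (E.h_deg _ _ hx) (F.βα_deg _ _ hy))
      (DGA.tm_mem _ _ (by omega) (HasDeg.sgn _ _ hx) (F.h_deg _ _ hy))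
  β_one := E.tensorβ_one F
  β_d := E.tensorβ_d F
  α_β := E.tensor_α_β F
  α_h z := by
    refine X.tm_induction Y z (fun x y => ?_) (fun s s' h h' => by
      simp only [map_add, h, h', add_zero])
    rw [tensorh'_tm, map_add, DGAHom.tensor_tm, DGAHom.tensor_tm, E.α_h, F.α_h]
    simp
  d_h z := by
    refine X.tm_induction Y z (fun x y => ?_) (fun s s' h h' => by
      simp only [map_add]; linear_combination (norm := abel) h + h')
    rw [DGAHom.tensor_tm, tensorβ_tm, ← βα_apply, ← βα_apply]
    simp only [DGA.tm_d, map_add, tensorh'_tm, E.d_h_eq, F.d_h_eq, E.h_sgn, sgn_sgn,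
      X.d_sgn, ← F.βα_d, map_sub, map_neg, LinearMap.sub_apply, LinearMap.neg_apply]
    abel
end TrivExt

/-- The map determined by a trivialized extension is a map over `A`. -/
theorem TrivExt.α_lift {X : DGA.{u, x} k} {A : DGA.{u, v} k} (E : TrivExt X A)
    (z : A.bar.cobar.carrier) : E.α.toAlgHom (E.lift.toAlgHom z) = A.alpha.toAlgHom z := by
  have h : ∀ c, E.α.toAlgHom (E.lift.toAlgHom (A.bar.taut c)) = A.alpha.toAlgHom (A.bar.taut c) := by
    intro c
    have h1 : E.lift.toAlgHom (A.bar.taut c) = E.tilde c :=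
      DGC.IsTwisting.hom_taut A.bar (DGA.tilde_isTwisting E) c
    have h2 : A.alpha.toAlgHom (A.bar.taut c) = A.taut c :=
      DGC.IsTwisting.hom_taut A.bar A.taut_isTwisting c
    rw [h1, h2]
    exact LinearMap.congr_fun (DGA.α_tilde E) c
  refine A.bar.cell_induction z ?_ (fun c x h => ?_) (fun x y hx hy => ?_) ?_
  · exact (congrArg _ (map_one E.lift.toAlgHom)).trans
      ((map_one E.α.toAlgHom).trans (map_one A.alpha.toAlgHom).symm)
  · exact (congrArg _ (map_smul E.lift.toAlgHom c x)).trans ((map_smul E.α.toAlgHom c _).trans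
      ((congrArg (c • ·) h).trans (map_smul A.alpha.toAlgHom c x).symm))
  · exact (congrArg _ (map_add E.lift.toAlgHom x y)).trans ((map_add E.α.toAlgHom _ _).trans
      ((congrArg₂ (· + ·) hx hy).trans (map_add A.alpha.toAlgHom x y).symm))
  · intro c x hx
    exact (congrArg _ (map_mul E.lift.toAlgHom (A.bar.taut c) x)).trans
      ((map_mul E.α.toAlgHom _ _).trans ((congrArg₂ (· * ·) (h c) hx).trans
        (map_mul A.alpha.toAlgHom (A.bar.taut c) x).symm))

end tensorTE

namespace DGA
variable {k : Type u} [CommRing k] (A : DGA.{u, v} k) (B : DGA.{u, w} k)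

/-- The map `ψ : ΩB(A ⊗ B) → ΩBA ⊗ ΩBB` over `A ⊗ B` determined by the tensor product of the
trivialized extensions `ΩBA → A` and `ΩBB → B`, with the homotopy `h₁ ⊗ 1 + β₁ α₁ ⊗ h₂`. -/
def psi : DGAHom (A.tensor B).bar.cobar (A.bar.cobar.tensor B.bar.cobar) :=
  (A.cobarBar.tensor B.cobarBar).lift

/-- The map `ψ : ΩB(A ⊗ B) → ΩBA ⊗ ΩBB` obtained from the other usual choice of a homotopy on the
tensor product, `h₁ ⊗ β₂ α₂ + 1 ⊗ h₂`. -/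
def psi' : DGAHom (A.tensor B).bar.cobar (A.bar.cobar.tensor B.bar.cobar) :=
  (A.cobarBar.tensor' B.cobarBar).lift

/-- `ψ` is a map over `A ⊗ B`. -/
theorem alpha_psi (x : (A.tensor B).bar.cobar.carrier) :
    (A.alpha.tensor B.alpha).toAlgHom ((A.psi B).toAlgHom x) = (A.tensor B).alpha.toAlgHom x :=
  TrivExt.α_lift (A.cobarBar.tensor B.cobarBar) x
theorem alpha_psi' (x : (A.tensor B).bar.cobar.carrier) :
    (A.alpha.tensor B.alpha).toAlgHom ((A.psi' B).toAlgHom x) = (A.tensor B).alpha.toAlgHom x :=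
  TrivExt.α_lift (A.cobarBar.tensor' B.cobarBar) x
end DGA

end

/-!
The maps `γ` and `ψ ∘ Ω∇` are DGA maps out of the cobar construction of `C = BA₁ ⊗ BA₂`, so it
suffices to compare the twisting cochains `g : c ⊗ c' ↦ ε(c') ⟨c⟩ ⊗ 1 + ε(c) 1 ⊗ ⟨c'⟩` and `τ ∘ ∇`
on `C` (`DGC.cobar_hom_ext`).

As `∇` is a map of coalgebras, `f = τ ∘ ∇` solves the equation `f = β t ∇ + h (f ∪ f)`. The coalgebra
`C` is conilpotent, with the total word length as weight, so a solution that vanishes on the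
coaugmentation is unique (`DGC.IsWeight.eq_of_fixed`). It remains to see that `g` is a solution too.
This needs no computation of `g ∪ g`. The map `g` is a twisting cochain, it satisfies
`(α₁ ⊗ α₂) g = t ∇` (`DGA.alpha_gammaT`), as `t` sees only the words of length one in a shuffle, and
either homotopy `h` annihilates `g` (`DGA.tensorh_gammaT`, `DGA.tensorh'_gammaT`), as
`hᵢ(1) = 0 = hᵢ⟨c⟩`. Hence
`h (g ∪ g) = h (d g + g d) = h d g = g - β α g - d h g = g - β t ∇`
(`TrivExt.eq_tilde_comp`).
-/

noncomputable section
open GrMod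

/-! ### Conilpotent weights on a coalgebra -/
namespace GrMod
variable {k : Type u} [CommRing k] {V : Type v} [AddCommGroup V] [Module k V]
  {W : Type w} [AddCommGroup W] [Module k W]

/-- The part of total weight `n` of a tensor product, for families `F` and `G` of submodules
indexed by weights. -/
def tensorWeight (F : ℕ → Submodule k V) (G : ℕ → Submodule k W) (n : ℕ) :
    Submodule k (V ⊗[k] W) :=
  Submodule.span k {t | ∃ i j, i + j = n ∧ ∃ x ∈ F i, ∃ y ∈ G j, t = x ⊗ₜ y}

variable {F : ℕ → Submodule k V} {G : ℕ → Submodule k W}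

theorem tmul_mem_tensorWeight {i j n : ℕ} (h : i + j = n) {x : V} {y : W} (hx : x ∈ F i)
    (hy : y ∈ G j) : x ⊗ₜ[k] y ∈ tensorWeight F G n :=
  Submodule.subset_span ⟨i, j, h, x, hx, y, hy, rfl⟩

theorem map_mem_of_mem_tensorWeight {M : Type*} [AddCommGroup M] [Module k M] {n : ℕ}
    (f : V ⊗[k] W →ₗ[k] M) (N : Submodule k M)
    (h : ∀ i j, i + j = n → ∀ x ∈ F i, ∀ y ∈ G j, f (x ⊗ₜ y) ∈ N)
    {t : V ⊗[k] W} (ht : t ∈ tensorWeight F G n) : f t ∈ N := by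
  have hle : tensorWeight F G n ≤ N.comap f := by
    refine Submodule.span_le.mpr ?_
    rintro _ ⟨i, j, hij, x, hx, y, hy, rfl⟩
    exact h i j hij x hx y hy
  exact hle ht

theorem iSup_tensorWeight (hF : ⨆ n, F n = ⊤) (hG : ⨆ n, G n = ⊤) :
    ⨆ n, tensorWeight F G n = ⊤ := by
  rw [eq_top_iff, ← TensorProduct.span_tmul_eq_top, Submodule.span_le]
  rintro _ ⟨x, y, rfl⟩
  have h1 : ∀ i, ∀ x ∈ F i, ∀ y : W, x ⊗ₜ[k] y ∈ ⨆ n, tensorWeight F G n := by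
    intro i x hx y
    refine Submodule.iSup_induction G (motive := fun y => x ⊗ₜ[k] y ∈ ⨆ n, tensorWeight F G n)
      (hG ▸ Submodule.mem_top : y ∈ ⨆ n, G n) ?_ (by simp) ?_
    · intro j y hy
      exact Submodule.mem_iSup_of_mem (i + j) (tmul_mem_tensorWeight rfl hx hy)
    · intro y y' hy hy'; rw [TensorProduct.tmul_add]; exact add_mem hy hy'
  refine Submodule.iSup_induction F (motive := fun x => x ⊗ₜ[k] y ∈ ⨆ n, tensorWeight F G n)
    (hF ▸ Submodule.mem_top : x ∈ ⨆ n, F n) (fun i x hx => h1 i x hx y) (by simp) ?_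
  intro x x' hx hx'; rw [TensorProduct.add_tmul]; exact add_mem hx hx'

theorem mid_mem_tensorWeight [GrMod k V] [GrMod k W]
    (hF : ∀ n, ∀ x ∈ F n, odd k V x ∈ F n) (hG : ∀ n, ∀ y ∈ G n, odd k W y ∈ G n)
    {m n : ℕ} {s : V ⊗[k] V} {t : W ⊗[k] W} (hs : s ∈ tensorWeight F F m)
    (ht : t ∈ tensorWeight G G n) :
    mid k V V W W (s ⊗ₜ t) ∈
      tensorWeight (tensorWeight F G) (tensorWeight F G) (m + n) := by
  refine map_mem_of_mem_tensorWeight (mid k V V W W ∘ₗ (TensorProduct.mk k _ _).flip t) _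
    ?_ hs
  intro i j hij x hx x' hx'
  refine map_mem_of_mem_tensorWeight (mid k V V W W ∘ₗ TensorProduct.mk k _ _ (x ⊗ₜ x')) _
    ?_ ht
  intro p q hpq y hy y' hy'
  simp only [LinearMap.comp_apply, TensorProduct.mk_apply, mid_tmul]
  refine sub_mem ?_ (Submodule.smul_mem _ _ ?_)
  · exact tmul_mem_tensorWeight (i := i + p) (j := j + q) (by omega)
      (tmul_mem_tensorWeight rfl hx hy) (tmul_mem_tensorWeight rfl hx' hy')
  · exact tmul_mem_tensorWeight (i := i + p) (j := j + q) (by omega)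
      (tmul_mem_tensorWeight rfl hx (hG _ _ hy)) (tmul_mem_tensorWeight rfl (hF _ _ hx') hy')
end GrMod

namespace DGC
variable {k : Type u} [CommRing k]

/-- A family of submodules that makes a coaugmented coalgebra conilpotent: they span the coalgebra,
the diagonal is additive on weights, and weight zero is concentrated in the image of the
coaugmentation. Stability under the projection to odd degrees stands in for a compatibility with
the grading and makes the notion pass to tensor products with Koszul signs. -/
structure IsWeight (C : DGC.{u, v} k) (F : ℕ → Submodule k C.carrier) : Prop where
  odd_mem : ∀ n, ∀ x ∈ F n, odd k C.carrier x ∈ F n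
  zero_le : F 0 ≤ LinearMap.range C.η
  Δ_mem : ∀ n, ∀ x ∈ F n, C.Δ x ∈ tensorWeight F F n
  iSup_eq : ⨆ n, F n = ⊤

theorem IsWeight.tensor {C : DGC.{u, v} k} {D : DGC.{u, w} k} {F : ℕ → Submodule k C.carrier}
    {G : ℕ → Submodule k D.carrier} (hF : C.IsWeight F) (hG : D.IsWeight G) :
    (C.tensor D).IsWeight (tensorWeight F G) where
  odd_mem n t ht := by
    refine map_mem_of_mem_tensorWeight (odd k (C.carrier ⊗[k] D.carrier)) _ ?_ ht
    intro i j hij x hx y hy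
    rw [odd_tmul]
    have hx' := hF.odd_mem i x hx
    have hy' := hG.odd_mem j y hy
    exact sub_mem (add_mem (tmul_mem_tensorWeight hij hx' hy) (tmul_mem_tensorWeight hij hx hy'))
      (tmul_mem_tensorWeight hij (Submodule.smul_mem _ _ hx') hy')
  zero_le t ht := by
    refine map_mem_of_mem_tensorWeight (LinearMap.id : C.carrier ⊗[k] D.carrier →ₗ[k] _)
      (LinearMap.range (C.tensor D).η) ?_ ht
    intro i j hij x hx y hy
    obtain ⟨rfl, rfl⟩ : i = 0 ∧ j = 0 := by omega
    obtain ⟨a, rfl⟩ := hF.zero_le hx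
    obtain ⟨b, rfl⟩ := hG.zero_le hy
    refine ⟨a * b, ?_⟩
    change (a * b) • (C.η 1 ⊗ₜ[k] D.η 1) = C.η a ⊗ₜ D.η b
    rw [← TensorProduct.smul_tmul_smul, ← map_smul, ← map_smul, smul_eq_mul, smul_eq_mul, mul_one,
      mul_one]
  Δ_mem n t ht := by
    refine map_mem_of_mem_tensorWeight (tensorΔ C D) _ ?_ ht
    intro i j hij x hx y hy
    rw [tensorΔ_tmul, ← hij]
    exact mid_mem_tensorWeight hF.odd_mem hG.odd_mem (hF.Δ_mem i x hx) (hG.Δ_mem j y hy)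
  iSup_eq := iSup_tensorWeight hF.iSup_eq hG.iSup_eq

/-- On a conilpotent coalgebra, the equation `f = φ + h (f ∪ f)` has at most one solution that
vanishes on the coaugmentation: as the terms with a factor of weight zero drop out, `f ∪ f` in
weight `n` involves the values of `f` in smaller weights only. -/
theorem IsWeight.eq_of_fixed {C : DGC.{u, v} k} {F : ℕ → Submodule k C.carrier} (hF : C.IsWeight F)
    {X : DGA.{u, w} k} {f g φ : C.carrier →ₗ[k] X.carrier} {h : X.carrier →ₗ[k] X.carrier}
    (f_deg : HasDeg f 1) (g_deg : HasDeg g 1)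
    (f_η : f (C.η 1) = 0) (g_η : g (C.η 1) = 0)
    (hf : f = φ + h ∘ₗ conv (f ∘ₗ sgn k _) f) (hg : g = φ + h ∘ₗ conv (g ∘ₗ sgn k _) g) :
    f = g := by
  have vanish : ∀ f : C.carrier →ₗ[k] X.carrier, f (C.η 1) = 0 → ∀ x ∈ F 0, f x = 0 := by
    intro f f_η x hx
    obtain ⟨c, rfl⟩ := hF.zero_le hx
    have : C.η c = c • C.η 1 := by rw [← map_smul, smul_eq_mul, mul_one]
    rw [this, map_smul, f_η, smul_zero]
  -- Moving the sign from the source to the target leaves only the values of `f` and `g`.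
  have move : ∀ f : C.carrier →ₗ[k] X.carrier, HasDeg f 1 →
      f ∘ₗ sgn k _ = - (sgn k _ ∘ₗ f) := by
    intro f hf
    ext c
    simp [sgn_odd hf (by decide)]
  have key : ∀ n, ∀ x ∈ F n, f x = g x := by
    intro n
    induction n using Nat.strong_induction_on with
    | _ n ih =>
    intro x hx
    have hc : conv (f ∘ₗ sgn k _) f x = conv (g ∘ₗ sgn k _) g x := by
      rw [move f f_deg, move g g_deg]
      rw [← sub_eq_zero]
      refine (Submodule.mem_bot k).mp (map_mem_of_mem_tensorWeight
        (LinearMap.mul' k _ ∘ₗ TensorProduct.map (- (sgn k _ ∘ₗ f)) f -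
          LinearMap.mul' k _ ∘ₗ TensorProduct.map (- (sgn k _ ∘ₗ g)) g) ⊥ ?_ (hF.Δ_mem n x hx))
      intro i j hij a ha b hb
      rw [Submodule.mem_bot]
      simp only [LinearMap.sub_apply, LinearMap.comp_apply, TensorProduct.map_tmul,
        LinearMap.mul'_apply, LinearMap.neg_apply]
      rcases Nat.eq_zero_or_pos i with rfl | hi
      · rw [vanish f f_η a ha, vanish g g_η a ha]; simp
      rcases Nat.eq_zero_or_pos j with rfl | hj
      · rw [vanish f f_η b hb, vanish g g_η b hb]; simp
      rw [ih i (by omega) a ha, ih j (by omega) b hb, sub_self]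
    rw [hf, hg]
    simp only [LinearMap.add_apply, LinearMap.comp_apply, hc]
  ext c
  refine Submodule.iSup_induction F (motive := fun c => f c = g c)
    (hF.iSup_eq ▸ Submodule.mem_top : c ∈ ⨆ n, F n) key (by simp) ?_
  intro x y hx hy
  rw [map_add, map_add, hx, hy]

/-- DGA maps out of the cobar construction agree if they agree on the generators `⟨c⟩`. -/
theorem cobar_hom_ext {C : DGC.{u, v} k} {X : DGA.{u, w} k} {f g : DGAHom C.cobar X}
    (h : ∀ c, f.toAlgHom (C.taut c) = g.toAlgHom (C.taut c)) : f = g := by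
  refine DGAHom.ext ?_
  refine TensorAlgebra.hom_ext (R := k) (M := C.W) (A := X.carrier) (LinearMap.ext fun v => ?_)
  obtain ⟨c, rfl⟩ := C.sus_surj v
  exact h c
end DGC

/-! ### Word length on the bar construction -/
namespace TC
variable {k : Type u} [CommRing k] {V : Type v} [AddCommGroup V] [Module k V]

variable (k V) in
/-- The span of the words of length `n`. -/
abbrev words (n : ℕ) : Submodule k (TensorAlgebra k V) :=
  LinearMap.range (TensorAlgebra.ι k : V →ₗ[k] TensorAlgebra k V) ^ n

theorem ι_mul_mem_words (v : V) {n : ℕ} {x : TensorAlgebra k V} (hx : x ∈ words k V n) :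
    TensorAlgebra.ι k v * x ∈ words k V (n + 1) := by
  rw [words, pow_succ']
  exact Submodule.mul_mem_mul ⟨v, rfl⟩ hx

/-- A linear map whose values on words lie in prescribed submodules. -/
theorem map_mem_of_mem_words {M : Type*} [AddCommGroup M] [Module k M]
    (f : TensorAlgebra k V →ₗ[k] M) (N : ℕ → Submodule k M) (one : f 1 ∈ N 0)
    (cons : ∀ n v, ∀ x ∈ words k V n, f x ∈ N n → f (TensorAlgebra.ι k v * x) ∈ N (n + 1))
    (n : ℕ) : ∀ x ∈ words k V n, f x ∈ N n := by
  induction n with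
  | zero =>
    intro x hx
    rw [words, pow_zero, Submodule.one_eq_span, Submodule.mem_span_singleton] at hx
    obtain ⟨c, rfl⟩ := hx
    rw [map_smul]; exact Submodule.smul_mem _ _ one
  | succ n ih =>
    intro x hx
    rw [words, pow_succ'] at hx
    refine Submodule.mul_induction_on hx ?_ (fun x y hx hy => by
      rw [map_add]; exact add_mem hx hy)
    rintro _ ⟨v, rfl⟩ y hy
    exact cons n v y hy (ih y hy)

theorem words_zero : words k V 0 = Submodule.span k {1} := by
  rw [words, pow_zero, Submodule.one_eq_span]

theorem one_mem_words : (1 : TensorAlgebra k V) ∈ words k V 0 :=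
  words_zero (k := k) (V := V) ▸ Submodule.mem_span_singleton_self 1

theorem odd_mem_words [GrMod k V] (n : ℕ) :
    ∀ x ∈ words k V n, odd k (TensorAlgebra k V) x ∈ words k V n := by
  refine map_mem_of_mem_words (odd k (TensorAlgebra k V)) (words k V) ?_ ?_ n
  · rw [GrMod.odd_one]; exact zero_mem _
  · intro n v x hx h
    have hv : odd k _ (TensorAlgebra.ι k v) = TensorAlgebra.ι k (odd k V v) :=
      odd_even hasDeg_ι (by simp) v
    rw [GrMod.odd_mul, hv]
    exact sub_mem (add_mem (ι_mul_mem_words _ hx) (ι_mul_mem_words _ h))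
      (Submodule.smul_mem _ _ (ι_mul_mem_words _ h))

theorem decon_mem_words (n : ℕ) :
    ∀ x ∈ words k V n, decon k V x ∈ tensorWeight (words k V) (words k V) n := by
  refine map_mem_of_mem_words (decon k V) (tensorWeight (words k V) (words k V)) ?_ ?_ n
  · rw [decon_one]; exact tmul_mem_tensorWeight (add_zero 0) one_mem_words one_mem_words
  · intro n v x hx h
    rw [decon_cons]
    refine add_mem (tmul_mem_tensorWeight (zero_add _) one_mem_words (ι_mul_mem_words v hx)) ?_
    refine map_mem_of_mem_tensorWeight (lmul v) _ ?_ h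
    intro i j hij a ha b hb
    rw [lmul_tmul]
    exact tmul_mem_tensorWeight (by omega) (ι_mul_mem_words v ha) hb

theorem iSup_words : ⨆ n, words k V n = ⊤ := by
  rw [eq_top_iff]
  intro x _
  refine word_induction (P := fun x => x ∈ ⨆ n, words k V n) x
    (Submodule.mem_iSup_of_mem 0 one_mem_words)
    (fun c x hx => Submodule.smul_mem _ c hx) (fun x y hx hy => add_mem hx hy) ?_
  intro v x hx
  refine Submodule.iSup_induction _
    (motive := fun x => TensorAlgebra.ι k v * x ∈ ⨆ n, words k V n) hx ?_ (by simp) ?_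
  · intro n x hx
    exact Submodule.mem_iSup_of_mem (n + 1) (ι_mul_mem_words v hx)
  · intro x y hx hy; rw [mul_add]; exact add_mem hx hy

theorem isWeight_words [GrMod k V] {d₁ : V →ₗ[k] V} {m : V →ₗ[k] V →ₗ[k] V} (H : IsBar d₁ m) :
    (dgc H).IsWeight (words k V) where
  odd_mem := odd_mem_words
  zero_le x hx := Submodule.mem_span_singleton.mp
    ((words_zero (k := k) (V := V)).le hx : x ∈ Submodule.span k {(1 : TensorAlgebra k V)})
  Δ_mem := decon_mem_words
  iSup_eq := iSup_words

/-- The component in words of length one of a map given by a letter recursion. -/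
theorem IsRec.letter {C : DGC.{u, w} k} {f : C.carrier →ₗ[k] V}
    {F : C.carrier →ₗ[k] TensorAlgebra k V} (hF : IsRec C f F)
    (hε : ∀ c, counit k V (F c) = C.ε c) (c : C.carrier) : letter k V (F c) = f c := by
  rw [hF c, map_add, map_smul, letter_one, smul_zero, zero_add]
  refine Eq.trans ?_ (C.counit_lift_right f c)
  simp only [fold, LinearMap.comp_apply]
  generalize C.Δ c = t
  induction t with
  | zero => simp
  | add s t hs ht => simp only [map_add, hs, ht]
  | tmul a b => simp [hε]
end TC

/-! ### Recognizing a lifted twisting cochain -/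
namespace TrivExt
variable {k : Type u} [CommRing k] {X : DGA.{u, w} k} {A : DGA.{u, v} k}

/-- A twisting cochain `t` that covers the tautological one along a coalgebra map `G` and is
annihilated by the homotopy is the pullback of the canonical solution `τ`. It solves the same
equation, as `h (t ∪ t) = h (d t + t d) = h d t = t - β α t`. -/
theorem eq_tilde_comp (E : TrivExt X A) {C : DGC.{u, x} k} {F : ℕ → Submodule k C.carrier}
    (hF : C.IsWeight F) (G : DGCHom C A.bar) {t : C.carrier →ₗ[k] X.carrier}
    (ht : C.IsTwisting X t) (hα : ∀ c, E.α.toAlgHom (t c) = A.taut (G.toLin c))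
    (hh : ∀ c, E.h (t c) = 0) : t = E.tilde ∘ₗ G.toLin := by
  refine hF.eq_of_fixed (φ := E.β ∘ₗ A.taut ∘ₗ G.toLin) (h := E.h) ht.deg
    ((DGA.tilde_deg E).comp G.map_deg (zero_add 1)) ht.η ?_ ?_ ?_
  · rw [LinearMap.comp_apply, G.map_η]
    exact (DGA.tilde_isTwisting E).η
  · ext c
    have h := E.d_h (t c)
    rw [hh, map_zero, zero_add, hα] at h
    simp only [LinearMap.add_apply, LinearMap.comp_apply]
    rw [← ht.tw c, map_add, hh, add_zero, h]
    abel
  · ext c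
    have h := LinearMap.congr_fun (DGA.tilde_eq E) (G.toLin c)
    simp only [LinearMap.add_apply, LinearMap.comp_apply] at h ⊢
    rw [h]
    congr 2
    simp only [DGC.conv, LinearMap.comp_apply, G.map_Δ]
    generalize C.Δ c = s
    induction s with
    | zero => simp
    | add s t hs ht => simp only [map_add, hs, ht]
    | tmul p q => simp [sgn_even G.map_deg]

theorem hom_eq_lift_comp (E : TrivExt X A) {C : DGC.{u, x} k} {F : ℕ → Submodule k C.carrier}
    (hF : C.IsWeight F) (G : DGCHom C A.bar) {t : C.carrier →ₗ[k] X.carrier}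
    (ht : C.IsTwisting X t) (hα : ∀ c, E.α.toAlgHom (t c) = A.taut (G.toLin c))
    (hh : ∀ c, E.h (t c) = 0) : ht.hom = E.lift.comp G.cobarMap := by
  refine DGC.cobar_hom_ext fun c => ?_
  have h1 : G.cobarMap.toAlgHom (C.taut c) = A.bar.taut (G.toLin c) :=
    DGC.IsTwisting.hom_taut C _ c
  have h2 : E.lift.toAlgHom (A.bar.taut (G.toLin c)) = E.tilde (G.toLin c) :=
    DGC.IsTwisting.hom_taut A.bar (DGA.tilde_isTwisting E) _
  change _ = E.lift.toAlgHom (G.cobarMap.toAlgHom (C.taut c))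
  rw [h1, h2, DGC.IsTwisting.hom_taut]
  exact LinearMap.congr_fun (E.eq_tilde_comp hF G ht hα hh) c
end TrivExt

/-! ### The twisting cochain of `γ` and the shuffle map -/
namespace DGA
variable {k : Type u} [CommRing k] (A : DGA.{u, v} k) (B : DGA.{u, w} k)

theorem isWeight_bar : A.bar.IsWeight (TC.words k A.V) := TC.isWeight_words A.isBar

theorem taut_nabla (x : A.bar.carrier) (y : B.bar.carrier) :
    (A.tensor B).taut ((A.nabla B).toLin (A.bar.tp B.bar x y)) =
      B.bar.ε y • A.tm B (A.taut x) 1 + A.bar.ε x • A.tm B 1 (B.taut y) := by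
  have h : TC.letter k (A.tensor B).V ((A.nabla B).toLin (A.bar.tp B.bar x y)) =
      B.bar.ε y • A.inl B (TC.letter k A.V x) + A.bar.ε x • A.inr B (TC.letter k B.V y) :=
    ((TC.shuffle_isRec (i₁ := A.inl B) (i₂ := A.inr B) A.isBar B.isBar).letter
      (A.nabla B).map_ε _).trans (TC.letters_tmul _ _ _ _)
  refine (congrArg (A.tensor B).unbr h).trans ?_
  rw [map_add, map_smul, map_smul, unbr_inl, unbr_inr]
  rfl

/-- The twisting cochain of `γ` lies over the map `BA ⊗ BB → A ⊗ B` obtained from the shuffle map. -/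
theorem alpha_gammaT (c : (A.bar.tensor B.bar).carrier) :
    (A.alpha.tensor B.alpha).toAlgHom (A.bar.gammaT B.bar c) =
      (A.tensor B).taut ((A.nabla B).toLin c) := by
  have h : (A.alpha.tensor B.alpha).toAlgHom.toLinearMap ∘ₗ A.bar.gammaT B.bar =
      (A.tensor B).taut ∘ₗ (A.nabla B).toLin := by
    refine A.bar.tp_ext B.bar fun x y => ?_
    have h1 : A.alpha.toAlgHom (A.bar.taut x) = A.taut x := A.alpha_cell x
    have h2 : B.alpha.toAlgHom (B.bar.taut y) = B.taut y := B.alpha_cell y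
    rw [LinearMap.comp_apply, LinearMap.comp_apply, taut_nabla, DGC.gammaT_tmul,
      AlgHom.toLinearMap_apply, map_add, map_smul, map_smul, DGC.tautl_apply, DGC.tautr_apply,
      DGAHom.tensor_tm, DGAHom.tensor_tm, h1, h2, map_one A.alpha.toAlgHom,
      map_one B.alpha.toAlgHom]
  exact LinearMap.congr_fun h c

theorem cobarBar_h_one : A.cobarBar.h 1 = 0 := LinearMap.congr_fun A.contr_one 1

theorem cobarBar_h_taut (c : A.bar.carrier) : A.cobarBar.h (A.bar.taut c) = 0 := by
  change A.contr (A.bar.cell c) 1 = 0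
  have h := A.contr_cons c 1 1
  rw [mul_one, contr_one, mul_one, LinearMap.zero_apply, add_zero, sig_apply, sgn_one, pre_one,
    map_zero, neg_zero] at h
  exact h

theorem tensorh_gammaT (c : (A.bar.tensor B.bar).carrier) :
    A.cobarBar.tensorh B.cobarBar (A.bar.gammaT B.bar c) = 0 := by
  have h : A.cobarBar.tensorh B.cobarBar ∘ₗ A.bar.gammaT B.bar = 0 := by
    refine A.bar.tp_ext B.bar fun x y => ?_
    rw [LinearMap.comp_apply, DGC.gammaT_tmul, map_add, map_smul, map_smul, DGC.tautl_apply,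
      DGC.tautr_apply, TrivExt.tensorh_tm, TrivExt.tensorh_tm, cobarBar_h_one, cobarBar_h_one,
      cobarBar_h_taut, cobarBar_h_taut]
    simp
  exact LinearMap.congr_fun h c

theorem tensorh'_gammaT (c : (A.bar.tensor B.bar).carrier) :
    A.cobarBar.tensorh' B.cobarBar (A.bar.gammaT B.bar c) = 0 := by
  have h : A.cobarBar.tensorh' B.cobarBar ∘ₗ A.bar.gammaT B.bar = 0 := by
    refine A.bar.tp_ext B.bar fun x y => ?_
    rw [LinearMap.comp_apply, DGC.gammaT_tmul, map_add, map_smul, map_smul, DGC.tautl_apply,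
      DGC.tautr_apply, TrivExt.tensorh'_tm, TrivExt.tensorh'_tm, cobarBar_h_one, cobarBar_h_one,
      cobarBar_h_taut, cobarBar_h_taut]
    simp
  exact LinearMap.congr_fun h c
end DGA

end

theorem mainTheorem2 {k : Type u} [CommRing k] (A₁ : DGA.{u, v} k) (A₂ : DGA.{u, w} k) :
    DGC.gamma A₁.bar A₂.bar = (A₁.psi A₂).comp (A₁.nabla A₂).cobarMap ∧
    DGC.gamma A₁.bar A₂.bar = (A₁.psi' A₂).comp (A₁.nabla A₂).cobarMap := by
  have hF := A₁.isWeight_bar.tensor A₂.isWeight_bar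
  have ht := A₁.bar.gammaT_isTwisting A₂.bar
  exact ⟨(A₁.cobarBar.tensor A₂.cobarBar).hom_eq_lift_comp hF (A₁.nabla A₂) ht
      (A₁.alpha_gammaT A₂) (A₁.tensorh_gammaT A₂),
    (A₁.cobarBar.tensor' A₂.cobarBar).hom_eq_lift_comp hF (A₁.nabla A₂) ht
      (A₁.alpha_gammaT A₂) (A₁.tensorh'_gammaT A₂)⟩
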